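/- **Notation.** Let $N\ge 0$ be an integer, $\omega=e^{2\pi i/3}$, $\omega^a:=e^{2\pi i a/3}$. All roots and powers of $\lambda$, $\lambda_k$, $\mu_k$ are principal, with $\arg\in(-\pi,\pi)$. For $M\in\mathbb Z$ put $$f(\lambda;M)=\frac{i^M}{\sqrt{2\pi}}\int_{\mathbb R+i\epsilon}\frac{e^{ix^3/3+ix\lambda}}{x^M}\,dx\quad(\epsilon>0),$$ and put $g(\lambda;0)=1$ and $g(\lambda;N)=\frac{(-i)^N}{\Gamma(N)}\int_0^{+\infty e^{i\epsilon}}x^{N-1}e^{ix^3/3+ix\lambda}\,dx$ for $N\ge1$ ($0<\epsilon<\pi/3$); neither depends on $\epsilon$. Fix angles $-\pi<\beta_-<-\frac\pi3<\beta_0<\frac\pi3<\beta_+<\pi$ and let $I,II,III,IV$ be the open sectors $-\pi<\arg\lambda<\beta_-$, $\beta_-<\arg\lambda<\beta_0$, $\beta_0<\arg\lambda<\beta_+$, $\beta_+<\arg\lambda<\pi$. With $\nabla=(1,\partial_\lambda,\partial_\lambda^2)^\top$ (acting on functions of $\lambda$) let $\Psi(\lambda)$ be the $3\times3$ matrix with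 columns - in $I$: $\omega^{-N}\nabla g(\omega^{-1}\lambda;N),\ \omega^{-N}\nabla f(\omega^{-1}\lambda;1-N),\ i\omega^{-N/2}\nabla f(\omega\lambda;1-N)$; - in $II$: $\omega^{N}\nabla g(\omega\lambda;N),\ -\nabla f(\lambda;1-N),\ i\omega^{-N/2}\nabla f(\omega\lambda;1-N)$; - in $III$: $\nabla g(\lambda;N),\ -\nabla f(\lambda;1-N),\ -i\omega^{N/2}\nabla f(\omega^{-1}\lambda;1-N)$; - in $IV$: $\omega^{-N}\nabla g(\omega^{-1}\lambda;N),\ \omega^{N}\nabla f(\omega\lambda;1-N),\ -i\omega^{N/2}\nabla f(\omega^{-1}\lambda;1-N)$. Put $\Gamma_0=\Psi e^{-\vartheta}$, $\vartheta=\mathrm{diag}(0,-\frac23\lambda^{3/2},\frac23\lambda^{3/2})$, $S=\mathrm{diag}(-\frac12,-\frac12,0)$, $L=\mathrm{diag}(-N+\frac12,\frac N2+\frac14,\frac N2+\frac14)$ and $$G=\begin{bmatrix}1&0&0\\0&\frac1{\sqrt2}&\frac1{\sqrt2}\\0&-\frac1{\sqrt2}&\frac1{\sqrt2}\end{bmatrix}.$$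 Let $n=n_1+n_2$ and let $\vec\lambda=(\lambda_1,\dots,\lambda_{n_1})$, $\vec\mu=(\mu_1,\dots,\mu_{n_2})$ be points of $I\cup II\cup III\cup IV$. Put $$D_n=\mathrm{diag}(\alpha,\pi_+,\pi_-),\quad \alpha=\prod_j\sqrt{\lambda_j}\prod_j\sqrt{\mu_j},\quad \pi_\pm=\prod_{j}(\sqrt{\lambda_j}\pm\sqrt\lambda)\prod_{j}(\sqrt{\mu_j}\mp\sqrt\lambda),$$ $$H_\infty=\lambda^SG\,\mathrm{diag}(1,(-1)^n\lambda^{n/2},\lambda^{n/2})\,G^{-1}\lambda^{-S},\qquad G_\infty=\Gamma_0D_n\lambda^{-L}G^{-1}\lambda^{-S}H_\infty^{-1}.$$ **Statement.** As $\lambda\to\infty$ in $I\cup II\cup III\cup IV$, $G_\infty$ has a unique asymptotic expansion $G_\infty(\lambda)\sim\sum_{m\ge0}c_m\lambda^{-m}$ in nonpositive integer powers of $\lambda$. Let $\mathbf G$ be the $n\times n$ characteristic matrix $$\mathbf G_{k,\ell}=\mathop{\mathrm{res}}_{\lambda=\infty}\frac{\lambda^{\lfloor(\ell-1)/2\rfloor}}{\lambda-\zeta_k}\,A_k\,G_\infty(\lambda)\,\mathbf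 e_{2+(\ell\bmod 2)},$$ where $\zeta_k=\lambda_k$, $A_k=\mathbf e_3^\top\Gamma_0^{-1}(\lambda_k)$ for $k\le n_1$ and $\zeta_{n_1+k}=\mu_k$, $A_{n_1+k}=\mathbf e_2^\top\Gamma_0^{-1}(\mu_k)$ for $1\le k\le n_2$, and $\mathrm{res}_{\lambda=\infty}$ is the formal residue (minus the coefficient of $\lambda^{-1}$) of the expansion in powers of $1/\lambda$. Then $$\det\mathbf G=\pm\,e^{Q(\vec\lambda,\vec\mu)}\det\big[\phi_k^{(j-1)}(\zeta_k)\big]_{k,j=1}^n,\qquad Q(\vec\lambda,\vec\mu)=\tfrac23\sum_{j=1}^{n_1}\lambda_j^{3/2}-\tfrac23\sum_{j=1}^{n_2}\mu_j^{3/2},$$ where $\phi_k^{(j-1)}$ is the $(j-1)$-st derivative of the function $\phi_k$ given, for $k\le n_1$, by $$\phi_k(x)=\omega^{N+\frac12}f(\omega^{-1}x;N)\ (\lambda_k\in I),\quad f(x;N)\ (\lambda_k\in II\cup III),\quad \omega^{-N-\frac12}f(\omega x;N)\ (\lambda_k\in IV),$$ and, for $1\le k\le n_2$, by $$\phi_{n_1+k}(x)=\omega^{\frac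 N2+\frac14}f(\omega x;N)\ (\mu_k\in I\cup II),\quad \omega^{-\frac N2-\frac14}f(\omega^{-1}x;N)\ (\mu_k\in III\cup IV).$$ The sign depends only on $n_1$ and $n_2$. -/

import Mathlib

namespace KontsevichPenner

noncomputable section

open Complex MeasureTheory Asymptotics

/-- The power `ω ^ a` of `ω = e^{2πi/3}`, that is `e^{2πia/3}`. -/
def omegaPow (a : ℂ) : ℂ := exp (2 * Real.pi * I * a / 3)

/-- The principal square root. -/
def sqrtC (z : ℂ) : ℂ := z ^ (1 / 2 : ℂ)

/-- `f(z; M) = i^M / √(2π) ∫_{ℝ + i} exp(i x³/3 + i x z) x^{-M} dx`, for an integer `M`.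
(By Cauchy's theorem the integral over `ℝ + iε` does not depend on `ε > 0`; the line is `ε = 1`.) -/
def f (M : ℤ) (z : ℂ) : ℂ :=
  I ^ M / (Real.sqrt (2 * Real.pi) : ℂ) *
    ∫ t : ℝ, exp (I * ((t : ℂ) + I) ^ 3 / 3 + I * ((t : ℂ) + I) * z) / ((t : ℂ) + I) ^ M

/-- The direction `e^{iπ/6}` of the ray of integration that defines `g`. -/
def gRay : ℂ := exp (I * Real.pi / 6)

/-- `g(z; 0) = 1` and
`g(z; N) = (-i)^N / Γ(N) ∫_0^{+∞ e^{iε}} x^{N-1} exp(i x³/3 + i x z) dx` for `N ≥ 1`.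
(The integral does not depend on `0 < ε < π/3`; the ray is `ε = π/6`, parametrized as
`x = t e^{iπ/6}`, `t > 0`.) -/
def g (N : ℕ) (z : ℂ) : ℂ :=
  if N = 0 then 1
  else (-I) ^ N / Gamma (N : ℂ) *
    ∫ t in Set.Ioi (0 : ℝ), ((t : ℂ) * gRay) ^ (N - 1) *
      exp (I * ((t : ℂ) * gRay) ^ 3 / 3 + I * ((t : ℂ) * gRay) * z) * gRay

/-- The three angles that bound the sectors. -/
structure Angles where
  betaMinus : ℝ
  betaZero : ℝ
  betaPlus : ℝ
  neg_pi_lt : -Real.pi < betaMinus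
  betaMinus_lt : betaMinus < -(Real.pi / 3)
  lt_betaZero : -(Real.pi / 3) < betaZero
  betaZero_lt : betaZero < Real.pi / 3
  lt_betaPlus : Real.pi / 3 < betaPlus
  betaPlus_lt : betaPlus < Real.pi

/-- `-π < arg z < β₋`. -/
def sectorI (b : Angles) : Set ℂ := {z | z ≠ 0 ∧ -Real.pi < z.arg ∧ z.arg < b.betaMinus}

/-- `β₋ < arg z < β₀`. -/
def sectorII (b : Angles) : Set ℂ := {z | z ≠ 0 ∧ b.betaMinus < z.arg ∧ z.arg < b.betaZero}

/-- `β₀ < arg z < β₊`. -/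
def sectorIII (b : Angles) : Set ℂ := {z | z ≠ 0 ∧ b.betaZero < z.arg ∧ z.arg < b.betaPlus}

/-- `β₊ < arg z < π`. -/
def sectorIV (b : Angles) : Set ℂ := {z | z ≠ 0 ∧ b.betaPlus < z.arg ∧ z.arg < Real.pi}

/-- The union of the four open sectors, i.e. the complement of the contour `Σ`. -/
def sectors (b : Angles) : Set ℂ := sectorI b ∪ sectorII b ∪ sectorIII b ∪ sectorIV b

/-- The column vector `∇u = (u, u', u'')` at `z`. -/
def nabla (u : ℂ → ℂ) (z : ℂ) : Fin 3 → ℂ := fun i => iteratedDeriv i u z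

/-- The `3 × 3` matrix with the given columns. -/
def ofCols (c₁ c₂ c₃ : Fin 3 → ℂ) : Matrix (Fin 3) (Fin 3) ℂ :=
  Matrix.of fun i j => ![c₁, c₂, c₃] j i

open scoped Classical in
/-- The sectionally analytic fundamental matrix `Ψ` of the bare system
`∂Ψ = [[0,1,0],[0,0,1],[N,z,0]] Ψ` (with value `0` outside the four sectors). -/
def Psi (N : ℕ) (b : Angles) (z : ℂ) : Matrix (Fin 3) (Fin 3) ℂ :=
  if z ∈ sectorI b then
    ofCols
      (omegaPow (-N) • nabla (fun x => g N (omegaPow (-1) * x)) z)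
      (omegaPow (-N) • nabla (fun x => f (1 - N) (omegaPow (-1) * x)) z)
      ((I * omegaPow (-N / 2)) • nabla (fun x => f (1 - N) (omegaPow 1 * x)) z)
  else if z ∈ sectorII b then
    ofCols
      (omegaPow N • nabla (fun x => g N (omegaPow 1 * x)) z)
      (-nabla (fun x => f (1 - N) x) z)
      ((I * omegaPow (-N / 2)) • nabla (fun x => f (1 - N) (omegaPow 1 * x)) z)
  else if z ∈ sectorIII b then
    ofCols
      (nabla (fun x => g N x) z)
      (-nabla (fun x => f (1 - N) x) z)
      ((-(I * omegaPow (N / 2))) • nabla (fun x => f (1 - N) (omegaPow (-1) * x)) z)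
  else if z ∈ sectorIV b then
    ofCols
      (omegaPow (-N) • nabla (fun x => g N (omegaPow (-1) * x)) z)
      (omegaPow N • nabla (fun x => f (1 - N) (omegaPow 1 * x)) z)
      ((-(I * omegaPow (N / 2))) • nabla (fun x => f (1 - N) (omegaPow (-1) * x)) z)
  else 0

/-- `e^{-ϑ(z)}`, where `ϑ(z) = diag(0, -(2/3) z^{3/2}, (2/3) z^{3/2})`. -/
def expNegTheta (z : ℂ) : Matrix (Fin 3) (Fin 3) ℂ :=
  Matrix.diagonal ![1, exp (2 / 3 * z ^ (3 / 2 : ℂ)), exp (-(2 / 3 * z ^ (3 / 2 : ℂ)))]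

/-- `Γ₀ = Ψ e^{-ϑ}`. -/
def Gamma0 (N : ℕ) (b : Angles) (z : ℂ) : Matrix (Fin 3) (Fin 3) ℂ :=
  Psi N b z * expNegTheta z

/-- `z^S`, where `S = diag(-1/2, -1/2, 0)`. -/
def powS (z : ℂ) : Matrix (Fin 3) (Fin 3) ℂ :=
  Matrix.diagonal ![z ^ (-(1 / 2) : ℂ), z ^ (-(1 / 2) : ℂ), 1]

/-- `z^L`, where `L = diag(-N + 1/2, N/2 + 1/4, N/2 + 1/4)`. -/
def powL (N : ℕ) (z : ℂ) : Matrix (Fin 3) (Fin 3) ℂ :=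
  Matrix.diagonal
    ![z ^ (-N + 1 / 2 : ℂ), z ^ (N / 2 + 1 / 4 : ℂ), z ^ (N / 2 + 1 / 4 : ℂ)]

/-- The constant matrix `G` of the asymptotic expansion of `Ψ`. -/
def Gmat : Matrix (Fin 3) (Fin 3) ℂ :=
  let s : ℂ := 1 / (Real.sqrt 2 : ℂ)
  !![1, 0, 0; 0, s, s; 0, -s, s]

/-- The dressing matrix `D_n = diag(α, π₊, π₋)`. -/
def Dmat {n₁ n₂ : ℕ} (lam : Fin n₁ → ℂ) (mu : Fin n₂ → ℂ) (z : ℂ) :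
    Matrix (Fin 3) (Fin 3) ℂ :=
  Matrix.diagonal
    ![(∏ j, sqrtC (lam j)) * ∏ j, sqrtC (mu j),
      (∏ j, (sqrtC (lam j) + sqrtC z)) * ∏ j, (sqrtC (mu j) - sqrtC z),
      (∏ j, (sqrtC (lam j) - sqrtC z)) * ∏ j, (sqrtC (mu j) + sqrtC z)]

/-- `H_∞ = z^S G diag(1, (-1)^n z^{n/2}, z^{n/2}) G⁻¹ z^{-S}`. -/
def Hinf (n : ℕ) (z : ℂ) : Matrix (Fin 3) (Fin 3) ℂ :=
  powS z * Gmat *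
    Matrix.diagonal ![1, (-1) ^ n * z ^ (n / 2 : ℂ), z ^ (n / 2 : ℂ)] * Gmat⁻¹ * (powS z)⁻¹

/-- The jump matrix `J_∞ = Γ₀ D_n z^{-L} G⁻¹ z^{-S}`. -/
def Jinf (N : ℕ) (b : Angles) {n₁ n₂ : ℕ} (lam : Fin n₁ → ℂ) (mu : Fin n₂ → ℂ) (z : ℂ) :
    Matrix (Fin 3) (Fin 3) ℂ :=
  Gamma0 N b z * Dmat lam mu z * (powL N z)⁻¹ * Gmat⁻¹ * (powS z)⁻¹

/-- `G_∞ = J_∞ H_∞⁻¹`. -/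
def Ginf (N : ℕ) (b : Angles) {n₁ n₂ : ℕ} (lam : Fin n₁ → ℂ) (mu : Fin n₂ → ℂ) (z : ℂ) :
    Matrix (Fin 3) (Fin 3) ℂ :=
  Jinf N b lam mu z * (Hinf (n₁ + n₂) z)⁻¹

/-- `F(z) ~ ∑_m c_m z^{-m}` as `z → ∞` in `U`, entry by entry; the formal series `∑_m c_m z^{-m}`
is given as a power series in the variable `1/z`. -/
def HasExpansionAtInfinity (U : Set ℂ) (F : ℂ → Matrix (Fin 3) (Fin 3) ℂ)
    (c : Matrix (Fin 3) (Fin 3) (PowerSeries ℂ)) : Prop :=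
  ∀ (i j : Fin 3) (K : ℕ),
    (fun z => F z i j - ∑ m ∈ Finset.range K, PowerSeries.coeff m (c i j) * (z⁻¹) ^ m)
      =O[Bornology.cobounded ℂ ⊓ Filter.principal U] fun z => (z⁻¹) ^ K

/-- The variable `z` as a formal Laurent series in `1/z`. -/
def formalVar : LaurentSeries ℂ := HahnSeries.single (-1 : ℤ) (1 : ℂ)

/-- The formal residue at `z = ∞` of `h(z) dz`: minus the coefficient of `z^{-1}`. Here `h` is a
Laurent series in `1/z`. -/
def resInfinity (h : LaurentSeries ℂ) : ℂ := -(HahnSeries.coeff h 1)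

/-- The list `ζ = (λ_1, …, λ_{n₁}, μ_1, …, μ_{n₂})`. -/
def zeta {n₁ n₂ : ℕ} (lam : Fin n₁ → ℂ) (mu : Fin n₂ → ℂ) : Fin (n₁ + n₂) → ℂ :=
  Fin.append lam mu

/-- The row vectors `e₃ᵀ Γ₀⁻¹(λ_k)` and `e₂ᵀ Γ₀⁻¹(μ_k)`. -/
def rowA (N : ℕ) (b : Angles) {n₁ n₂ : ℕ} (lam : Fin n₁ → ℂ) (mu : Fin n₂ → ℂ) :
    Fin (n₁ + n₂) → Fin 3 → ℂ :=
  Fin.append (fun k => (Gamma0 N b (lam k))⁻¹ 2) (fun k => (Gamma0 N b (mu k))⁻¹ 1)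

/-- The characteristic matrix
`G_{k,ℓ} = res_{z=∞} z^{⌊(ℓ-1)/2⌋} / (z - ζ_k) · A_k G_∞(z) e_{2 + (ℓ mod 2)}`, `1 ≤ k, ℓ ≤ n`,
where `G_∞` is replaced by its formal expansion `c` at `z = ∞`. The indices of `Fin` start at `0`:
the column `ℓ` of the code is the column `ℓ + 1` of the formula. -/
def charMatrix (N : ℕ) (b : Angles) {n₁ n₂ : ℕ} (lam : Fin n₁ → ℂ) (mu : Fin n₂ → ℂ)
    (c : Matrix (Fin 3) (Fin 3) (PowerSeries ℂ)) :
    Matrix (Fin (n₁ + n₂)) (Fin (n₁ + n₂)) ℂ :=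
  Matrix.of fun k l =>
    resInfinity
      (formalVar ^ ((l : ℕ) / 2) * (formalVar - HahnSeries.C (zeta lam mu k))⁻¹ *
        ∑ i : Fin 3, HahnSeries.C (rowA N b lam mu k i) *
          HahnSeries.ofPowerSeries ℤ ℂ (c i (if (l : ℕ) % 2 = 0 then 2 else 1)))

open scoped Classical in
/-- The function attached to a point `p = λ_k`, depending on the sector of `p`. -/
def phiLam (N : ℕ) (b : Angles) (p : ℂ) : ℂ → ℂ :=
  if p ∈ sectorI b then fun x => omegaPow (N + 1 / 2) * f N (omegaPow (-1) * x)
  else if p ∈ sectorII b ∪ sectorIII b then fun x => f N x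
  else fun x => omegaPow (-N - 1 / 2) * f N (omegaPow 1 * x)

open scoped Classical in
/-- The function attached to a point `p = μ_k`, depending on the sector of `p`. -/
def phiMu (N : ℕ) (b : Angles) (p : ℂ) : ℂ → ℂ :=
  if p ∈ sectorI b ∪ sectorII b then fun x => omegaPow (N / 2 + 1 / 4) * f N (omegaPow 1 * x)
  else fun x => omegaPow (-N / 2 - 1 / 4) * f N (omegaPow (-1) * x)

/-- The Wronskian matrix `[φ_k^{(j-1)}(ζ_k)]`, `1 ≤ k, j ≤ n`. -/
def wronskianMatrix (N : ℕ) (b : Angles) {n₁ n₂ : ℕ} (lam : Fin n₁ → ℂ) (mu : Fin n₂ → ℂ) :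
    Matrix (Fin (n₁ + n₂)) (Fin (n₁ + n₂)) ℂ :=
  Matrix.of fun k j =>
    iteratedDeriv j
      ((Fin.append (fun k => phiLam N b (lam k)) (fun k => phiMu N b (mu k)) :
        Fin (n₁ + n₂) → ℂ → ℂ) k)
      (zeta lam mu k)

/-- `Q = (2/3) ∑ λ_j^{3/2} - (2/3) ∑ μ_j^{3/2}`. -/
def Q {n₁ n₂ : ℕ} (lam : Fin n₁ → ℂ) (mu : Fin n₂ → ℂ) : ℂ :=
  2 / 3 * ∑ j, lam j ^ (3 / 2 : ℂ) - 2 / 3 * ∑ j, mu j ^ (3 / 2 : ℂ)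

end

end KontsevichPenner

namespace KontsevichPenner

open Complex MeasureTheory Asymptotics Filter Topology

noncomputable section

/-! The columns of `Psi` are the vectors (u, u', u'') of solutions of u''' = z u' + N u, a system v'
= A v with a traceless companion matrix A. The adjoint row system r' = -r A is solved by r = (φ'' -
zφ, -φ', φ) whenever φ''' = z φ' + (1 - N) φ, and f(·; N), rotated by a cube root of unity, is such
a φ. The pairing of a solution with an adjoint solution is constant in z. It is zero when the
product decays along a suitable ray, and it is ±1, read off from leading asymptotics, when the
exponentials cancel. Hence the rows of Γ₀⁻¹ that enter the characteristic matrix are explicit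
exponentials times the adjoint rows of the functions φ_k; these exponentials produce e^Q
(`fRow_pairing_eq_zero`, `fRow_pairing_cross`, `Chart.gamma0_inv_two`, `Chart.gamma0_inv_one`).

At infinity, the second and third columns of Γ₀ and the corresponding dressing factors are given by
the same power series, evaluated at t = z^{-1/2} and at -t. Conjugation by G and z^S takes the even
and odd parts in t. This is why G_∞ expands in integer powers of 1/z, with the same coefficients in
all four sectors (`Chart.hasExp_ginf`). The residue against z^m/(z - ζ) extracts a polynomial part
at ζ. Up to sign, the l-th column of the characteristic matrix, l counted from 0, thus pairs the
rows with the polynomial part (integer powers only) of z^{l/2} · P(t) · v, where v is the formal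
solution without its exponential and power prefactor and P is the dressing series
(`charMatrix_apply`).

The decisive point is `exists_diffOperator`: the adjoint row of φ, paired with the polynomial part
of z^{l/2} v, equals m_l(∂)φ for a monic polynomial m_l of degree l with constant coefficients, the
same for all φ. The reason is that z^{l/2} v satisfies w' - A w = z^{(l+1)/2} v + const ·
z^{(l-2)/2} v, so differentiating the pairing at level l gives level l + 1 up to lower levels.
Expanding P only adds lower-order operators. The characteristic matrix is therefore diag(row
factors) · Wronskian · T, with T upper triangular and with diagonal entries ±1 that depend only on l
and n₁ (`det_charMatrix`).

The analytic input is the full expansion of f, by shifting the line to the saddle i√z, and of g, by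
integrating term by term along a ray adapted to arg z. The recurrences that make v a formal solution
are proved for the explicit coefficients, from the recurrence of Gaussian moments, so no asymptotic
expansion has to be differentiated. -/

/-! ### The contour integral f: independence of the line, derivative, recurrence -/

/-- The integrand of `f`. -/
def integrandF (M : ℤ) (z x : ℂ) : ℂ := exp (I * x ^ 3 / 3 + I * x * z) / x ^ M

lemma f_eq (M : ℤ) (z : ℂ) :
    f M z = I ^ M / (Real.sqrt (2 * Real.pi) : ℂ) * ∫ t : ℝ, integrandF M z ((t : ℂ) + I) := rfl

/-- The derivative in `x` stays inside the family, with exponents shifted by -2, 0 and +1. A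
vanishing integral of this derivative is therefore a three-term relation between integrals of the
family. -/
lemma hasDerivAt_integrandF (M : ℤ) (z : ℂ) {x : ℂ} (hx : x ≠ 0) :
    HasDerivAt (integrandF M z)
      (I * integrandF (M - 2) z x + I * z * integrandF M z x - M * integrandF (M + 1) z x) x := by
  have h1 : HasDerivAt (fun x : ℂ => I * x ^ 3 / 3 + I * x * z) (I * x ^ 2 + I * z) x := by
    have := (((hasDerivAt_pow 3 x).const_mul I).div_const 3).add
      (((hasDerivAt_id x).const_mul I).mul_const z)
    refine this.congr_deriv ?_
    push_cast; ring
  have h2 := h1.cexp.div (hasDerivAt_zpow M x (Or.inl hx)) (zpow_ne_zero M hx)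
  refine h2.congr_deriv ?_
  simp only [integrandF]
  have e1 : x ^ (M - 1) = x ^ M / x := by rw [zpow_sub_one₀ hx]; rfl
  have e2 : x ^ (M - 2) = x ^ M / x ^ 2 := by rw [zpow_sub₀ hx]; norm_cast
  have e3 : x ^ (M + 1) = x ^ M * x := zpow_add_one₀ hx M
  have := zpow_ne_zero M hx
  rw [e1, e2, e3]
  field_simp

lemma norm_exp_phase (x z : ℂ) :
    ‖exp (I * x ^ 3 / 3 + I * x * z)‖ =
      Real.exp (-x.im * x.re ^ 2 + x.im ^ 3 / 3 - x.re * z.im - x.im * z.re) := by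
  rw [Complex.norm_exp]
  congr 1
  have : I * x ^ 3 / 3 = (x ^ 3 * I) * ((1 / 3 : ℝ) : ℂ) := by push_cast; ring
  rw [this]
  simp [pow_succ]
  ring

/-- On the strip ε ≤ Im x ≤ R both |x| and 1/|x| are at most 1/ε + R + |Re x|, so one bound serves
both signs of `M`. -/
lemma norm_zpow_inv_le {ε R : ℝ} (hε : 0 < ε) (M : ℤ) {x : ℂ} (h1 : ε ≤ x.im) (h2 : x.im ≤ R) :
    ‖(x ^ M)⁻¹‖ ≤ (1 / ε + R + |x.re|) ^ M.natAbs := by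
  have hx : ε ≤ ‖x‖ := h1.trans ((le_abs_self _).trans (Complex.abs_im_le_norm x))
  have hx' : ‖x‖ ≤ R + |x.re| := by
    have := Complex.norm_le_abs_re_add_abs_im x
    rw [abs_of_pos (hε.trans_le h1)] at this
    linarith
  have hpos : 0 < ‖x‖ := hε.trans_le hx
  have hinv : ‖x‖⁻¹ ≤ 1 / ε + R + |x.re| := by
    have : ‖x‖⁻¹ ≤ 1 / ε := by rw [one_div]; exact inv_anti₀ hε hx
    have := abs_nonneg x.re
    linarith [hε.le.trans (h1.trans h2)]
  have hle : ‖x‖ ≤ 1 / ε + R + |x.re| := by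
    have : 0 < 1 / ε := by positivity
    linarith
  rw [norm_inv, norm_zpow]
  rcases Int.natAbs_eq M with h | h
  · rw [h, zpow_natCast, ← inv_pow, Int.natAbs_natCast]
    exact pow_le_pow_left₀ (by positivity) hinv _
  · rw [h, zpow_neg, zpow_natCast, inv_inv, Int.natAbs_neg, Int.natAbs_natCast]
    exact pow_le_pow_left₀ (by positivity) hle _

/-- The phase decays like exp(-Im x · (Re x)²). Half of this rate is kept; the other half absorbs
the power of x and the terms linear in Re x. The bound is uniform in x on a strip and in bounded z,
so it dominates derivatives both in z and in the position of the line. -/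
lemma norm_integrandF_le (M : ℤ) {ε : ℝ} (hε : 0 < ε) (R : ℝ) :
    ∃ C : ℝ, 0 ≤ C ∧ ∀ x z : ℂ, ε ≤ x.im → x.im ≤ R → ‖z‖ ≤ R →
      ‖integrandF M z x‖ ≤ C * Real.exp (-(ε / 2) * x.re ^ 2) := by
  set k := M.natAbs
  refine ⟨k.factorial * Real.exp (1 / ε + R + R ^ 3 / 3 + R ^ 2 + (R + 1) ^ 2 / (2 * ε)),
    by positivity, fun x z h1 h2 hz => ?_⟩
  have hR : 0 < R := hε.trans_le (h1.trans h2)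
  have hy : 0 < x.im := hε.trans_le h1
  rw [integrandF, div_eq_mul_inv, norm_mul, norm_exp_phase]
  have hb := norm_zpow_inv_le hε M h1 h2
  have hb2 : (1 / ε + R + |x.re|) ^ k ≤ k.factorial * Real.exp (1 / ε + R + |x.re|) := by
    have := Real.pow_div_factorial_le_exp (1 / ε + R + |x.re|) (by positivity) k
    rwa [div_le_iff₀' (by positivity)] at this
  calc _ ≤ Real.exp (-x.im * x.re ^ 2 + x.im ^ 3 / 3 - x.re * z.im - x.im * z.re) *
        (k.factorial * Real.exp (1 / ε + R + |x.re|)) := by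
        gcongr; exact hb.trans hb2
    _ = k.factorial * Real.exp ((-x.im * x.re ^ 2 + x.im ^ 3 / 3 - x.re * z.im - x.im * z.re)
          + (1 / ε + R + |x.re|)) := by rw [mul_left_comm, ← Real.exp_add]
    _ ≤ k.factorial * Real.exp ((1 / ε + R + R ^ 3 / 3 + R ^ 2 + (R + 1) ^ 2 / (2 * ε))
          + (-(ε / 2) * x.re ^ 2)) := by
        refine mul_le_mul_of_nonneg_left (Real.exp_le_exp.2 ?_) (by positivity)
        have e1 : ε * x.re ^ 2 ≤ x.im * x.re ^ 2 := by gcongr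
        have e2 : x.im ^ 3 ≤ R ^ 3 := by gcongr
        have e3 : -(x.re * z.im) ≤ |x.re| * R := by
          calc -(x.re * z.im) ≤ |x.re * z.im| := neg_le_abs _
            _ = |x.re| * |z.im| := abs_mul _ _
            _ ≤ |x.re| * R := by gcongr; exact (Complex.abs_im_le_norm z).trans hz
        have e4 : -(x.im * z.re) ≤ R * R := by
          calc -(x.im * z.re) ≤ |x.im * z.re| := neg_le_abs _
            _ = |x.im| * |z.re| := abs_mul _ _
            _ ≤ R * R := by
              rw [abs_of_pos hy]; gcongr; exact (Complex.abs_re_le_norm z).trans hz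
        -- Completing the square; this is where (R + 1)²/(2ε) in the constant comes from.
        have e5 : (R + 1) * |x.re| ≤ ε / 2 * x.re ^ 2 + (R + 1) ^ 2 / (2 * ε) := by
          have : 0 ≤ (ε * |x.re| - (R + 1)) ^ 2 / (2 * ε) := by positivity
          have h3 : (ε * |x.re| - (R + 1)) ^ 2 / (2 * ε) =
              ε / 2 * x.re ^ 2 + (R + 1) ^ 2 / (2 * ε) - (R + 1) * |x.re| := by
            rw [← sq_abs x.re]; field_simp; ring
          linarith
        nlinarith
    _ = _ := by rw [Real.exp_add, mul_assoc]

lemma continuous_integrandF_line (M : ℤ) (z : ℂ) {w : ℂ} (hw : 0 < w.im) :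
    Continuous fun t : ℝ => integrandF M z ((t : ℂ) + w) := by
  refine continuous_iff_continuousAt.2 fun t => ?_
  have hne : (t : ℂ) + w ≠ 0 := fun h => by
    have := congrArg Complex.im h
    simp at this; exact hw.ne' this
  exact ((hasDerivAt_integrandF M z hne).continuousAt).comp
    (f := fun t : ℝ => (t : ℂ) + w) (by fun_prop)

lemma integrable_gauss_shift {ε : ℝ} (hε : 0 < ε) (C a : ℝ) :
    Integrable fun t : ℝ => C * Real.exp (-(ε / 2) * (t + a) ^ 2) :=
  ((integrable_exp_neg_mul_sq (half_pos hε)).comp_add_right a).const_mul C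

lemma integrable_integrandF (M : ℤ) (z : ℂ) {w : ℂ} (hw : 0 < w.im) :
    Integrable fun t : ℝ => integrandF M z ((t : ℂ) + w) := by
  obtain ⟨C, -, hC⟩ := norm_integrandF_le M hw (max w.im ‖z‖)
  refine (integrable_gauss_shift hw C w.re).mono'
    (continuous_integrandF_line M z hw).aestronglyMeasurable (Eventually.of_forall fun t => ?_)
  have := hC ((t : ℂ) + w) z (by simp) (by simp) (le_max_right _ _)
  simpa using this

lemma integral_deriv_integrandF (M : ℤ) (z : ℂ) {w : ℂ} (hw : 0 < w.im) :
    I * (∫ t : ℝ, integrandF (M - 2) z ((t : ℂ) + w))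
      + I * z * (∫ t : ℝ, integrandF M z ((t : ℂ) + w))
      - M * ∫ t : ℝ, integrandF (M + 1) z ((t : ℂ) + w) = 0 := by
  have i1 := (integrable_integrandF (M - 2) z hw).const_mul I
  have i2 := (integrable_integrandF M z hw).const_mul (I * z)
  have i3 := (integrable_integrandF (M + 1) z hw).const_mul (M : ℂ)
  have i12 : Integrable fun t : ℝ => I * integrandF (M - 2) z ((t : ℂ) + w)
      + I * z * integrandF M z ((t : ℂ) + w) := i1.add i2
  rw [← integral_const_mul, ← integral_const_mul, ← integral_const_mul, ← integral_add i1 i2,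
    ← integral_sub i12 i3]
  refine integral_eq_zero_of_hasDerivAt_of_integrable
    (f := fun t : ℝ => integrandF M z ((t : ℂ) + w)) (fun t => ?_) ((i1.add i2).sub i3)
    (integrable_integrandF M z hw)
  have hne : (t : ℂ) + w ≠ 0 := fun h => by
    have := congrArg Complex.im h
    simp at this; exact hw.ne' this
  have h := (hasDerivAt_integrandF M z hne).comp (t : ℂ) ((hasDerivAt_id (t : ℂ)).add_const w)
  simpa using h.comp_ofReal

/-- Moving the line is the same as differentiating in x, and the integral of a total derivative
vanishes. This plays the role of Cauchy's theorem. The shift `w` is complex because the saddle i√z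
is in general not on the imaginary axis. -/
lemma hasDerivAt_integral_line (M : ℤ) (z : ℂ) {w : ℂ} (hw : 0 < w.im) :
    HasDerivAt (fun w : ℂ => ∫ t : ℝ, integrandF M z ((t : ℂ) + w)) 0 w := by
  set ε := w.im / 2
  have hε : 0 < ε := by positivity
  set R := ‖w‖ + ε + ‖z‖
  obtain ⟨C1, hC1, h1⟩ := norm_integrandF_le (M - 2) hε R
  obtain ⟨C2, hC2, h2⟩ := norm_integrandF_le M hε R
  obtain ⟨C3, hC3, h3⟩ := norm_integrandF_le (M + 1) hε R
  set C := C1 + ‖z‖ * C2 + |(M : ℝ)| * C3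
  have him : ∀ v ∈ Metric.ball w ε, ε ≤ v.im ∧ v.im ≤ R ∧ |v.re - w.re| ≤ ε := by
    intro v hv
    have hd : ‖v - w‖ < ε := by rwa [Metric.mem_ball, dist_eq_norm] at hv
    have a1 := abs_le.1 ((Complex.abs_im_le_norm (v - w)).trans hd.le)
    have a2 := (Complex.abs_re_le_norm (v - w)).trans hd.le
    have a3 := (le_abs_self _).trans (Complex.abs_im_le_norm w)
    simp only [sub_im, sub_re] at a1 a2
    refine ⟨by simp only [ε] at *; linarith, ?_, a2⟩
    simp only [R]; linarith [norm_nonneg z]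
  have key := hasDerivAt_integral_of_dominated_loc_of_deriv_le (𝕜 := ℂ) (μ := volume)
    (F := fun (w : ℂ) (t : ℝ) => integrandF M z ((t : ℂ) + w))
    (F' := fun (w : ℂ) (t : ℝ) => I * integrandF (M - 2) z ((t : ℂ) + w)
      + I * z * integrandF M z ((t : ℂ) + w) - M * integrandF (M + 1) z ((t : ℂ) + w))
    (x₀ := w) (s := Metric.ball w ε)
    -- Replacing Re v by Re w costs half of the Gaussian rate and the constant `exp (ε ^ 3)`.
    (bound := fun t => C * Real.exp (ε ^ 3) * Real.exp (-((ε / 2) / 2) * (t + w.re) ^ 2))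
    (Metric.ball_mem_nhds w hε) ?_ (integrable_integrandF M z hw) ?_ ?_
    (integrable_gauss_shift (half_pos hε) _ _) ?_
  · refine key.2.congr_deriv ?_
    have i1 := (integrable_integrandF (M - 2) z hw).const_mul I
    have i2 := (integrable_integrandF M z hw).const_mul (I * z)
    have i3 := (integrable_integrandF (M + 1) z hw).const_mul (M : ℂ)
    have i12 : Integrable fun t : ℝ => I * integrandF (M - 2) z ((t : ℂ) + w)
        + I * z * integrandF M z ((t : ℂ) + w) := i1.add i2
    rw [integral_sub i12 i3, integral_add i1 i2, integral_const_mul, integral_const_mul,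
      integral_const_mul, integral_deriv_integrandF M z hw]
  · filter_upwards [Metric.ball_mem_nhds w hε] with v hv
    exact (continuous_integrandF_line M z (hε.trans_le (him v hv).1)).aestronglyMeasurable
  · exact ((((continuous_integrandF_line _ z hw).const_mul _).add
      ((continuous_integrandF_line _ z hw).const_mul _)).sub
      ((continuous_integrandF_line _ z hw).const_mul _)).aestronglyMeasurable
  · refine Eventually.of_forall fun t v hv => ?_
    obtain ⟨b1, b2, b3⟩ := him v hv
    have hz : ‖z‖ ≤ R := by simp only [R]; linarith [norm_nonneg w]
    have g1 := h1 (t + v) z (by simpa) (by simpa) hz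
    have g2 := h2 (t + v) z (by simpa) (by simpa) hz
    have g3 := h3 (t + v) z (by simpa) (by simpa) hz
    have hC0 : 0 ≤ C := by positivity
    calc ‖I * integrandF (M - 2) z (t + v) + I * z * integrandF M z (t + v)
          - M * integrandF (M + 1) z (t + v)‖
        ≤ ‖integrandF (M - 2) z (t + v)‖ + ‖z‖ * ‖integrandF M z (t + v)‖
          + |(M : ℝ)| * ‖integrandF (M + 1) z (t + v)‖ := by
          refine (norm_sub_le _ _).trans (add_le_add ((norm_add_le _ _).trans ?_) ?_)
          · simp
          · simp
      _ ≤ C1 * Real.exp (-(ε / 2) * (t + v : ℂ).re ^ 2)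
          + ‖z‖ * (C2 * Real.exp (-(ε / 2) * (t + v : ℂ).re ^ 2))
          + |(M : ℝ)| * (C3 * Real.exp (-(ε / 2) * (t + v : ℂ).re ^ 2)) := by gcongr
      _ = C * Real.exp (-(ε / 2) * (t + v : ℂ).re ^ 2) := by simp only [C]; ring
      _ ≤ C * Real.exp (ε ^ 3 + -((ε / 2) / 2) * (t + w.re) ^ 2) := by
          gcongr
          have : (t + w.re) ^ 2 ≤ 2 * (t + v.re) ^ 2 + 2 * ε ^ 2 := by
            have := sq_le_sq' (abs_le.1 b3).1 (abs_le.1 b3).2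
            nlinarith [sq_nonneg ((t + v.re) + (v.re - w.re))]
          have e : (t + v : ℂ).re = t + v.re := by simp
          rw [e]
          nlinarith [pow_pos hε 3]
      _ = _ := by rw [Real.exp_add]; ring
  · refine Eventually.of_forall fun t v hv => ?_
    have hne : (t : ℂ) + v ≠ 0 := fun h => by
      have := congrArg Complex.im h
      simp at this; exact (hε.trans_le (him v hv).1).ne' this
    have h := (hasDerivAt_integrandF M z hne).comp v ((hasDerivAt_id v).const_add (t : ℂ))
    exact h.congr_deriv (by simp)

lemma convex_im_pos : Convex ℝ {w : ℂ | 0 < w.im} :=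
  convex_halfSpace_im_gt 0

lemma f_eq_line (M : ℤ) (z : ℂ) {w : ℂ} (hw : 0 < w.im) :
    f M z = I ^ M / (Real.sqrt (2 * Real.pi) : ℂ) * ∫ t : ℝ, integrandF M z ((t : ℂ) + w) := by
  rw [f_eq]
  congr 1
  exact IsOpen.is_const_of_deriv_eq_zero (𝕜 := ℂ)
    (f := fun w : ℂ => ∫ t : ℝ, integrandF M z ((t : ℂ) + w)) (s := {w : ℂ | 0 < w.im})
    (isOpen_lt continuous_const Complex.continuous_im) convex_im_pos.isPreconnected
    (fun v hv => (hasDerivAt_integral_line M z hv).differentiableAt.differentiableWithinAt)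
    (fun v hv => (hasDerivAt_integral_line M z hv).deriv) (by simp) hw

/-- This is `integral_deriv_integrandF` with the normalizing powers of i put in. Together with f(·;
M)' = -f(·; M - 1) it becomes the third-order equation of `isSol_f`. -/
lemma f_recurrence (M : ℤ) (z : ℂ) : f (M - 2) z = z * f M z + M * f (M + 1) z := by
  have h := integral_deriv_integrandF M z (w := I) (by simp)
  have e1 : (I : ℂ) ^ (M - 2) = -I ^ M := by
    rw [zpow_sub₀ I_ne_zero]
    have : (I : ℂ) ^ (2 : ℤ) = -1 := by rw [← I_sq]; norm_cast
    rw [this]; ring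
  have e2 : (I : ℂ) ^ (M + 1) = I ^ M * I := zpow_add_one₀ I_ne_zero M
  rw [f_eq, f_eq, f_eq, e1, e2]
  linear_combination (I * I ^ M / (Real.sqrt (2 * Real.pi) : ℂ)) * h +
    (-(I ^ M / (Real.sqrt (2 * Real.pi) : ℂ)) * ((∫ t : ℝ, integrandF (M - 2) z ((t : ℂ) + I))
      + z * (∫ t : ℝ, integrandF M z ((t : ℂ) + I)))) * I_sq

lemma hasDerivAt_f (M : ℤ) (z : ℂ) : HasDerivAt (f M) (-f (M - 1) z) z := by
  have hI : 0 < (I : ℂ).im := by simp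
  obtain ⟨C, -, hC⟩ := norm_integrandF_le (M - 1) one_pos (‖z‖ + 1)
  have key := hasDerivAt_integral_of_dominated_loc_of_deriv_le (𝕜 := ℂ) (μ := volume)
    (F := fun (z : ℂ) (t : ℝ) => integrandF M z ((t : ℂ) + I))
    (F' := fun (z : ℂ) (t : ℝ) => I * integrandF (M - 1) z ((t : ℂ) + I))
    (x₀ := z) (s := Metric.ball z 1)
    (bound := fun t => C * Real.exp (-(1 / 2) * (t + 0) ^ 2))
    (Metric.ball_mem_nhds z one_pos)
    (Eventually.of_forall fun v => (continuous_integrandF_line M v hI).aestronglyMeasurable)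
    (integrable_integrandF M z hI)
    ((continuous_integrandF_line _ z hI).const_mul _).aestronglyMeasurable ?_
    (integrable_gauss_shift one_pos _ _) ?_
  · have h2 := key.2.const_mul (I ^ M / (Real.sqrt (2 * Real.pi) : ℂ))
    refine h2.congr_deriv ?_
    rw [f_eq, integral_const_mul]
    have e1 : (I : ℂ) ^ (M - 1) = -(I ^ M * I) := by
      rw [zpow_sub_one₀ I_ne_zero, inv_I]; ring
    rw [e1]; ring
  · refine Eventually.of_forall fun t v hv => ?_
    have hv' : ‖v‖ ≤ ‖z‖ + 1 := by
      have : ‖v - z‖ < 1 := by rwa [Metric.mem_ball, dist_eq_norm] at hv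
      linarith [norm_le_norm_add_norm_sub' v z]
    have := hC ((t : ℂ) + I) v (by simp) (by simp) hv'
    simpa using this
  · refine Eventually.of_forall fun t v hv => ?_
    have hne : (t : ℂ) + I ≠ 0 := fun h => by
      have := congrArg Complex.im h
      simp at this
    have h1 : HasDerivAt (fun v : ℂ => I * ((t : ℂ) + I) ^ 3 / 3 + I * ((t : ℂ) + I) * v)
        (I * ((t : ℂ) + I)) v := by
      simpa using ((hasDerivAt_id v).const_mul (I * ((t : ℂ) + I))).const_add
        (I * ((t : ℂ) + I) ^ 3 / 3)
    have h2 := h1.cexp.div_const (((t : ℂ) + I) ^ M)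
    refine h2.congr_deriv ?_
    simp only [integrandF]
    rw [zpow_sub_one₀ hne]
    have := zpow_ne_zero M hne
    field_simp

/-! ### Principal square roots and their real parts -/

lemma sqrtC_sq (z : ℂ) : sqrtC z ^ 2 = z := by
  simp [sqrtC]

lemma sqrtC_eq_of_sq {x z : ℂ} (h : x ^ 2 = z) (hx : 0 < x.re) : sqrtC z = x := by
  rw [sqrtC, ← h, one_div]
  exact Complex.sq_cpow_two_inv hx

lemma norm_sqrtC_sq (z : ℂ) : ‖sqrtC z‖ ^ 2 = ‖z‖ := by rw [← norm_pow, sqrtC_sq]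

lemma sqrtC_ne_zero {z : ℂ} (hz : z ≠ 0) : sqrtC z ≠ 0 := fun h => hz <| by
  rw [← sqrtC_sq z, h]; simp

lemma sqrtC_re {z : ℂ} (hz : z ≠ 0) :
    (sqrtC z).re = ‖sqrtC z‖ * Real.cos (z.arg / 2) := by
  have : Complex.log z * (1 / 2) = Complex.log z * ((1 / 2 : ℝ) : ℂ) := by push_cast; ring
  rw [sqrtC, cpow_def_of_ne_zero hz, this, Complex.norm_exp, Complex.exp_re]
  congr 2
  simp [Complex.log_im]
  ring

lemma sqrtC_re_pos {z : ℂ} (hz : z ≠ 0) (h : z.arg < Real.pi) : 0 < (sqrtC z).re := by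
  rw [sqrtC_re hz]
  refine mul_pos (norm_pos_iff.2 (sqrtC_ne_zero hz)) (Real.cos_pos_of_mem_Ioo ⟨?_, ?_⟩)
  · linarith [Complex.neg_pi_lt_arg z]
  · linarith

/-- Away from the negative axis √z stays in a closed subsector of the right half-plane. This makes
the saddle-point estimates uniform in arg z. -/
lemma sqrtC_re_ge {δ : ℝ} (hδ : 0 < δ) {z : ℂ} (hz : z ≠ 0)
    (h : |z.arg| ≤ Real.pi - δ) : Real.sin (δ / 2) * ‖sqrtC z‖ ≤ (sqrtC z).re := by
  rw [sqrtC_re hz, mul_comm, ← Real.cos_abs (z.arg / 2), abs_div, abs_two,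
    ← Real.cos_pi_div_two_sub]
  have := Real.pi_pos
  have h2 := abs_nonneg z.arg
  exact mul_le_mul_of_nonneg_left
    (Real.cos_le_cos_of_nonneg_of_le_pi (by linarith) (by linarith) (by linarith)) (norm_nonneg _)

/-! ### Gaussian moments -/

/-- The moments of the Gaussian weight `exp (-x ^ 2)`, divided by the zeroth one. -/
def gaussMoment : ℕ → ℂ
  | 0 => 1
  | 1 => 0
  | n + 2 => (n + 1) / 2 * gaussMoment n

lemma integrable_pow_mul_gauss (k : ℕ) {s : ℂ} (hs : 0 < s.re) :
    Integrable fun t : ℝ => (t : ℂ) ^ k * exp (-s * (t : ℂ) ^ 2) := by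
  have h := integrable_rpow_mul_exp_neg_mul_sq hs (s := (k : ℝ)) (by linarith [k.cast_nonneg (α := ℝ)])
  refine h.norm.mono' (by fun_prop) (Eventually.of_forall fun t => ?_)
  rw [norm_mul, norm_mul, Complex.norm_exp, Real.rpow_natCast, norm_pow, norm_pow,
    Complex.norm_real, Real.norm_of_nonneg (Real.exp_pos _).le]
  have : (-s * (t : ℂ) ^ 2).re = -s.re * t ^ 2 := by
    rw [← ofReal_pow, re_mul_ofReal]; simp
  rw [this]

lemma hasDerivAt_gauss (k : ℕ) (s : ℂ) (t : ℝ) :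
    HasDerivAt (fun t : ℝ => (t : ℂ) ^ k * exp (-s * (t : ℂ) ^ 2))
      (k * ((t : ℂ) ^ (k - 1) * exp (-s * (t : ℂ) ^ 2))
        - 2 * s * ((t : ℂ) ^ (k + 1) * exp (-s * (t : ℂ) ^ 2))) t := by
  have h := (hasDerivAt_pow k (t : ℂ)).mul (((hasDerivAt_pow 2 (t : ℂ)).const_mul (-s)).cexp)
  refine h.comp_ofReal.congr_deriv ?_
  push_cast; ring

/-- Integrating the derivative of t^{n+1} exp(-s t²) lowers the order by two. This works directly
for complex `s`, with no rotation of the line. -/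
lemma integral_pow_mul_gauss (k : ℕ) {s : ℂ} (hs : 0 < s.re) :
    ∫ t : ℝ, (t : ℂ) ^ k * exp (-s * (t : ℂ) ^ 2) =
      (Real.sqrt Real.pi : ℂ) * gaussMoment k * (sqrtC s ^ (k + 1))⁻¹ := by
  have hs0 : s ≠ 0 := fun h => by simp [h] at hs
  have hp := sqrtC_sq s
  have hp0 := sqrtC_ne_zero hs0
  have hpr : 0 < (sqrtC s).re := sqrtC_re_pos hs0 (by
    have := (abs_lt.1 ((Complex.abs_arg_lt_pi_div_two_iff).2 (Or.inl hs))).2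
    linarith [Real.pi_pos])
  induction k using Nat.twoStepInduction with
  | zero =>
    have h := integral_gaussian_complex hs
    simp only [pow_zero, one_mul, zero_add, pow_one, gaussMoment, mul_one]
    rw [h]
    -- The Gaussian integral is the principal root of π/s. It equals √π/√s because both have the
    -- same square and positive real part.
    refine sqrtC_eq_of_sq ?_ ?_
    · rw [mul_pow, inv_pow, hp, ← ofReal_pow, Real.sq_sqrt Real.pi_pos.le]; rfl
    · rw [re_ofReal_mul, inv_re]
      have := Complex.normSq_pos.2 hp0
      have := Real.sqrt_pos.2 Real.pi_pos
      positivity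
  | one =>
    have h := integral_eq_zero_of_hasDerivAt_of_integrable (hasDerivAt_gauss 0 s)
      (((integrable_pow_mul_gauss _ hs).const_mul _).sub
        ((integrable_pow_mul_gauss _ hs).const_mul _)) (integrable_pow_mul_gauss _ hs)
    simp only [Nat.cast_zero, zero_mul, zero_sub, zero_add] at h
    rw [integral_neg, integral_const_mul, neg_eq_zero, mul_eq_zero] at h
    rw [h.resolve_left (by simp [hs0])]
    simp [gaussMoment]
  | more n ih _ =>
    have h := integral_eq_zero_of_hasDerivAt_of_integrable (hasDerivAt_gauss (n + 1) s)
      (((integrable_pow_mul_gauss _ hs).const_mul _).sub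
        ((integrable_pow_mul_gauss _ hs).const_mul _)) (integrable_pow_mul_gauss _ hs)
    rw [integral_sub ((integrable_pow_mul_gauss _ hs).const_mul _)
        ((integrable_pow_mul_gauss _ hs).const_mul _), integral_const_mul, integral_const_mul,
        Nat.add_sub_cancel, ih] at h
    have e : sqrtC s ^ (n + 2 + 1) = s * sqrtC s ^ (n + 1) := by
      rw [show n + 2 + 1 = 2 + (n + 1) by ring, pow_add, hp]
    rw [gaussMoment, e]
    push_cast at h
    rw [mul_inv]
    have hs1 : s * s⁻¹ = 1 := mul_inv_cancel₀ hs0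
    linear_combination (-1 / 2 * s⁻¹) * h - (∫ a : ℝ, (a : ℂ) ^ (n + 2) * exp (-s * (a : ℂ) ^ 2)) * hs1

/-! ### Remainder estimates -/

/-- In the left half-plane the Taylor remainder is O(|w|^K) for all w, not only small w: for |w| ≥ 1
the exponential and each Taylor term are at most |w|^K. A global bound is needed because it is
integrated over a whole line or half-line. -/
lemma norm_exp_sub_sum_le_of_re_nonpos (K : ℕ) :
    ∃ C : ℝ, 0 ≤ C ∧ ∀ w : ℂ, w.re ≤ 0 →
      ‖exp w - ∑ k ∈ Finset.range K, w ^ k / (k.factorial : ℂ)‖ ≤ C * ‖w‖ ^ K := by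
  refine ⟨Real.exp 1 + (1 + K), by positivity, fun w hw => ?_⟩
  rcases le_total ‖w‖ 1 with h | h
  · calc _ ≤ ‖w‖ ^ K * Real.exp ‖w‖ := Complex.norm_exp_sub_sum_le_norm_mul_exp w K
      _ ≤ ‖w‖ ^ K * (Real.exp 1 + (1 + K)) := by
        gcongr
        have := Real.exp_le_exp.2 h
        linarith [K.cast_nonneg (α := ℝ)]
      _ = _ := mul_comm _ _
  · have h1 : ‖exp w‖ ≤ ‖w‖ ^ K := by
      rw [Complex.norm_exp]
      exact (Real.exp_le_one_iff.2 hw).trans (one_le_pow₀ h)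
    have h2 : ‖∑ k ∈ Finset.range K, w ^ k / (k.factorial : ℂ)‖ ≤ K * ‖w‖ ^ K := by
      refine (norm_sum_le _ _).trans ((Finset.sum_le_card_nsmul _ _ (‖w‖ ^ K) ?_).trans (by simp))
      intro k hk
      rw [norm_div, norm_pow, Complex.norm_natCast]
      refine (div_le_self (by positivity) ?_).trans
        (pow_le_pow_right₀ h (Finset.mem_range.1 hk).le)
      exact_mod_cast Nat.one_le_iff_ne_zero.2 k.factorial_ne_zero
    have := Real.exp_pos 1
    refine (norm_sub_le _ _).trans ?_
    nlinarith [pow_nonneg (norm_nonneg w) K]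

/-- The binomial coefficient with an integer upper entry, as a complex number. -/
def binomC (m : ℤ) (b : ℕ) : ℂ := ((Ring.choose m b : ℤ) : ℂ)

lemma binomC_zero_right (m : ℤ) : binomC m 0 = 1 := by simp [binomC]

lemma binomC_succ_succ (m : ℤ) (b : ℕ) :
    binomC (m + 1) (b + 1) = binomC m b + binomC m (b + 1) := by
  rw [binomC, Ring.choose_succ_succ]; push_cast; rfl

/-- Pascal's rule: multiplying the truncated binomial series by 1 + w raises the exponent by one, up
to a single term of order `K`. This drives the induction on the integer exponent below in both
directions. -/
lemma one_add_mul_sum_choose (m : ℤ) (K : ℕ) : ∃ e : ℂ, ∀ w : ℂ,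
    (1 + w) * ∑ b ∈ Finset.range K, binomC m b * w ^ b =
      (∑ b ∈ Finset.range K, binomC (m + 1) b * w ^ b) + e * w ^ K := by
  rcases K with _ | K
  · exact ⟨0, by simp⟩
  refine ⟨binomC m K, fun w => ?_⟩
  induction K with
  | zero => simp [binomC_zero_right]
  | succ K ih =>
    rw [Finset.sum_range_succ, mul_add, ih, Finset.sum_range_succ _ (K + 1),
      binomC_succ_succ]
    ring

/-- Going up multiplies the remainder by 1 + w and going down divides by it; the latter needs |1 +
w| ≥ κ. The polynomial growth (1 + |w|)^L is harmless against the Gaussian weight. -/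
lemma norm_zpow_sub_sum_choose_le {κ : ℝ} (hκ : 0 < κ) (K : ℕ) (m : ℤ) :
    ∃ (C : ℝ) (L : ℕ), 0 ≤ C ∧ ∀ w : ℂ, κ ≤ ‖1 + w‖ →
      ‖(1 + w) ^ m - ∑ b ∈ Finset.range K, binomC m b * w ^ b‖
        ≤ C * ‖w‖ ^ K * (1 + ‖w‖) ^ L := by
  induction m using Int.induction_on with
  | zero =>
    refine ⟨1, 0, zero_le_one, fun w _ => ?_⟩
    rcases K with _ | K
    · simp
    · rw [Finset.sum_range_succ', Finset.sum_eq_zero]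
      · simp [binomC]
      · intro b _
        simp [binomC, Ring.choose_zero_succ]
  | succ m ih =>
    obtain ⟨C, L, hC, h⟩ := ih
    obtain ⟨e, he⟩ := one_add_mul_sum_choose m K
    refine ⟨C + ‖e‖, L + 1, by positivity, fun w hw => ?_⟩
    have hne : 1 + w ≠ 0 := norm_pos_iff.1 (hκ.trans_le hw)
    have : (1 + w) ^ ((m : ℤ) + 1) - ∑ b ∈ Finset.range K, binomC ((m : ℤ) + 1) b * w ^ b
        = (1 + w) * ((1 + w) ^ (m : ℤ) - ∑ b ∈ Finset.range K, binomC (m : ℤ) b * w ^ b)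
          + e * w ^ K := by
      rw [zpow_add_one₀ hne, mul_sub, he]; ring
    rw [this]
    have h1 : ‖1 + w‖ ≤ 1 + ‖w‖ := (norm_add_le _ _).trans (by simp)
    have h2 : 1 ≤ (1 + ‖w‖) ^ (L + 1) := one_le_pow₀ (by linarith [norm_nonneg w])
    calc _ ≤ ‖1 + w‖ * ‖(1 + w) ^ (m : ℤ)
            - ∑ b ∈ Finset.range K, binomC (m : ℤ) b * w ^ b‖ + ‖e‖ * ‖w‖ ^ K := by
          refine (norm_add_le _ _).trans ?_
          rw [norm_mul, norm_mul, norm_pow]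
      _ ≤ (1 + ‖w‖) * (C * ‖w‖ ^ K * (1 + ‖w‖) ^ L) + ‖e‖ * ‖w‖ ^ K * (1 + ‖w‖) ^ (L + 1) := by
          exact add_le_add (mul_le_mul h1 (h w hw) (norm_nonneg _) (by positivity))
            (le_mul_of_one_le_right (by positivity) h2)
      _ = _ := by ring
  | pred m ih =>
    obtain ⟨C, L, hC, h⟩ := ih
    obtain ⟨e, he⟩ := one_add_mul_sum_choose (-(m : ℤ) - 1) K
    refine ⟨κ⁻¹ * (C + ‖e‖), L, by positivity, fun w hw => ?_⟩
    have hne : 1 + w ≠ 0 := norm_pos_iff.1 (hκ.trans_le hw)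
    have he' := he w
    rw [sub_add_cancel] at he'
    have : (1 + w) ^ (-(m : ℤ) - 1)
          - ∑ b ∈ Finset.range K, binomC (-(m : ℤ) - 1) b * w ^ b
        = (1 + w)⁻¹ * (((1 + w) ^ (-(m : ℤ))
          - ∑ b ∈ Finset.range K, binomC (-(m : ℤ)) b * w ^ b) - e * w ^ K) := by
      rw [zpow_sub_one₀ hne]
      field_simp
      linear_combination (-1 : ℂ) * he'
    rw [this, norm_mul, norm_inv]
    have h2 : 1 ≤ (1 + ‖w‖) ^ L := one_le_pow₀ (by linarith [norm_nonneg w])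
    calc _ ≤ κ⁻¹ * (C * ‖w‖ ^ K * (1 + ‖w‖) ^ L + ‖e‖ * ‖w‖ ^ K * (1 + ‖w‖) ^ L) := by
          gcongr
          refine (norm_sub_le _ _).trans (add_le_add (h w hw) ?_)
          rw [norm_mul, norm_pow]
          exact le_mul_of_one_le_right (by positivity) h2
      _ = _ := by ring

/-- The square [0, K)² splits into the antidiagonals of total degree below K, which form the
truncated Cauchy product, and the pairs of total degree at least K, which go into the error. -/
lemma sum_range_mul_range {R : Type*} [AddCommMonoid R] (F : ℕ → ℕ → R) (K : ℕ) :
    ∑ a ∈ Finset.range K, ∑ b ∈ Finset.range K, F a b =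
      (∑ n ∈ Finset.range K, ∑ q ∈ Finset.HasAntidiagonal.antidiagonal n, F q.1 q.2) +
      ∑ q ∈ (Finset.range K ×ˢ Finset.range K).filter (fun q => K ≤ q.1 + q.2), F q.1 q.2 := by
  rw [← Finset.sum_product', ← Finset.sum_filter_add_sum_filter_not _ (fun q => q.1 + q.2 < K)]
  simp only [not_lt]
  congr 1
  rw [← Finset.sum_fiberwise_of_maps_to (t := Finset.range K) (g := fun q : ℕ × ℕ => q.1 + q.2)]
  · refine Finset.sum_congr rfl fun n hn => Finset.sum_congr ?_ fun _ _ => rfl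
    ext ⟨a, b⟩
    simp only [Finset.mem_filter, Finset.mem_product, Finset.mem_range, Finset.HasAntidiagonal.mem_antidiagonal] at *
    omega
  · simp

/-! ### Saddle-point expansion of f -/

/-- The fourth root of `z`, as an iterated principal square root. -/
def root4 (z : ℂ) : ℂ := sqrtC (sqrtC z)

lemma root4_sq (z : ℂ) : root4 z ^ 2 = sqrtC z := sqrtC_sq _

lemma root4_ne_zero {z : ℂ} (hz : z ≠ 0) : root4 z ≠ 0 := sqrtC_ne_zero (sqrtC_ne_zero hz)

/-- With s = √z and x = i s + t, the phase is exactly -(2/3)s³ - s t² + i t³/3, the linear term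
vanishing at the saddle, and x = i s (1 - i t/s). -/
lemma f_saddle (M : ℤ) {z : ℂ} (hs : 0 < (sqrtC z).re) :
    f M z = (Real.sqrt (2 * Real.pi) : ℂ)⁻¹ * exp (-(2 / 3) * sqrtC z ^ 3) * (sqrtC z ^ M)⁻¹ *
      ∫ t : ℝ, exp (-sqrtC z * (t : ℂ) ^ 2) *
        (exp (I * (t : ℂ) ^ 3 / 3) * (1 + -I * t / sqrtC z) ^ (-M)) := by
  set s := sqrtC z with hsdef
  have hs0 : s ≠ 0 := fun h => by simp [h] at hs
  have hz : z = s ^ 2 := (sqrtC_sq z).symm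
  suffices key : ∀ t : ℝ, I ^ M * integrandF M z ((t : ℂ) + I * s) =
      exp (-(2 / 3) * s ^ 3) * (s ^ M)⁻¹ * (exp (-s * (t : ℂ) ^ 2) *
        (exp (I * (t : ℂ) ^ 3 / 3) * (1 + -I * t / s) ^ (-M)))  by
    rw [f_eq_line M z (w := I * s) (by simpa using hs), div_eq_mul_inv, mul_comm (I ^ M),
      mul_assoc, ← integral_const_mul, integral_congr_ae (Eventually.of_forall key),
      integral_const_mul]
    ring
  intro t
  simp only [integrandF]
  have e1 : I * ((t : ℂ) + I * s) ^ 3 / 3 + I * ((t : ℂ) + I * s) * z =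
      -(2 / 3) * s ^ 3 + (-s * (t : ℂ) ^ 2 + I * (t : ℂ) ^ 3 / 3) := by
    rw [hz]
    linear_combination (s ^ 3 / 3 * I ^ 2 + t * s ^ 2 * I + t ^ 2 * s - s ^ 3 / 3 + s ^ 3) * I_sq
  have hne : (1 + -I * t / s) ≠ 0 := fun h => by
    have h2 : s = I * t := by field_simp at h; linear_combination h
    rw [h2] at hs; simp at hs
  have e2 : (t : ℂ) + I * s = I * (s * (1 + -I * t / s)) := by
    field_simp
    linear_combination (t : ℂ) * I_sq
  rw [e1, exp_add, exp_add, e2, mul_zpow, mul_zpow, zpow_neg]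
  have h1 := zpow_ne_zero M I_ne_zero
  have h2 := zpow_ne_zero M hs0
  have h3 := zpow_ne_zero M hne
  field_simp

/-- The function `f`, normalized by its leading behaviour at infinity. -/
def normF (M : ℤ) (z : ℂ) : ℂ :=
  (Real.sqrt 2 : ℂ) * exp (2 / 3 * sqrtC z ^ 3) * sqrtC z ^ M * root4 z * f M z

lemma f_eq_normF (M : ℤ) {z : ℂ} (hz : z ≠ 0) :
    f M z = (Real.sqrt 2 : ℂ)⁻¹ * exp (-(2 / 3) * sqrtC z ^ 3) * (sqrtC z ^ M)⁻¹ * (root4 z)⁻¹ *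
      normF M z := by
  have h1 := zpow_ne_zero M (sqrtC_ne_zero hz)
  have h2 := root4_ne_zero hz
  have h3 : (Real.sqrt 2 : ℂ) ≠ 0 := by
    exact_mod_cast (Real.sqrt_pos.2 (by norm_num : (0 : ℝ) < 2)).ne'
  have h4 := exp_ne_zero (2 / 3 * sqrtC z ^ 3)
  rw [normF, neg_mul, exp_neg]
  field_simp

/-- The Taylor coefficients of `exp (i x ^ 3 / 3)` in `x ^ 3`. -/
def expCoeff (a : ℕ) : ℂ := (I / 3) ^ a / (a.factorial : ℂ)

/-- The Taylor coefficients of `(1 - i x) ^ (-M)`. -/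
def powCoeff (M : ℤ) (b : ℕ) : ℂ := binomC (-M) b * (-I) ^ b

/-- The coefficients of the asymptotic expansion of `normF`. -/
def airyCoeff (M : ℤ) (n : ℕ) : ℂ :=
  ∑ q ∈ Finset.HasAntidiagonal.antidiagonal n,
    expCoeff q.1 * powCoeff M q.2 * gaussMoment (3 * q.1 + q.2)

lemma airyCoeff_zero (M : ℤ) : airyCoeff M 0 = 1 := by
  simp [airyCoeff, expCoeff, powCoeff, gaussMoment, binomC_zero_right]

lemma integrable_one_add_abs_pow_gauss (L : ℕ) {κ : ℝ} (hκ : 0 < κ) :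
    Integrable fun v : ℝ => (1 + |v|) ^ L * Real.exp (-κ * v ^ 2) := by
  have h : ∀ v : ℝ, (1 + |v|) ^ L * Real.exp (-κ * v ^ 2) ≤
      (L.factorial * Real.exp (1 + 1 / (2 * κ))) * Real.exp (-(κ / 2) * v ^ 2) := fun v => by
    have h1 := Real.pow_div_factorial_le_exp (1 + |v|) (by positivity) L
    rw [div_le_iff₀' (by positivity)] at h1
    calc _ ≤ (L.factorial * Real.exp (1 + |v|)) * Real.exp (-κ * v ^ 2) := by gcongr
      _ = L.factorial * Real.exp ((1 + |v|) + -κ * v ^ 2) := by rw [mul_assoc, ← Real.exp_add]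
      _ ≤ L.factorial * Real.exp ((1 + 1 / (2 * κ)) + -(κ / 2) * v ^ 2) := by
        refine mul_le_mul_of_nonneg_left (Real.exp_le_exp.2 ?_) (by positivity)
        have : 0 ≤ (κ * |v| - 1) ^ 2 / (2 * κ) := by positivity
        have h3 : (κ * |v| - 1) ^ 2 / (2 * κ) = κ / 2 * v ^ 2 + 1 / (2 * κ) - |v| := by
          rw [← sq_abs v]; field_simp; ring
        linarith
      _ = _ := by rw [Real.exp_add, mul_assoc]
  refine ((integrable_exp_neg_mul_sq (half_pos hκ)).const_mul
    (L.factorial * Real.exp (1 + 1 / (2 * κ)))).mono' (by fun_prop)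
    (Eventually.of_forall fun v => ?_)
  rw [Real.norm_of_nonneg (by positivity)]
  exact h v

/-- Here `x` stands for i t³/3, `y` for -i t/s, `v` for the rescaled variable |s|^{1/2}|t| and `q`
for the small parameter |s|^{-3/2}. Both x and y are of first order in q, so truncating both series
at order `K` costs q^K times a polynomial in v. -/
lemma norm_truncation_error_le (M : ℤ) (K : ℕ) {κ : ℝ} (hκ : 0 < κ) :
    ∃ (C : ℝ) (L : ℕ), 0 ≤ C ∧ ∀ (x y : ℂ) (q v : ℝ), x.re ≤ 0 → κ ≤ ‖1 + y‖ → 0 ≤ q → q ≤ 1 →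
      0 ≤ v → ‖x‖ ≤ q * v ^ 3 → ‖y‖ ≤ q * v →
      ‖exp x * (1 + y) ^ (-M) - (∑ a ∈ Finset.range K, x ^ a / (a.factorial : ℂ)) *
        ∑ b ∈ Finset.range K, binomC (-M) b * y ^ b‖ ≤ C * q ^ K * (1 + v) ^ L := by
  obtain ⟨C1, hC1, h1⟩ := norm_exp_sub_sum_le_of_re_nonpos K
  obtain ⟨C2, L, hC2, h2⟩ := norm_zpow_sub_sum_choose_le hκ K (-M)
  set B := ∑ b ∈ Finset.range K, ‖binomC (-M) b‖
  refine ⟨C2 + C1 * B, K + L + 3 * K, by positivity, fun x y q v hx hy hq hq1 hv hxq hyq => ?_⟩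
  have hyv : ‖y‖ ≤ 1 + v := hyq.trans (by nlinarith)
  have hv1 : 1 ≤ 1 + v := by linarith
  have hS : ‖∑ b ∈ Finset.range K, binomC (-M) b * y ^ b‖ ≤ B * (1 + v) ^ K := by
    rw [Finset.sum_mul]
    refine norm_sum_le_of_le _ fun b hb => ?_
    rw [norm_mul, norm_pow]
    gcongr
    exact (pow_le_pow_left₀ (norm_nonneg _) hyv b).trans
      (pow_le_pow_right₀ hv1 (Finset.mem_range.1 hb).le)
  have hE : ‖exp x‖ ≤ 1 := by rw [Complex.norm_exp]; exact Real.exp_le_one_iff.2 hx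
  have key : exp x * (1 + y) ^ (-M) - (∑ a ∈ Finset.range K, x ^ a / (a.factorial : ℂ)) *
        ∑ b ∈ Finset.range K, binomC (-M) b * y ^ b =
      exp x * ((1 + y) ^ (-M) - ∑ b ∈ Finset.range K, binomC (-M) b * y ^ b) +
      (exp x - ∑ a ∈ Finset.range K, x ^ a / (a.factorial : ℂ)) *
        ∑ b ∈ Finset.range K, binomC (-M) b * y ^ b := by ring
  rw [key]
  refine (norm_add_le _ _).trans ?_
  rw [norm_mul, norm_mul]
  have t1 : ‖exp x‖ * ‖(1 + y) ^ (-M) - ∑ b ∈ Finset.range K, binomC (-M) b * y ^ b‖ ≤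
      C2 * q ^ K * (1 + v) ^ (K + L + 3 * K) := by
    calc _ ≤ 1 * (C2 * ‖y‖ ^ K * (1 + ‖y‖) ^ L) := by gcongr; exact h2 y hy
      _ ≤ 1 * (C2 * (q * (1 + v)) ^ K * (1 + v) ^ L) := by
        gcongr
        · exact hyq.trans (by gcongr; linarith)
        · exact hyq.trans (by nlinarith)
      _ = C2 * q ^ K * (1 + v) ^ (K + L) := by rw [mul_pow, pow_add]; ring
      _ ≤ _ := mul_le_mul_of_nonneg_left (pow_le_pow_right₀ hv1 (by omega)) (by positivity)
  have t2 : ‖exp x - ∑ a ∈ Finset.range K, x ^ a / (a.factorial : ℂ)‖ *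
      ‖∑ b ∈ Finset.range K, binomC (-M) b * y ^ b‖ ≤
      C1 * B * q ^ K * (1 + v) ^ (K + L + 3 * K) := by
    calc _ ≤ (C1 * ‖x‖ ^ K) * (B * (1 + v) ^ K) := by gcongr; exact h1 x hx
      _ ≤ (C1 * (q * (1 + v) ^ 3) ^ K) * (B * (1 + v) ^ K) := by
        gcongr
        exact hxq.trans (by gcongr; linarith)
      _ = C1 * B * q ^ K * (1 + v) ^ (3 * K + K) := by rw [mul_pow, pow_add, ← pow_mul]; ring
      _ ≤ _ := mul_le_mul_of_nonneg_left (pow_le_pow_right₀ hv1 (by omega)) (by positivity)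
  linarith

/-- Under the Gaussian t scales like s^{-1/2}, so t³ and t/s each contribute exactly one factor
s^{-3/2}. The term with indices a, b therefore has order a + b, and `airyCoeff` sums over
antidiagonals. -/
lemma integral_truncation (M : ℤ) (K : ℕ) {s : ℂ} (hs : 0 < s.re) :
    Integrable (fun t : ℝ => exp (-s * (t : ℂ) ^ 2) *
        ((∑ a ∈ Finset.range K, (I * (t : ℂ) ^ 3 / 3) ^ a / (a.factorial : ℂ)) *
        ∑ b ∈ Finset.range K, binomC (-M) b * (-I * t / s) ^ b)) ∧
    sqrtC s / (Real.sqrt Real.pi : ℂ) * ∫ t : ℝ, exp (-s * (t : ℂ) ^ 2) *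
        ((∑ a ∈ Finset.range K, (I * (t : ℂ) ^ 3 / 3) ^ a / (a.factorial : ℂ)) *
        ∑ b ∈ Finset.range K, binomC (-M) b * (-I * t / s) ^ b) =
      ∑ a ∈ Finset.range K, ∑ b ∈ Finset.range K,
        expCoeff a * powCoeff M b * gaussMoment (3 * a + b) * ((sqrtC s ^ 3)⁻¹) ^ (a + b) := by
  have hs0 : s ≠ 0 := fun h => by simp [h] at hs
  have hp0 := sqrtC_ne_zero hs0
  have hpi : (Real.sqrt Real.pi : ℂ) ≠ 0 := by
    exact_mod_cast (Real.sqrt_pos.2 Real.pi_pos).ne'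
  have e : ∀ t : ℝ, exp (-s * (t : ℂ) ^ 2) *
        ((∑ a ∈ Finset.range K, (I * (t : ℂ) ^ 3 / 3) ^ a / (a.factorial : ℂ)) *
        ∑ b ∈ Finset.range K, binomC (-M) b * (-I * t / s) ^ b) =
      ∑ a ∈ Finset.range K, ∑ b ∈ Finset.range K, expCoeff a * powCoeff M b * (s⁻¹) ^ b *
        ((t : ℂ) ^ (3 * a + b) * exp (-s * (t : ℂ) ^ 2)) := fun t => by
    rw [Finset.sum_mul_sum, Finset.mul_sum]
    refine Finset.sum_congr rfl fun a _ => ?_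
    rw [Finset.mul_sum]
    refine Finset.sum_congr rfl fun b _ => ?_
    rw [expCoeff, powCoeff, pow_add, pow_mul, mul_div_right_comm, mul_pow (I / 3), div_eq_mul_inv _ s,
      mul_pow _ s⁻¹, mul_pow (-I)]
    ring
  have hint : ∀ a b : ℕ, Integrable fun t : ℝ => expCoeff a * powCoeff M b * (s⁻¹) ^ b *
        ((t : ℂ) ^ (3 * a + b) * exp (-s * (t : ℂ) ^ 2)) := fun a b =>
    (integrable_pow_mul_gauss _ hs).const_mul _
  simp only [e]
  refine ⟨integrable_finsetSum _ fun a _ => integrable_finsetSum _ fun b _ => hint a b, ?_⟩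
  rw [integral_finsetSum _ fun a _ => integrable_finsetSum _ fun b _ => hint a b, Finset.mul_sum]
  refine Finset.sum_congr rfl fun a _ => ?_
  rw [integral_finsetSum _ fun b _ => hint a b, Finset.mul_sum]
  refine Finset.sum_congr rfl fun b _ => ?_
  rw [integral_const_mul, integral_pow_mul_gauss _ hs]
  have e1 : s⁻¹ ^ b = ((sqrtC s) ^ (2 * b))⁻¹ := by rw [pow_mul, sqrtC_sq, inv_pow]
  have e2 : sqrtC s ^ (3 * a + b + 1) = sqrtC s ^ (3 * a + b) * sqrtC s := pow_succ _ _
  have e3 : (sqrtC s ^ 3)⁻¹ ^ (a + b) = (sqrtC s ^ (2 * b))⁻¹ * (sqrtC s ^ (3 * a + b))⁻¹ := by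
    rw [inv_pow, ← pow_mul, ← mul_inv, ← pow_add]; congr 2; ring
  rw [e1, e2, e3, mul_inv]
  field_simp

/-- The expansion of `f` in a closed sector that avoids the negative axis. -/
lemma normF_expansion (M : ℤ) {δ : ℝ} (hδ : 0 < δ) (hδ' : δ ≤ Real.pi) (K : ℕ) :
    ∃ C : ℝ, ∀ z : ℂ, 1 ≤ ‖z‖ → |z.arg| ≤ Real.pi - δ →
      ‖normF M z - ∑ n ∈ Finset.range K, airyCoeff M n * ((root4 z ^ 3)⁻¹) ^ n‖ ≤
        C * ‖(root4 z ^ 3)⁻¹‖ ^ K := by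
  -- The same constant gives the Gaussian decay, Re s ≥ κ|s|, and the lower bound |1 - i t/s| ≥ κ.
  set κ := Real.sin (δ / 2)
  have hκ : 0 < κ := Real.sin_pos_of_pos_of_lt_pi (by positivity) (by linarith [Real.pi_pos])
  obtain ⟨C0, L, hC0, herr⟩ := norm_truncation_error_le M K hκ
  set J := ∫ v : ℝ, (1 + |v|) ^ L * Real.exp (-κ * v ^ 2)
  set D := ∑ q ∈ (Finset.range K ×ˢ Finset.range K).filter (fun q => K ≤ q.1 + q.2),
    ‖expCoeff q.1 * powCoeff M q.2 * gaussMoment (3 * q.1 + q.2)‖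
  refine ⟨(Real.sqrt Real.pi)⁻¹ * (C0 * J) + D, fun z hz harg => ?_⟩
  have hz0 : z ≠ 0 := norm_pos_iff.1 (one_pos.trans_le hz)
  set s := sqrtC z with hsdef
  set p := root4 z with hpdef
  have hp : p = sqrtC s := rfl
  have hs0 : s ≠ 0 := sqrtC_ne_zero hz0
  have hp0 : p ≠ 0 := sqrtC_ne_zero hs0
  have hsκ : κ * ‖s‖ ≤ s.re := sqrtC_re_ge hδ hz0 harg
  have hs : 0 < s.re := (mul_pos hκ (norm_pos_iff.2 hs0)).trans_le hsκ
  have hps : ‖p‖ ^ 2 = ‖s‖ := norm_sqrtC_sq s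
  have hs1 : 1 ≤ ‖s‖ := by
    have := norm_sqrtC_sq z
    rw [← hsdef] at this
    exact (one_le_sq_iff₀ (norm_nonneg _)).1 (this ▸ hz)
  have hp1 : 1 ≤ ‖p‖ := (one_le_sq_iff₀ (norm_nonneg _)).1 (hps ▸ hs1)
  set q := ‖(p ^ 3)⁻¹‖ with hqdef
  have hq : q = (‖p‖ ^ 3)⁻¹ := by rw [hqdef, norm_inv, norm_pow]
  have hq0 : 0 ≤ q := norm_nonneg _
  have hq1 : q ≤ 1 := by rw [hq]; exact inv_le_one_of_one_le₀ (one_le_pow₀ hp1)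
  have hppos : 0 < ‖p‖ := norm_pos_iff.2 hp0
  obtain ⟨hint, hmain⟩ := integral_truncation M K hs
  set T : ℝ → ℂ := fun t => (∑ a ∈ Finset.range K, (I * (t : ℂ) ^ 3 / 3) ^ a / (a.factorial : ℂ)) *
        ∑ b ∈ Finset.range K, binomC (-M) b * (-I * t / s) ^ b with hT
  set E : ℝ → ℂ := fun t => exp (I * (t : ℂ) ^ 3 / 3) * (1 + -I * t / s) ^ (-M) with hE
  -- Since t is real, Re(s - i t) = Re s ≥ κ|s|.
  have hlow : ∀ t : ℝ, κ ≤ ‖1 + -I * t / s‖ := fun t => by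
    have : 1 + -I * t / s = (s - I * t) / s := by field_simp; ring
    rw [this, norm_div, le_div_iff₀ (norm_pos_iff.2 hs0)]
    refine hsκ.trans ?_
    have h := (le_abs_self _).trans (Complex.abs_re_le_norm (s - I * t))
    simpa using h
  have hbound : ∀ t : ℝ, ‖exp (-s * (t : ℂ) ^ 2) * (E t - T t)‖ ≤
      C0 * q ^ K * ((1 + |‖p‖ * t|) ^ L * Real.exp (-κ * (‖p‖ * t) ^ 2)) := fun t => by
    have h1 := herr (I * (t : ℂ) ^ 3 / 3) (-I * t / s) q |‖p‖ * t| (by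
        
        have : I * (t : ℂ) ^ 3 / 3 = ((t ^ 3 / 3 : ℝ) : ℂ) * I := by push_cast; ring
        rw [this, re_ofReal_mul]; simp) (hlow t) hq0 hq1
        (abs_nonneg _) (by
          rw [norm_div, norm_mul, norm_I, norm_pow, Complex.norm_real, hq, abs_mul, mul_pow,
            abs_of_pos hppos, Real.norm_eq_abs, inv_mul_cancel_left₀ (by positivity)]
          have : 0 ≤ |t| ^ 3 := by positivity
          simp; linarith) (by
          rw [norm_div, norm_mul, norm_neg, norm_I, Complex.norm_real, hq, abs_mul,
            abs_of_pos hppos, Real.norm_eq_abs, ← hps]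
          apply le_of_eq; field_simp)
    rw [norm_mul, Complex.norm_exp, mul_comm]
    have e1 : (-s * (t : ℂ) ^ 2).re = -s.re * t ^ 2 := by
      rw [← ofReal_pow, re_mul_ofReal]; simp
    have e2 : Real.exp (-s.re * t ^ 2) ≤ Real.exp (-κ * (‖p‖ * t) ^ 2) := by
      refine Real.exp_le_exp.2 ?_
      rw [mul_pow, hps]
      nlinarith [sq_nonneg t, mul_le_mul_of_nonneg_right hsκ (sq_nonneg t)]
    rw [e1]
    calc _ ≤ (C0 * q ^ K * (1 + |‖p‖ * t|) ^ L) * Real.exp (-κ * (‖p‖ * t) ^ 2) := by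
          gcongr
      _ = _ := by ring
  have hGint : Integrable fun t : ℝ =>
      C0 * q ^ K * ((1 + |‖p‖ * t|) ^ L * Real.exp (-κ * (‖p‖ * t) ^ 2)) :=
    ((integrable_one_add_abs_pow_gauss L hκ).comp_mul_left' hppos.ne').const_mul _
  have hEc : Continuous E := by
    refine continuous_iff_continuousAt.2 fun t => ?_
    refine ContinuousAt.mul (by fun_prop) (ContinuousAt.zpow₀ (by fun_prop) _ (Or.inl ?_))
    exact norm_pos_iff.1 (hκ.trans_le (hlow t))
  have hdiff : Integrable fun t : ℝ => exp (-s * (t : ℂ) ^ 2) * (E t - T t) := by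
    refine hGint.mono' ?_ (Eventually.of_forall hbound)
    refine Continuous.aestronglyMeasurable (Continuous.mul (by fun_prop) (hEc.sub ?_))
    simp only [hT]; fun_prop
  have hsplit : ∫ t : ℝ, exp (-s * (t : ℂ) ^ 2) * E t =
      (∫ t : ℝ, exp (-s * (t : ℂ) ^ 2) * (E t - T t)) + ∫ t : ℝ, exp (-s * (t : ℂ) ^ 2) * T t := by
    rw [← integral_add hdiff hint]
    exact integral_congr_ae (Eventually.of_forall fun t => by ring)
  have hpi : (Real.sqrt Real.pi : ℂ) ≠ 0 := by
    exact_mod_cast (Real.sqrt_pos.2 Real.pi_pos).ne'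
  have h2 : (Real.sqrt 2 : ℂ) ≠ 0 := by
    exact_mod_cast (Real.sqrt_pos.2 (by norm_num : (0 : ℝ) < 2)).ne'
  have hnorm : normF M z = p / (Real.sqrt Real.pi : ℂ) * ∫ t : ℝ, exp (-s * (t : ℂ) ^ 2) * E t := by
    rw [normF, f_saddle M hs, ← hsdef, ← hpdef, neg_mul, exp_neg,
      Real.sqrt_mul (by norm_num : (0 : ℝ) ≤ 2)]
    have h4 := exp_ne_zero (2 / 3 * s ^ 3)
    have h3 := zpow_ne_zero M hs0
    simp only [hE]
    generalize (∫ t : ℝ, exp (-s * (t : ℂ) ^ 2) * (exp (I * (t : ℂ) ^ 3 / 3) *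
      (1 + -I * t / s) ^ (-M))) = J'
    push_cast
    field_simp
  -- The product of the two truncations contains the wanted sum and finitely many terms of order at
  -- least `K`; the latter are bounded by `D` times q^K.
  rw [hnorm, hsplit, mul_add, hp, hmain, ← hp, sum_range_mul_range]
  have hcoef : ∑ n ∈ Finset.range K, airyCoeff M n * (p ^ 3)⁻¹ ^ n =
      ∑ n ∈ Finset.range K, ∑ q ∈ Finset.HasAntidiagonal.antidiagonal n,
        expCoeff q.1 * powCoeff M q.2 * gaussMoment (3 * q.1 + q.2) * (p ^ 3)⁻¹ ^ (q.1 + q.2) := by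
    refine Finset.sum_congr rfl fun n _ => ?_
    rw [airyCoeff, Finset.sum_mul]
    refine Finset.sum_congr rfl fun q hq => ?_
    rw [Finset.HasAntidiagonal.mem_antidiagonal.1 hq]
  rw [hcoef, add_sub_assoc, add_sub_cancel_left]
  refine (norm_add_le _ _).trans ?_
  rw [add_mul]
  refine add_le_add ?_ ?_
  · have hI : ‖∫ t : ℝ, exp (-s * (t : ℂ) ^ 2) * (E t - T t)‖ ≤ C0 * q ^ K * (‖p‖⁻¹ * J) := by
      refine (norm_integral_le_of_norm_le hGint (Eventually.of_forall hbound)).trans (le_of_eq ?_)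
      rw [integral_const_mul, Measure.integral_comp_mul_left
        (fun v : ℝ => (1 + |v|) ^ L * Real.exp (-κ * v ^ 2)), abs_of_pos (inv_pos.2 hppos),
        smul_eq_mul]
    rw [norm_mul, norm_div, Complex.norm_real, Real.norm_of_nonneg (Real.sqrt_nonneg _)]
    have : 0 < Real.sqrt Real.pi := Real.sqrt_pos.2 Real.pi_pos
    calc _ ≤ ‖p‖ / Real.sqrt Real.pi * (C0 * q ^ K * (‖p‖⁻¹ * J)) := by gcongr
      _ = _ := by field_simp
  · rw [Finset.sum_mul]
    refine norm_sum_le_of_le _ fun r hr => ?_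
    rw [norm_mul, norm_pow]
    exact mul_le_mul_of_nonneg_left
      (pow_le_pow_of_le_one hq0 hq1 (Finset.mem_filter.1 hr).2) (norm_nonneg _)

/-! ### Ray integrals and the function g -/

/-- The integrand of `g`. -/
def integrandG (n : ℕ) (z x : ℂ) : ℂ := x ^ n * exp (I * x ^ 3 / 3 + I * x * z)

/-- The sector `0 < arg c < π / 3` of directions of integration. -/
def raySector : Set ℂ := {c | 0 < c.im ∧ c.im < Real.sqrt 3 * c.re}

/-- The integral of `integrandG` over the ray in the direction `c`. -/
def rayIntegral (n : ℕ) (z c : ℂ) : ℂ := ∫ t in Set.Ioi (0 : ℝ), integrandG n z (t * c) * c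

lemma im_cube (c : ℂ) : (c ^ 3).im = c.im * (3 * c.re ^ 2 - c.im ^ 2) := by
  simp [pow_succ]; ring

/-- Im c³ > 0 is the convergence condition on the ray: Re(i (tc)³/3) = -t³ Im(c³)/3. -/
lemma im_cube_pos {c : ℂ} (hc : c ∈ raySector) : 0 < (c ^ 3).im := by
  obtain ⟨h1, h2⟩ := hc
  rw [im_cube]
  have h3 : c.im ^ 2 < (Real.sqrt 3 * c.re) ^ 2 := by gcongr
  rw [mul_pow, Real.sq_sqrt (by norm_num)] at h3
  exact mul_pos h1 (by linarith)

lemma isOpen_raySector : IsOpen raySector :=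
  (isOpen_lt continuous_const Complex.continuous_im).inter
    (isOpen_lt Complex.continuous_im (by fun_prop))

lemma convex_raySector : Convex ℝ raySector := by
  intro a ha b hb s t hs ht hst
  obtain ⟨a1, a2⟩ := ha
  obtain ⟨b1, b2⟩ := hb
  have hpos : ∀ x y : ℝ, 0 < x → 0 < y → 0 < s * x + t * y := fun x y hx hy => by
    rcases hs.eq_or_lt with rfl | hs'
    · have : t = 1 := by linarith
      subst this; simpa using hy
    · have := mul_pos hs' hx
      have := mul_nonneg ht hy.le
      linarith
  refine ⟨by simpa using hpos _ _ a1 b1, ?_⟩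
  have h := hpos _ _ (sub_pos.2 a2) (sub_pos.2 b2)
  simp
  linarith

lemma exp_mul_I_mem_raySector {θ : ℝ} (h0 : 0 < θ) (h1 : θ < Real.pi / 3) :
    exp (θ * I) ∈ raySector := by
  have hpi := Real.pi_pos
  refine ⟨?_, ?_⟩
  · rw [Complex.exp_ofReal_mul_I_im]
    exact Real.sin_pos_of_pos_of_lt_pi h0 (by linarith)
  · rw [Complex.exp_ofReal_mul_I_im, Complex.exp_ofReal_mul_I_re]
    have := Real.sin_pos_of_pos_of_lt_pi (x := Real.pi / 3 - θ) (by linarith) (by linarith)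
    rw [Real.sin_sub, Real.sin_pi_div_three, Real.cos_pi_div_three] at this
    linarith

lemma gRay_mem : gRay ∈ raySector := by
  have h := exp_mul_I_mem_raySector (θ := Real.pi / 6) (by positivity)
    (by linarith [Real.pi_pos])
  have e : gRay = exp ((Real.pi / 6 : ℝ) * I) := by rw [gRay]; congr 1; push_cast; ring
  rwa [e]

lemma g_succ (n : ℕ) (z : ℂ) :
    g (n + 1) z = (-I) ^ (n + 1) / (n.factorial : ℂ) * rayIntegral n z gRay := by
  rw [g, if_neg n.succ_ne_zero, rayIntegral]
  push_cast
  rw [Complex.Gamma_nat_eq_factorial]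
  simp [integrandG]

lemma norm_integrandG_le (n : ℕ) {η : ℝ} (hη : 0 < η) {R : ℝ} (hR : 0 ≤ R) :
    ∃ C : ℝ, 0 ≤ C ∧ ∀ (t : ℝ) (c z : ℂ), 0 ≤ t → η ≤ (c ^ 3).im → ‖c‖ ≤ R → ‖z‖ ≤ R →
      ‖integrandG n z (t * c)‖ ≤ C * Real.exp (-t) := by
  -- B t collects the growth t R from the power, the growth t R² from the linear phase, and the
  -- margin t for the decay e^{-t}. Beyond `T` the cubic term dominates B t.
  set B := R + R * R + 1
  set T := 1 + 3 * B / η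
  refine ⟨n.factorial * Real.exp (B * T), by positivity, fun t c z ht hc hcR hz => ?_⟩
  have hB : 0 ≤ B := by positivity
  have hT : 1 ≤ T := by simp only [T]; linarith [div_nonneg (mul_nonneg zero_le_three hB) hη.le]
  have h1 : ‖(t : ℂ) * c‖ ≤ t * R := by
    rw [norm_mul, Complex.norm_real, Real.norm_of_nonneg ht]; gcongr
  have h2 : (t * R) ^ n ≤ n.factorial * Real.exp (t * R) := by
    have := Real.pow_div_factorial_le_exp (t * R) (by positivity) n
    rwa [div_le_iff₀' (by positivity)] at this
  have h3 : (I * (t * c) ^ 3 / 3 + I * (t * c) * z).re ≤ t * (R * R) - η * t ^ 3 / 3 := by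
    have e : I * (t * c) ^ 3 / 3 = ((t ^ 3 / 3 : ℝ) : ℂ) * (I * c ^ 3) := by push_cast; ring
    have e1 : (I * (t * c) * z).re ≤ t * (R * R) := by
      refine (Complex.re_le_norm _).trans ?_
      rw [norm_mul, norm_mul, norm_I, one_mul, ← mul_assoc]
      gcongr
    rw [add_re, e, re_ofReal_mul, I_mul_re]
    have := mul_le_mul_of_nonneg_left hc (pow_nonneg ht 3)
    nlinarith
  have h4 : B * t ≤ B * T + η * t ^ 3 / 3 := by
    rcases le_total t T with h | h
    · have : 0 ≤ η * t ^ 3 / 3 := by positivity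
      nlinarith
    · have e1 : B ≤ η * T / 3 := by
        simp only [T]
        have : η * (1 + 3 * B / η) / 3 = η / 3 + B := by field_simp
        rw [this]; linarith
      have e2 : T ≤ t ^ 2 := by nlinarith
      have e3 : η * T / 3 ≤ η * t ^ 2 / 3 := by gcongr
      have e4 : B * t ≤ (η * t ^ 2 / 3) * t := by gcongr; linarith
      have : 0 ≤ B * T := by positivity
      nlinarith
  rw [integrandG, norm_mul, norm_pow, Complex.norm_exp]
  calc _ ≤ (t * R) ^ n * Real.exp (t * (R * R) - η * t ^ 3 / 3) := by gcongr
    _ ≤ (n.factorial * Real.exp (t * R)) * Real.exp (t * (R * R) - η * t ^ 3 / 3) := by gcongr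
    _ = n.factorial * Real.exp (t * R + (t * (R * R) - η * t ^ 3 / 3)) := by
      rw [mul_assoc, ← Real.exp_add]
    _ ≤ n.factorial * Real.exp (B * T + -t) := by
      refine mul_le_mul_of_nonneg_left (Real.exp_le_exp.2 ?_) (by positivity)
      have : B * t = R * t + R * R * t + t := by simp only [B]; ring
      linarith
    _ = _ := by rw [Real.exp_add, mul_assoc]

lemma integrableOn_exp_neg_const (C : ℝ) :
    IntegrableOn (fun t : ℝ => C * Real.exp (-t)) (Set.Ioi 0) := by
  have h : IntegrableOn (fun t : ℝ => C * Real.exp (-1 * t)) (Set.Ioi 0) :=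
    (exp_neg_integrableOn_Ioi 0 one_pos).const_mul C
  simpa using h

lemma continuous_integrandG (n : ℕ) (z c : ℂ) :
    Continuous fun t : ℝ => integrandG n z (t * c) := by
  unfold integrandG; fun_prop

lemma integrableOn_integrandG (n : ℕ) (z : ℂ) {c : ℂ} (hc : c ∈ raySector) :
    IntegrableOn (fun t : ℝ => integrandG n z (t * c)) (Set.Ioi 0) := by
  obtain ⟨C, -, h⟩ := norm_integrandG_le n (im_cube_pos hc) (R := max ‖c‖ ‖z‖)
    (le_max_of_le_left (norm_nonneg _))
  refine (integrableOn_exp_neg_const C).mono' (continuous_integrandG n z c).aestronglyMeasurable ?_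
  filter_upwards [ae_restrict_mem measurableSet_Ioi] with t ht
  exact h t c z (le_of_lt ht) le_rfl (le_max_left _ _) (le_max_right _ _)

lemma hasDerivAt_integrandG (n : ℕ) (z x : ℂ) :
    HasDerivAt (integrandG n z)
      (n * (x ^ (n - 1) * exp (I * x ^ 3 / 3 + I * x * z)) + I * integrandG (n + 2) z x
        + I * z * integrandG n z x) x := by
  have h1 : HasDerivAt (fun x : ℂ => I * x ^ 3 / 3 + I * x * z) (I * x ^ 2 + I * z) x := by
    have := (((hasDerivAt_pow 3 x).const_mul I).div_const 3).add
      (((hasDerivAt_id x).const_mul I).mul_const z)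
    refine this.congr_deriv ?_
    push_cast; ring
  refine ((hasDerivAt_pow n x).mul h1.cexp).congr_deriv ?_
  simp only [integrandG]
  ring

/-- The derivative of `x * integrandG n z x`. -/
def integrandG' (n : ℕ) (z x : ℂ) : ℂ :=
  (n + 1) * integrandG n z x + I * integrandG (n + 3) z x + I * z * integrandG (n + 1) z x

/-- With G the integrand, ∂_c (c G(tc)) = (xG)'(tc), so it is xG, not G, that governs the dependence
on the direction. The factor x also removes the boundary term at 0, even for n = 0. -/
lemma hasDerivAt_mul_integrandG (n : ℕ) (z x : ℂ) :
    HasDerivAt (fun x => x * integrandG n z x) (integrandG' n z x) x := by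
  refine ((hasDerivAt_id x).mul (hasDerivAt_integrandG n z x)).congr_deriv ?_
  simp only [integrandG, integrandG', id]
  rcases n with _ | n
  · simp; ring
  · push_cast; simp; ring

lemma integrableOn_integrandG' (n : ℕ) (z : ℂ) {c : ℂ} (hc : c ∈ raySector) :
    IntegrableOn (fun t : ℝ => integrandG' n z (t * c)) (Set.Ioi 0) :=
  (((integrableOn_integrandG n z hc).const_mul _).add
    ((integrableOn_integrandG (n + 3) z hc).const_mul _)).add
    ((integrableOn_integrandG (n + 1) z hc).const_mul _)

lemma integral_integrandG' (n : ℕ) (z : ℂ) {c : ℂ} (hc : c ∈ raySector) :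
    ∫ t in Set.Ioi (0 : ℝ), integrandG' n z (t * c) = 0 := by
  have hc0 : c ≠ 0 := fun h => by simp [h, raySector] at hc
  have key := integral_Ioi_of_hasDerivAt_of_tendsto (a := 0) (m := 0)
    (f := fun t : ℝ => (t : ℂ) * c * integrandG n z (t * c))
    (f' := fun t : ℝ => integrandG' n z (t * c) * c)
    (((by fun_prop : Continuous fun t : ℝ => (t : ℂ) * c).mul
      (continuous_integrandG n z c)).continuousWithinAt)
    (fun t _ => by
      have h := (hasDerivAt_mul_integrandG n z (t * c)).comp (t : ℂ)
        ((hasDerivAt_id (t : ℂ)).mul_const c)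
      simpa using h.comp_ofReal)
    ((integrableOn_integrandG' n z hc).mul_const c) ?_
  · rw [integral_mul_const] at key
    simpa [hc0] using key
  · obtain ⟨C, hC0, h⟩ := norm_integrandG_le (n + 1) (im_cube_pos hc) (R := max ‖c‖ ‖z‖)
      (le_max_of_le_left (norm_nonneg _))
    refine squeeze_zero_norm' (a := fun t => C * Real.exp (-t)) ?_ ?_
    · filter_upwards [eventually_ge_atTop 0] with t ht
      have := h t c z ht le_rfl (le_max_left _ _) (le_max_right _ _)
      have e : (t : ℂ) * c * integrandG n z (t * c) = integrandG (n + 1) z (t * c) := by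
        simp only [integrandG]; rw [pow_succ]; ring
      rwa [e]
    · simpa using Real.tendsto_exp_neg_atTop_nhds_zero.const_mul C

/-- The derivative in the direction is the integral of (xG)' along the ray, and xG vanishes at both
ends. -/
lemma hasDerivAt_rayIntegral (n : ℕ) (z : ℂ) {c : ℂ} (hc : c ∈ raySector) :
    HasDerivAt (rayIntegral n z) 0 c := by
  set η := (c ^ 3).im / 2
  have hη : 0 < η := half_pos (im_cube_pos hc)
  have hnhds : raySector ∩ {v | η < (v ^ 3).im} ∩ Metric.ball c 1 ∈ 𝓝 c := by
    refine inter_mem (inter_mem (isOpen_raySector.mem_nhds hc) ?_) (Metric.ball_mem_nhds c one_pos)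
    refine (isOpen_lt continuous_const (by fun_prop)).mem_nhds ?_
    exact half_lt_self (im_cube_pos hc)
  set R := ‖c‖ + 1 + ‖z‖
  have hR : 0 ≤ R := by positivity
  obtain ⟨C1, hC1, h1⟩ := norm_integrandG_le n hη hR
  obtain ⟨C2, hC2, h2⟩ := norm_integrandG_le (n + 3) hη hR
  obtain ⟨C3, hC3, h3⟩ := norm_integrandG_le (n + 1) hη hR
  have key := hasDerivAt_integral_of_dominated_loc_of_deriv_le (𝕜 := ℂ)
    (μ := volume.restrict (Set.Ioi (0 : ℝ)))
    (F := fun (c : ℂ) (t : ℝ) => integrandG n z (t * c) * c)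
    (F' := fun (c : ℂ) (t : ℝ) => integrandG' n z (t * c))
    (x₀ := c) (s := raySector ∩ {v | η < (v ^ 3).im} ∩ Metric.ball c 1)
    (bound := fun t => ((n + 1) * C1 + C2 + ‖z‖ * C3) * Real.exp (-t))
    hnhds
    (Eventually.of_forall fun v =>
      ((continuous_integrandG n z v).mul continuous_const).aestronglyMeasurable)
    ((integrableOn_integrandG n z hc).mul_const c)
    (integrableOn_integrandG' n z hc).aestronglyMeasurable ?_
    (integrableOn_exp_neg_const _) ?_
  · refine key.2.congr_deriv ?_
    exact integral_integrandG' n z hc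
  · filter_upwards [ae_restrict_mem measurableSet_Ioi] with t ht v hv
    obtain ⟨⟨-, v2⟩, v3⟩ := hv
    have hv' : ‖v‖ ≤ R := by
      rw [Metric.mem_ball, dist_eq_norm] at v3
      simp only [R]
      linarith [norm_le_norm_add_norm_sub' v c, norm_nonneg z]
    have hz' : ‖z‖ ≤ R := by simp only [R]; linarith [norm_nonneg c]
    have g1 := h1 t v z (le_of_lt ht) (le_of_lt v2) hv' hz'
    have g2 := h2 t v z (le_of_lt ht) (le_of_lt v2) hv' hz'
    have g3 := h3 t v z (le_of_lt ht) (le_of_lt v2) hv' hz'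
    rw [integrandG']
    refine (norm_add₃_le).trans ?_
    rw [norm_mul, norm_mul, norm_mul, norm_mul, norm_I, one_mul, one_mul, add_mul, add_mul]
    refine add_le_add (add_le_add ?_ g2) ?_
    · have : ‖((n : ℂ) + 1)‖ = n + 1 := by
        have := Complex.norm_natCast (n + 1)
        push_cast at this; exact this
      rw [this, mul_assoc]; gcongr
    · rw [mul_assoc]; gcongr
  · refine Eventually.of_forall fun t v _ => ?_
    -- For t ≠ 0 the integrand is t⁻¹ (xG)(tv), so the derivative of xG applies; t = 0 is checked
    -- directly.
    rcases eq_or_ne t 0 with rfl | ht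
    · have h := (hasDerivAt_id v).const_mul (integrandG n z 0)
      simp only [ofReal_zero, zero_mul]
      refine h.congr_deriv ?_
      simp [integrandG', integrandG]
      rcases n with _ | n <;> simp
    · have ht' : (t : ℂ) ≠ 0 := by exact_mod_cast ht
      have h := ((hasDerivAt_mul_integrandG n z (t * v)).comp v
        ((hasDerivAt_id v).const_mul (t : ℂ))).const_mul (t : ℂ)⁻¹
      refine (h.congr_deriv ?_).congr_of_eventuallyEq (Eventually.of_forall fun w => ?_)
      · field_simp
      · simp only [Function.comp]; field_simp

lemma rayIntegral_eq (n : ℕ) (z : ℂ) {c c' : ℂ} (hc : c ∈ raySector) (hc' : c' ∈ raySector) :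
    rayIntegral n z c = rayIntegral n z c' :=
  isOpen_raySector.is_const_of_deriv_eq_zero convex_raySector.isPreconnected
    (fun _ hv => (hasDerivAt_rayIntegral n z hv).differentiableAt.differentiableWithinAt)
    (fun _ hv => (hasDerivAt_rayIntegral n z hv).deriv) hc hc'

lemma rayIntegral_recurrence (n : ℕ) (z : ℂ) {c : ℂ} (hc : c ∈ raySector) :
    (n + 1) * rayIntegral n z c + I * rayIntegral (n + 3) z c
      + I * z * rayIntegral (n + 1) z c = 0 := by
  have h := integral_integrandG' n z hc
  have i1 : IntegrableOn (fun t : ℝ => ((n : ℂ) + 1) * integrandG n z (t * c)) (Set.Ioi 0) :=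
    (integrableOn_integrandG n z hc).const_mul ((n : ℂ) + 1)
  have i2 : IntegrableOn (fun t : ℝ => I * integrandG (n + 3) z (t * c)) (Set.Ioi 0) :=
    (integrableOn_integrandG (n + 3) z hc).const_mul I
  have i3 : IntegrableOn (fun t : ℝ => I * z * integrandG (n + 1) z (t * c)) (Set.Ioi 0) :=
    (integrableOn_integrandG (n + 1) z hc).const_mul (I * z)
  simp only [integrandG'] at h
  have i12 : IntegrableOn (fun t : ℝ => ((n : ℂ) + 1) * integrandG n z (t * c)
    + I * integrandG (n + 3) z (t * c)) (Set.Ioi 0) := i1.add i2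
  rw [integral_add i12 i3, integral_add i1 i2, integral_const_mul, integral_const_mul,
    integral_const_mul] at h
  simp only [rayIntegral, integral_mul_const]
  linear_combination c * h

lemma hasDerivAt_rayIntegral_param (n : ℕ) (z : ℂ) {c : ℂ} (hc : c ∈ raySector) :
    HasDerivAt (fun z => rayIntegral n z c) (I * rayIntegral (n + 1) z c) z := by
  have hR : 0 ≤ ‖c‖ + (‖z‖ + 1) := by positivity
  obtain ⟨C1, hC1, h1⟩ := norm_integrandG_le (n + 1) (im_cube_pos hc) hR
  have key := hasDerivAt_integral_of_dominated_loc_of_deriv_le (𝕜 := ℂ)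
    (μ := volume.restrict (Set.Ioi (0 : ℝ)))
    (F := fun (z : ℂ) (t : ℝ) => integrandG n z (t * c) * c)
    (F' := fun (z : ℂ) (t : ℝ) => I * (integrandG (n + 1) z (t * c) * c))
    (x₀ := z) (s := Metric.ball z 1)
    (bound := fun t => (C1 * ‖c‖) * Real.exp (-t))
    (Metric.ball_mem_nhds z one_pos)
    (Eventually.of_forall fun v =>
      ((continuous_integrandG n v c).mul continuous_const).aestronglyMeasurable)
    ((integrableOn_integrandG n z hc).mul_const c)
    (continuous_const.mul
      ((continuous_integrandG _ z c).mul continuous_const)).aestronglyMeasurable ?_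
    (integrableOn_exp_neg_const _) ?_
  · refine key.2.congr_deriv ?_
    rw [integral_const_mul]; rfl
  · filter_upwards [ae_restrict_mem measurableSet_Ioi] with t ht v hv
    have hv' : ‖v‖ ≤ ‖c‖ + (‖z‖ + 1) := by
      rw [Metric.mem_ball, dist_eq_norm] at hv
      linarith [norm_le_norm_add_norm_sub' v z, norm_nonneg c]
    have := h1 t c v (le_of_lt ht) le_rfl (by linarith [norm_nonneg z]) hv'
    rw [norm_mul, norm_mul, norm_I, one_mul, mul_right_comm]
    gcongr
  · refine Eventually.of_forall fun t v _ => ?_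
    have h1 : HasDerivAt (fun v : ℂ => I * (t * c) ^ 3 / 3 + I * (t * c) * v) (I * (t * c)) v := by
      simpa using ((hasDerivAt_id v).const_mul (I * (t * c))).const_add (I * (t * c) ^ 3 / 3)
    refine ((h1.cexp.const_mul ((t * c) ^ n)).mul_const c).congr_deriv ?_
    simp only [integrandG]
    ring

lemma hasDerivAt_g (N : ℕ) (z : ℂ) : HasDerivAt (g N) (-N * g (N + 1) z) z := by
  rcases N with _ | n
  · have : g 0 = fun _ => 1 := by funext z; simp [g]
    rw [this]
    simpa using hasDerivAt_const z (1 : ℂ)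
  · have h := (hasDerivAt_rayIntegral_param n z gRay_mem).const_mul
      ((-I) ^ (n + 1) / (n.factorial : ℂ))
    have e : g (n + 1) = fun z => (-I) ^ (n + 1) / (n.factorial : ℂ) * rayIntegral n z gRay := by
      funext z; exact g_succ n z
    rw [e]
    refine h.congr_deriv ?_
    rw [g_succ, Nat.factorial_succ]
    have h1 : (n.factorial : ℂ) ≠ 0 := by exact_mod_cast n.factorial_ne_zero
    have h2 : (n : ℂ) + 1 ≠ 0 := by exact_mod_cast n.succ_ne_zero
    push_cast
    field_simp
    ring

lemma g_recurrence (n : ℕ) (z : ℂ) :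
    z * g (n + 2) z = g (n + 1) z + (n + 2) * (n + 3) * g (n + 4) z := by
  have h := rayIntegral_recurrence n z gRay_mem
  rw [g_succ (n + 1), g_succ n, g_succ (n + 3), Nat.factorial_succ (n + 2),
    Nat.factorial_succ (n + 1), Nat.factorial_succ n]
  have h1 : (n.factorial : ℂ) ≠ 0 := by exact_mod_cast n.factorial_ne_zero
  have h2 : (n : ℂ) + 1 ≠ 0 := by exact_mod_cast n.succ_ne_zero
  have h3 : (n : ℂ) + 2 ≠ 0 := by exact_mod_cast (n + 1).succ_ne_zero
  have h4 : (n : ℂ) + 3 ≠ 0 := by exact_mod_cast (n + 2).succ_ne_zero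
  have e2 : (-I) ^ (n + 1 + 1) = (-I) ^ (n + 1) * (-I) := pow_succ _ _
  have e4 : (-I) ^ (n + 3 + 1) = (-I) ^ (n + 1) * I := by
    rw [show n + 3 + 1 = (n + 1) + 3 by ring, pow_add]
    congr 1
    rw [pow_succ, neg_sq, I_sq]; ring
  rw [e2, e4]
  push_cast
  have e : (n : ℂ) + 1 + 1 = n + 2 := by ring
  have e3 : (n : ℂ) + 2 + 1 = n + 3 := by ring
  simp only [e, e3]
  field_simp
  linear_combination (-1 : ℂ) * h

/-! ### The expansion of `g` -/

lemma integrableOn_pow_mul_exp (n : ℕ) {b : ℂ} (hb : 0 < b.re) :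
    IntegrableOn (fun t : ℝ => (t : ℂ) ^ n * exp (-(b * t))) (Set.Ioi 0) := by
  have h := integrableOn_rpow_mul_exp_neg_mul_rpow (s := (n : ℝ)) (p := 1) (b := b.re)
    (by linarith [n.cast_nonneg (α := ℝ)]) zero_lt_one hb
  refine h.mono' (Continuous.aestronglyMeasurable (by fun_prop)) ?_
  filter_upwards [ae_restrict_mem measurableSet_Ioi] with t ht
  rw [norm_mul, norm_pow, Complex.norm_real, Real.norm_of_nonneg (le_of_lt ht), Complex.norm_exp,
    Real.rpow_natCast, Real.rpow_one]
  simp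

lemma integral_pow_mul_exp (n : ℕ) {b : ℂ} (hb : 0 < b.re) :
    ∫ t in Set.Ioi (0 : ℝ), (t : ℂ) ^ n * exp (-(b * t)) = (n.factorial : ℂ) / b ^ (n + 1) := by
  have hb0 : b ≠ 0 := fun h => by simp [h] at hb
  induction n with
  | zero =>
    have h := integral_exp_mul_complex_Ioi (a := -b) (by simpa using hb) 0
    simp only [neg_mul, ofReal_zero, mul_zero, exp_zero] at h
    simp only [pow_zero, one_mul, h, Nat.factorial_zero, Nat.cast_one, zero_add, pow_one]
    field_simp
  | succ n ih =>
    have i1 := (integrableOn_pow_mul_exp n hb).const_mul ((n : ℂ) + 1)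
    have i2 := (integrableOn_pow_mul_exp (n + 1) hb).const_mul b
    have hd : ∀ t : ℝ, HasDerivAt (fun t : ℝ => (t : ℂ) ^ (n + 1) * exp (-(b * t)))
        (((n : ℂ) + 1) * ((t : ℂ) ^ n * exp (-(b * t))) - b * ((t : ℂ) ^ (n + 1) * exp (-(b * t))))
        t := fun t => by
      have h := (hasDerivAt_pow (n + 1) (t : ℂ)).mul
        (((hasDerivAt_id (t : ℂ)).const_mul b).neg.cexp)
      refine h.comp_ofReal.congr_deriv ?_
      simp
      ring
    have h := integral_Ioi_of_hasDerivAt_of_tendsto (a := 0) (m := 0)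
      (hd 0).continuousAt.continuousWithinAt (fun t _ => hd t) (i1.sub i2)
      (tendsto_zero_of_hasDerivAt_of_integrableOn_Ioi (a := 0) (fun t _ => hd t) (i1.sub i2)
        (integrableOn_pow_mul_exp (n + 1) hb))
    rw [integral_sub i1 i2, integral_const_mul, integral_const_mul, ih] at h
    simp only [ofReal_zero, ne_eq, n.succ_ne_zero, not_false_eq_true, zero_pow, zero_mul,
      sub_zero] at h
    rw [Nat.factorial_succ, pow_succ b (n + 1)]
    push_cast
    have hb1 : b * b⁻¹ = 1 := mul_inv_cancel₀ hb0
    rw [div_eq_mul_inv, mul_inv]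
    rw [div_eq_mul_inv] at h
    linear_combination (-b⁻¹) * h -
      (∫ t in Set.Ioi (0 : ℝ), (t : ℂ) ^ (n + 1) * exp (-(b * t))) * hb1

/-- The function `g`, normalized by its leading behaviour at infinity. -/
def normG (N : ℕ) (z : ℂ) : ℂ := z ^ N * g N z

/-- The coefficients of the expansion of `normG` in powers of `z⁻³`. -/
def gCoeff (N k : ℕ) : ℂ :=
  if N = 0 then (if k = 0 then 1 else 0)
  else (-I) ^ N / ((N - 1).factorial : ℂ) * expCoeff k * ((N - 1 + 3 * k).factorial : ℂ) *
    I ^ (N + 3 * k)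

/-- For c = e^{iθ} one has Re(-i c z) = |z| sin(θ + arg z). The angle θ = δ/2 serves arg z ≥ 0 and θ
= π/3 - δ/2 serves arg z ≤ 0; in both cases θ + arg z lies in [δ/2, π - δ/2]. -/
lemma exists_ray {δ : ℝ} (hδ : 0 < δ) (hδ' : δ < Real.pi / 3) {z : ℂ}
    (h1 : -(Real.pi / 3) + δ ≤ z.arg) (h2 : z.arg ≤ Real.pi - δ) :
    ∃ c ∈ raySector, ‖c‖ = 1 ∧ Real.sin (δ / 2) * ‖z‖ ≤ (-(I * c * z)).re := by
  have hpi := Real.pi_pos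
  have key : ∀ θ : ℝ, 0 < θ → θ < Real.pi / 3 → δ / 2 ≤ θ + z.arg → θ + z.arg ≤ Real.pi - δ / 2 →
      ∃ c ∈ raySector, ‖c‖ = 1 ∧ Real.sin (δ / 2) * ‖z‖ ≤ (-(I * c * z)).re := by
    intro θ t0 t1 t2 t3
    refine ⟨exp (θ * I), exp_mul_I_mem_raySector t0 t1, Complex.norm_exp_ofReal_mul_I θ, ?_⟩
    have e : (-(I * exp (θ * I) * z)).re = ‖z‖ * Real.sin (θ + z.arg) := by
      conv_lhs => rw [← Complex.norm_mul_exp_arg_mul_I z]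
      have : -(I * exp (θ * I) * (‖z‖ * exp (z.arg * I))) =
          (‖z‖ : ℂ) * (-(I * exp ((θ + z.arg : ℝ) * I))) := by
        push_cast; rw [add_mul, exp_add]; ring
      rw [this, re_ofReal_mul, neg_re, I_mul_re, Complex.exp_ofReal_mul_I_im, neg_neg]
    rw [e, mul_comm]
    refine mul_le_mul_of_nonneg_left ?_ (norm_nonneg _)
    rcases le_total (θ + z.arg) (Real.pi / 2) with h | h
    · exact Real.sin_le_sin_of_le_of_le_pi_div_two (by linarith) h t2
    · rw [← Real.sin_pi_sub (θ + z.arg)]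
      exact Real.sin_le_sin_of_le_of_le_pi_div_two (by linarith) (by linarith) (by linarith)
  rcases le_total 0 z.arg with h | h
  · exact key (δ / 2) (by linarith) (by linarith) (by linarith) (by linarith)
  · exact key (Real.pi / 3 - δ / 2) (by linarith) (by linarith) (by linarith) (by linarith)

/-- The expansion of `g` in a closed subsector of `-π / 3 < arg z < π`. -/
lemma normG_expansion (N : ℕ) {δ : ℝ} (hδ : 0 < δ) (hδ' : δ < Real.pi / 3) (K : ℕ) :
    ∃ C : ℝ, ∀ z : ℂ, 1 ≤ ‖z‖ → -(Real.pi / 3) + δ ≤ z.arg → z.arg ≤ Real.pi - δ →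
      ‖normG N z - ∑ k ∈ Finset.range K, gCoeff N k * (z⁻¹ ^ 3) ^ k‖ ≤
        C * ‖z⁻¹ ^ 3‖ ^ K := by
  rcases N with _ | n
  · refine ⟨1, fun z _ _ _ => ?_⟩
    rcases K with _ | K
    · simp [normG, g]
    · rw [Finset.sum_range_succ', Finset.sum_eq_zero]
      · simp [normG, g, gCoeff]
      · intro b _
        simp [gCoeff]
  set κ := Real.sin (δ / 2)
  have hκ : 0 < κ := Real.sin_pos_of_pos_of_lt_pi (by positivity) (by linarith [Real.pi_pos])
  obtain ⟨C0, hC0, herr⟩ := norm_exp_sub_sum_le_of_re_nonpos K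
  set m := n + 3 * K
  refine ⟨‖(-I) ^ (n + 1) / (n.factorial : ℂ)‖ * (C0 * (m.factorial / κ ^ (m + 1))),
    fun z hz h1 h2 => ?_⟩
  -- The ray depends on z, but the value of the ray integral does not depend on the ray.
  obtain ⟨c, hc, hc1, hcz⟩ := exists_ray hδ hδ' h1 h2
  have hz0 : z ≠ 0 := norm_pos_iff.1 (one_pos.trans_le hz)
  have hzpos : 0 < ‖z‖ := norm_pos_iff.2 hz0
  have hc0 : c ≠ 0 := norm_pos_iff.1 (hc1 ▸ one_pos)
  set b := -(I * c * z) with hb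
  have hbre : 0 < b.re := (mul_pos hκ hzpos).trans_le hcz
  have hb0 : b ≠ 0 := fun h => by simp [h] at hbre
  -- Each term of the expansion depends on the direction only through c/b, so the direction drops
  -- out.
  have hcb : c / b = I / z := by
    rw [hb]; field_simp
    linear_combination (-1 : ℂ) * I_sq
  set T : ℝ → ℂ := fun t => ∑ k ∈ Finset.range K, expCoeff k * c ^ (n + 3 * k + 1) *
    ((t : ℂ) ^ (n + 3 * k) * exp (-(b * t))) with hT
  have hTint : IntegrableOn T (Set.Ioi 0) :=
    integrable_finsetSum _ fun k _ => (integrableOn_pow_mul_exp _ hbre).const_mul _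
  have hTval : ∫ t in Set.Ioi (0 : ℝ), T t = ∑ k ∈ Finset.range K,
      expCoeff k * ((n + 3 * k).factorial : ℂ) * (I / z) ^ (n + 3 * k + 1) := by
    simp only [hT]
    rw [integral_finsetSum _ fun k _ => (integrableOn_pow_mul_exp _ hbre).const_mul _]
    refine Finset.sum_congr rfl fun k _ => ?_
    rw [integral_const_mul, integral_pow_mul_exp _ hbre, ← hcb, div_pow]
    ring
  have hpt : ∀ t : ℝ, 0 ≤ t → ‖integrandG n z (t * c) * c - T t‖ ≤
      C0 * (t ^ m * Real.exp (-(b.re * t))) := fun t ht => by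
    have e : integrandG n z (t * c) * c - T t = c ^ (n + 1) * ((t : ℂ) ^ n * exp (-(b * t)) *
        (exp (I * (t * c) ^ 3 / 3) - ∑ k ∈ Finset.range K,
          (I * (t * c) ^ 3 / 3) ^ k / (k.factorial : ℂ))) := by
      rw [mul_sub, mul_sub]
      congr 1
      · rw [integrandG, exp_add]
        have : I * (t * c) * z = -(b * t) := by rw [hb]; ring
        rw [this]; ring
      · simp only [hT]
        rw [Finset.mul_sum, Finset.mul_sum]
        refine Finset.sum_congr rfl fun k _ => ?_
        rw [expCoeff, mul_div_right_comm, mul_pow (I / 3), ← pow_mul, mul_pow]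
        ring
    have hre : (I * (t * c) ^ 3 / 3).re ≤ 0 := by
      have e : I * (t * c) ^ 3 / 3 = ((t ^ 3 / 3 : ℝ) : ℂ) * (I * c ^ 3) := by push_cast; ring
      rw [e, re_ofReal_mul, I_mul_re]
      have := im_cube_pos hc
      have : 0 ≤ t ^ 3 / 3 := by positivity
      nlinarith
    have hn : ‖I * (t * c) ^ 3 / 3‖ ≤ t ^ 3 := by
      rw [norm_div, norm_mul, norm_I, norm_pow, norm_mul, hc1, Complex.norm_real,
        Real.norm_of_nonneg ht]
      have : 0 ≤ t ^ 3 := by positivity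
      simp; linarith
    rw [e, norm_mul, norm_pow, hc1, one_pow, one_mul, norm_mul, norm_mul, norm_pow,
      Complex.norm_real, Real.norm_of_nonneg ht, Complex.norm_exp]
    have e2 : (-(b * (t : ℂ))).re = -(b.re * t) := by rw [neg_re, re_mul_ofReal]
    rw [e2]
    calc _ ≤ t ^ n * Real.exp (-(b.re * t)) * (C0 * (t ^ 3) ^ K) := by
          gcongr
          exact (herr _ hre).trans (by gcongr)
      _ = _ := by simp only [m]; rw [← pow_mul, pow_add]; ring
  have hre_b : 0 < ((b.re : ℝ) : ℂ).re := by simpa using hbre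
  have hcast : ∀ t : ℝ, (t : ℂ) ^ m * exp (-(((b.re : ℝ) : ℂ) * t)) =
      ((t ^ m * Real.exp (-(b.re * t)) : ℝ) : ℂ) := fun t => by push_cast; rfl
  have hBint : IntegrableOn (fun t : ℝ => t ^ m * Real.exp (-(b.re * t))) (Set.Ioi 0) := by
    have h := (integrableOn_pow_mul_exp m hre_b).re
    simp only [hcast] at h
    exact h
  have hBval : ∫ t in Set.Ioi (0 : ℝ), t ^ m * Real.exp (-(b.re * t)) =
      m.factorial / b.re ^ (m + 1) := by
    have h := integral_pow_mul_exp m hre_b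
    simp only [hcast] at h
    rw [integral_complex_ofReal] at h
    exact_mod_cast h
  have hGint : IntegrableOn (fun t : ℝ => integrandG n z (t * c) * c) (Set.Ioi 0) :=
    (integrableOn_integrandG n z hc).mul_const c
  have hsub : ‖rayIntegral n z c - ∫ t in Set.Ioi (0 : ℝ), T t‖ ≤
      C0 * (m.factorial / b.re ^ (m + 1)) := by
    rw [rayIntegral, ← integral_sub hGint hTint, ← hBval, ← integral_const_mul]
    refine norm_integral_le_of_norm_le (hBint.const_mul C0) ?_
    filter_upwards [ae_restrict_mem measurableSet_Ioi] with t ht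
    exact hpt t (le_of_lt ht)
  have hmain : normG (n + 1) z - ∑ k ∈ Finset.range K, gCoeff (n + 1) k * (z⁻¹ ^ 3) ^ k =
      z ^ (n + 1) * ((-I) ^ (n + 1) / (n.factorial : ℂ)) *
        (rayIntegral n z c - ∫ t in Set.Ioi (0 : ℝ), T t) := by
    rw [normG, g_succ, rayIntegral_eq n z gRay_mem hc, mul_sub, hTval, Finset.mul_sum]
    congr 1
    · ring
    · refine Finset.sum_congr rfl fun k _ => ?_
      rw [gCoeff, if_neg n.succ_ne_zero, Nat.add_sub_cancel, div_pow I z,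
        show n + 3 * k + 1 = n + 1 + 3 * k by ring, pow_add z, ← pow_mul, inv_pow]
      field_simp
      ring
  rw [hmain, norm_mul, norm_mul, norm_pow]
  calc _ ≤ ‖z‖ ^ (n + 1) * ‖(-I) ^ (n + 1) / (n.factorial : ℂ)‖ *
        (C0 * (m.factorial / b.re ^ (m + 1))) := by gcongr
    _ ≤ ‖z‖ ^ (n + 1) * ‖(-I) ^ (n + 1) / (n.factorial : ℂ)‖ *
        (C0 * (m.factorial / (κ * ‖z‖) ^ (m + 1))) := by gcongr
    _ = _ := by
      rw [norm_pow, norm_inv, mul_pow, ← pow_mul, inv_pow,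
        show m + 1 = n + 1 + 3 * K by simp only [m]; ring, pow_add ‖z‖]
      field_simp
      ring

/-! ### Recurrences for the coefficients of the expansion -/

lemma expCoeff_succ (a : ℕ) : 3 * ((a : ℂ) + 1) * expCoeff (a + 1) = I * expCoeff a := by
  rw [expCoeff, expCoeff, Nat.factorial_succ, pow_succ]
  have h1 : (a.factorial : ℂ) ≠ 0 := by exact_mod_cast a.factorial_ne_zero
  have h2 : (a : ℂ) + 1 ≠ 0 := by exact_mod_cast a.succ_ne_zero
  push_cast
  field_simp

lemma binomC_succ (m : ℤ) (b : ℕ) :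
    ((b : ℂ) + 1) * binomC m (b + 1) = (m - b) * binomC m b := by
  have h := Ring.choose_smul_choose m (n := b + 1) (k := b) (Nat.le_succ b)
  rw [Nat.add_sub_cancel_left, Ring.choose_one_right, Nat.choose_succ_self_right] at h
  have h' := congrArg (Int.cast : ℤ → ℂ) h
  simp only [binomC]
  push_cast [nsmul_eq_mul] at h'
  rw [h']; ring

lemma powCoeff_succ (M : ℤ) (b : ℕ) :
    ((b : ℂ) + 1) * powCoeff M (b + 1) = I * (M + b) * powCoeff M b := by
  have h := binomC_succ (-M) b
  rw [powCoeff, powCoeff, pow_succ]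
  push_cast at h
  linear_combination ((-I) ^ b * (-I)) * h

lemma powCoeff_sub_one (M : ℤ) (b : ℕ) :
    powCoeff (M - 1) (b + 1) = powCoeff M (b + 1) - I * powCoeff M b := by
  rw [powCoeff, powCoeff, powCoeff, show -(M - 1) = -M + 1 by ring, binomC_succ_succ, pow_succ]
  ring

lemma powCoeff_zero (M : ℤ) : powCoeff M 0 = 1 := by simp [powCoeff, binomC_zero_right]

lemma mul_powCoeff_add_one (M : ℤ) (b : ℕ) :
    (M : ℂ) * powCoeff (M + 1) b = (M + b) * powCoeff M b := by
  rcases b with _ | b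
  · simp [powCoeff_zero]
  · have h1 := powCoeff_succ (M + 1) b
    have h2 := powCoeff_sub_one (M + 1) b
    rw [add_sub_cancel_right] at h2
    push_cast at h1 ⊢
    linear_combination (-1 : ℂ) * h1 - ((M : ℂ) + (b + 1)) * h2

/-- At m = 0 the truncated difference m - 1 is harmless, since the factor m is zero. -/
lemma gaussMoment_succ (m : ℕ) : gaussMoment (m + 1) = m / 2 * gaussMoment (m - 1) := by
  rcases m with _ | m
  · simp [gaussMoment]
  · simp [gaussMoment]

lemma gaussMoment_odd {m : ℕ} (hm : Odd m) : gaussMoment m = 0 := by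
  obtain ⟨k, rfl⟩ := hm
  induction k with
  | zero => rfl
  | succ k ih =>
    rw [show 2 * (k + 1) + 1 = (2 * k + 1) + 2 by ring, gaussMoment, ih, mul_zero]

/-- 3a + b has the parity of a + b, and odd Gaussian moments vanish. Only powers of z^{-3/2} survive
in an expansion in powers of z^{-3/4}. -/
lemma airyCoeff_odd (M : ℤ) {n : ℕ} (hn : Odd n) : airyCoeff M n = 0 := by
  refine Finset.sum_eq_zero fun q hq => ?_
  have hq' := Finset.HasAntidiagonal.mem_antidiagonal.1 hq
  rw [gaussMoment_odd, mul_zero]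
  rw [show 3 * q.1 + q.2 = n + 2 * q.1 by omega]
  exact hn.add_even (even_two_mul _)

/-- Comes from (1 - ix)^{1-M} = (1 - ix)^{-M} (1 - ix): the extra factor -ix raises the moment by
one. -/
lemma airyCoeff_sub_one_sub (M : ℤ) (n : ℕ) :
    airyCoeff (M - 1) (n + 1) - airyCoeff M (n + 1) =
      -I * ∑ q ∈ Finset.HasAntidiagonal.antidiagonal n,
        expCoeff q.1 * powCoeff M q.2 * gaussMoment (3 * q.1 + q.2 + 1) := by
  rw [airyCoeff, airyCoeff, Finset.Nat.sum_antidiagonal_succ', Finset.Nat.sum_antidiagonal_succ',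
    powCoeff_zero, powCoeff_zero, add_sub_add_left_eq_sub, ← Finset.sum_sub_distrib,
    Finset.mul_sum]
  refine Finset.sum_congr rfl fun q _ => ?_
  simp only []
  rw [powCoeff_sub_one, show 3 * q.1 + (q.2 + 1) = 3 * q.1 + q.2 + 1 by ring]
  ring

/-- Integration by parts at the level of coefficients. The moment of order 3a + b + 1 yields the
factor (3a + b)/2. The part 3a is absorbed by lowering a in `expCoeff`, the part b by lowering b in
`powCoeff`. -/
lemma sum_gaussMoment_succ (M : ℤ) (n : ℕ) :
    -I * ∑ q ∈ Finset.HasAntidiagonal.antidiagonal (n + 1),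
        expCoeff q.1 * powCoeff M q.2 * gaussMoment (3 * q.1 + q.2 + 1) =
      1 / 2 * ∑ q ∈ Finset.HasAntidiagonal.antidiagonal n, expCoeff q.1 * powCoeff M q.2 *
        (gaussMoment (3 * q.1 + q.2 + 2) + (M + q.2) * gaussMoment (3 * q.1 + q.2)) := by
  have h1 : ∑ q ∈ Finset.HasAntidiagonal.antidiagonal (n + 1),
      (3 * (q.1 : ℂ)) * expCoeff q.1 * powCoeff M q.2 * gaussMoment (3 * q.1 + q.2 - 1) =
      I * ∑ q ∈ Finset.HasAntidiagonal.antidiagonal n,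
        expCoeff q.1 * powCoeff M q.2 * gaussMoment (3 * q.1 + q.2 + 2) := by
    rw [Finset.Nat.sum_antidiagonal_succ, Finset.mul_sum]
    simp only [Nat.cast_zero, mul_zero, zero_mul, zero_add]
    refine Finset.sum_congr rfl fun q _ => ?_
    have h := expCoeff_succ q.1
    rw [show 3 * (q.1 + 1) + q.2 - 1 = 3 * q.1 + q.2 + 2 by omega]
    push_cast
    linear_combination (powCoeff M q.2 * gaussMoment (3 * q.1 + q.2 + 2)) * h
  have h2 : ∑ q ∈ Finset.HasAntidiagonal.antidiagonal (n + 1),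
      (q.2 : ℂ) * expCoeff q.1 * powCoeff M q.2 * gaussMoment (3 * q.1 + q.2 - 1) =
      I * ∑ q ∈ Finset.HasAntidiagonal.antidiagonal n,
        expCoeff q.1 * powCoeff M q.2 * ((M + q.2) * gaussMoment (3 * q.1 + q.2)) := by
    rw [Finset.Nat.sum_antidiagonal_succ', Finset.mul_sum]
    simp only [Nat.cast_zero, zero_mul, zero_add]
    refine Finset.sum_congr rfl fun q _ => ?_
    have h := powCoeff_succ M q.2
    rw [show 3 * q.1 + (q.2 + 1) - 1 = 3 * q.1 + q.2 by omega]
    push_cast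
    linear_combination (expCoeff q.1 * gaussMoment (3 * q.1 + q.2)) * h
  have h3 : ∑ q ∈ Finset.HasAntidiagonal.antidiagonal (n + 1),
        expCoeff q.1 * powCoeff M q.2 * gaussMoment (3 * q.1 + q.2 + 1) =
      1 / 2 * (∑ q ∈ Finset.HasAntidiagonal.antidiagonal (n + 1),
      (3 * (q.1 : ℂ)) * expCoeff q.1 * powCoeff M q.2 * gaussMoment (3 * q.1 + q.2 - 1)) +
      1 / 2 * ∑ q ∈ Finset.HasAntidiagonal.antidiagonal (n + 1),
      (q.2 : ℂ) * expCoeff q.1 * powCoeff M q.2 * gaussMoment (3 * q.1 + q.2 - 1) := by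
    rw [Finset.mul_sum, Finset.mul_sum, ← Finset.sum_add_distrib]
    refine Finset.sum_congr rfl fun q _ => ?_
    rw [gaussMoment_succ]
    push_cast; ring
  simp only [mul_add, Finset.sum_add_distrib] at h2 ⊢
  rw [h3, h1, h2]
  linear_combination (-(1 / 2) * (∑ q ∈ Finset.HasAntidiagonal.antidiagonal n,
        expCoeff q.1 * powCoeff M q.2 * gaussMoment (3 * q.1 + q.2 + 2)) -
      1 / 2 * (∑ q ∈ Finset.HasAntidiagonal.antidiagonal n,
        expCoeff q.1 * powCoeff M q.2 * ((M + q.2) * gaussMoment (3 * q.1 + q.2)))) * I_sq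

/-- Coefficient form of f(·; M)' = -f(·; M - 1). The factor M/2 + 1/4 + 3n/4 is the exponent of z⁻¹
in the n-th term of f. -/
lemma airyCoeff_sub_one (M : ℤ) (n : ℕ) :
    airyCoeff (M - 1) (n + 2) =
      airyCoeff M (n + 2) + (M / 2 + 1 / 4 + 3 / 4 * n) * airyCoeff M n := by
  rw [← sub_eq_iff_eq_add', airyCoeff_sub_one_sub M (n + 1), sum_gaussMoment_succ, airyCoeff,
    Finset.mul_sum, Finset.mul_sum]
  refine Finset.sum_congr rfl fun q hq => ?_
  rw [← Finset.HasAntidiagonal.mem_antidiagonal.1 hq, gaussMoment]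
  push_cast; ring

/-- Coefficient form of `f_recurrence`. -/
lemma airyCoeff_sub_two (M : ℤ) (n : ℕ) :
    airyCoeff (M - 2) (n + 2) = airyCoeff M (n + 2) + M * airyCoeff (M + 1) n := by
  have h1 := airyCoeff_sub_one_sub M (n + 1)
  have h2 := airyCoeff_sub_one_sub (M - 1) (n + 1)
  have h3 := sum_gaussMoment_succ M n
  have h4 : ∑ q ∈ Finset.HasAntidiagonal.antidiagonal (n + 1),
        expCoeff q.1 * powCoeff (M - 1) q.2 * gaussMoment (3 * q.1 + q.2 + 1) =
      ∑ q ∈ Finset.HasAntidiagonal.antidiagonal (n + 1),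
        expCoeff q.1 * powCoeff M q.2 * gaussMoment (3 * q.1 + q.2 + 1) -
      I * ∑ q ∈ Finset.HasAntidiagonal.antidiagonal n,
        expCoeff q.1 * powCoeff M q.2 * gaussMoment (3 * q.1 + q.2 + 2) := by
    rw [Finset.Nat.sum_antidiagonal_succ', Finset.Nat.sum_antidiagonal_succ' (n := n), powCoeff_zero,
      powCoeff_zero, add_sub_assoc, Finset.mul_sum, ← Finset.sum_sub_distrib]
    congr 1
    refine Finset.sum_congr rfl fun q _ => ?_
    simp only []
    rw [powCoeff_sub_one, show 3 * q.1 + (q.2 + 1) + 1 = 3 * q.1 + q.2 + 2 by ring]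
    ring
  have h5 : (M : ℂ) * airyCoeff (M + 1) n = ∑ q ∈ Finset.HasAntidiagonal.antidiagonal n,
      expCoeff q.1 * powCoeff M q.2 * ((M + q.2) * gaussMoment (3 * q.1 + q.2)) := by
    rw [airyCoeff, Finset.mul_sum]
    refine Finset.sum_congr rfl fun q _ => ?_
    have := mul_powCoeff_add_one M q.2
    linear_combination (expCoeff q.1 * gaussMoment (3 * q.1 + q.2)) * this
  rw [h4] at h2
  simp only [mul_add, Finset.sum_add_distrib] at h3 h5
  rw [show M - 1 - 1 = M - 2 by ring] at h2
  rw [h5]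
  linear_combination h1 + h2 + 2 * h3 + (∑ q ∈ Finset.HasAntidiagonal.antidiagonal n,
        expCoeff q.1 * powCoeff M q.2 * gaussMoment (3 * q.1 + q.2 + 2)) * I_sq

/-! ### The formal solution in powers of z^{-1/2} -/

/-- The coefficient of `z ^ (-m / 2)` in the expansion of `normF M`. -/
def formalF (M m : ℤ) : ℂ :=
  if 0 ≤ m ∧ (3 : ℤ) ∣ m then airyCoeff M (2 * (m / 3)).toNat else 0

lemma formalF_three_mul (M : ℤ) (k : ℕ) : formalF M (3 * k) = airyCoeff M (2 * k) := by
  rw [formalF, if_pos ⟨by positivity, dvd_mul_right _ _⟩, Int.mul_ediv_cancel_left _ (by norm_num)]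
  congr 1

lemma formalF_of_not_dvd (M : ℤ) {m : ℤ} (h : ¬ (3 : ℤ) ∣ m) : formalF M m = 0 :=
  if_neg fun h' => h h'.2

lemma formalF_of_neg (M : ℤ) {m : ℤ} (h : m < 0) : formalF M m = 0 :=
  if_neg fun h' => absurd h'.1 (not_le.2 h)

lemma formalF_zero (M : ℤ) : formalF M 0 = 1 := by
  have := formalF_three_mul M 0
  simpa [airyCoeff_zero] using this

/-- The series is supported on nonnegative multiples of 3, so an identity that involves m and m - 3
is trivial off this support. Allowing negative indices removes boundary cases from the recurrences.
-/
lemma formalF_cases {P : ℤ → Prop} (h1 : ∀ m : ℤ, m < 0 → P m) (h2 : ∀ m : ℤ, ¬ (3 : ℤ) ∣ m → P m)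
    (h0 : P 0) (h3 : ∀ k : ℕ, P (3 * (k + 1 : ℕ))) (m : ℤ) : P m := by
  by_cases hm : (3 : ℤ) ∣ m
  · obtain ⟨k, rfl⟩ := hm
    rcases lt_trichotomy k 0 with hk | rfl | hk
    · exact h1 _ (by omega)
    · simpa using h0
    · obtain ⟨j, rfl⟩ := Int.eq_ofNat_of_zero_le hk.le
      obtain ⟨i, rfl⟩ := Nat.exists_eq_succ_of_ne_zero (n := j) (by omega)
      exact h3 i
  · exact h2 m hm

lemma formalF_sub_one (M m : ℤ) :
    formalF (M - 1) m = formalF M m + (M / 2 + 1 / 4 + (m - 3) / 2) * formalF M (m - 3) := by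
  induction m using formalF_cases with
  | h1 m h => simp [formalF_of_neg, h, show m - 3 < 0 by omega]
  | h2 m h =>
    rw [formalF_of_not_dvd _ h, formalF_of_not_dvd _ h, formalF_of_not_dvd _ (by omega)]; simp
  | h0 => simp [formalF_zero, formalF_of_neg]
  | h3 k =>
    rw [show (3 : ℤ) * ((k + 1 : ℕ) : ℤ) - 3 = 3 * (k : ℤ) by push_cast; ring, formalF_three_mul,
      formalF_three_mul, formalF_three_mul, show 2 * (k + 1) = 2 * k + 2 by ring,
      airyCoeff_sub_one]
    push_cast; ring

lemma formalF_sub_two (M m : ℤ) :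
    formalF (M - 2) m = formalF M m + M * formalF (M + 1) (m - 3) := by
  induction m using formalF_cases with
  | h1 m h => simp [formalF_of_neg, h, show m - 3 < 0 by omega]
  | h2 m h =>
    rw [formalF_of_not_dvd _ h, formalF_of_not_dvd _ h, formalF_of_not_dvd _ (by omega)]; simp
  | h0 => simp [formalF_zero, formalF_of_neg]
  | h3 k =>
    rw [show (3 : ℤ) * ((k + 1 : ℕ) : ℤ) - 3 = 3 * (k : ℤ) by push_cast; ring, formalF_three_mul,
      formalF_three_mul, formalF_three_mul, show 2 * (k + 1) = 2 * k + 2 by ring,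
      airyCoeff_sub_two]

/-- The coefficients of the formal solution of the bare system in powers of `z ^ (-1 / 2)`. -/
def formalSol (N : ℕ) (i : Fin 3) (m : ℤ) : ℂ :=
  ![formalF (1 - N) (m - 2), -formalF (-N) (m - 1), formalF (-1 - N) m] i

lemma formalSol_of_neg (N : ℕ) (i : Fin 3) {m : ℤ} (h : m < 0) : formalSol N i m = 0 := by
  fin_cases i <;>
    simp [formalSol, formalF_of_neg, h, show m - 2 < 0 by omega, show m - 1 < 0 by omega]

/-- Writing a solution as z^{N/2+1/4} exp(-(2/3) z^{3/2}) v turns the system into v' - A v = z^{1/2}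
v - (N/2 + 1/4) z⁻¹ v. This lemma and the next two compare coefficients of z^{-m/2} in its three
rows. -/
lemma formalSol_eq_zero (N : ℕ) (m : ℤ) : formalSol N 0 (m + 1) =
    -formalSol N 1 m + (N / 2 + 1 / 4 - (m - 2) / 2) * formalSol N 0 (m - 2) := by
  have h := formalF_sub_one (1 - N) (m - 1)
  simp only [formalSol, Matrix.cons_val_zero, Matrix.cons_val_one]
  rw [show (1 : ℤ) - N - 1 = -N by ring, show m - 1 - 3 = m - 2 - 2 by ring] at h
  rw [show m + 1 - 2 = m - 1 by ring]
  push_cast at h ⊢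
  linear_combination (-1 : ℂ) * h

lemma formalSol_eq_one (N : ℕ) (m : ℤ) : formalSol N 1 (m + 1) =
    -formalSol N 2 m + (N / 2 + 1 / 4 - (m - 2) / 2) * formalSol N 1 (m - 2) := by
  have h := formalF_sub_one (-N) m
  simp only [formalSol, Matrix.cons_val_one, Matrix.cons_val]
  rw [show -(N : ℤ) - 1 = -1 - N by ring, show m - 3 = m - 2 - 1 by ring] at h
  rw [show m + 1 - 1 = m by ring]
  push_cast at h ⊢
  linear_combination h

lemma formalSol_eq_two (N : ℕ) (m : ℤ) : formalSol N 2 (m + 1) =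
    -N * formalSol N 0 m - formalSol N 1 (m + 2)
      + (N / 2 + 1 / 4 - (m - 2) / 2) * formalSol N 2 (m - 2) := by
  have h := formalF_sub_one (-1 - N) (m + 1)
  have h2 := formalF_sub_two (-N) (m + 1)
  simp only [formalSol, Matrix.cons_val_zero, Matrix.cons_val_one, Matrix.cons_val]
  rw [show -1 - (N : ℤ) - 1 = -N - 2 by ring, show m + 1 - 3 = m - 2 by ring, h2] at h
  rw [show -(N : ℤ) + 1 = 1 - N by ring, show m + 1 - 3 = m - 2 by ring] at h
  rw [show m + 2 - 1 = m + 1 by ring]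
  push_cast at h ⊢
  linear_combination (-1 : ℂ) * h

/-! ### The bare system and its adjoint -/

/-- The functions `u, u1, u2` are `u, u', u''` for an entire solution of `u''' = z u' + κ u`. -/
structure IsSol (κ : ℂ) (u u1 u2 : ℂ → ℂ) : Prop where
  d0 : ∀ z, HasDerivAt u (u1 z) z
  d1 : ∀ z, HasDerivAt u1 (u2 z) z
  d2 : ∀ z, HasDerivAt u2 (z * u1 z + κ * u z) z

lemma isSol_f (M : ℤ) : IsSol (1 - M) (f M) (fun z => -f (M - 1) z) (f (M - 2)) where
  d0 := hasDerivAt_f M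
  d1 z := by
    refine (hasDerivAt_f (M - 1) z).neg.congr_deriv ?_
    rw [neg_neg, show M - 1 - 1 = M - 2 by ring]
  d2 z := by
    refine (hasDerivAt_f (M - 2) z).congr_deriv ?_
    have h := f_recurrence (M - 1) z
    rw [show M - 1 - 2 = M - 2 - 1 by ring, show M - 1 + 1 = M by ring] at h
    rw [h]; push_cast; ring

lemma isSol_g (N : ℕ) : IsSol N (g N) (fun z => -N * g (N + 1) z)
    (fun z => N * (N + 1) * g (N + 2) z) where
  d0 := hasDerivAt_g N
  d1 z := by
    refine ((hasDerivAt_g (N + 1) z).const_mul (-(N : ℂ))).congr_deriv ?_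
    push_cast; ring_nf
  d2 z := by
    refine ((hasDerivAt_g (N + 2) z).const_mul ((N : ℂ) * (N + 1))).congr_deriv ?_
    rcases N with _ | n
    · simp
    · have h := g_recurrence n z
      rw [show n + 1 + 2 + 1 = n + 4 by ring, show n + 1 + 1 = n + 2 by ring]
      push_cast
      linear_combination (n + 1 : ℂ) * h

lemma IsSol.rot {κ : ℂ} {u u1 u2 : ℂ → ℂ} (h : IsSol κ u u1 u2) {ρ : ℂ} (hρ : ρ ^ 3 = 1) (k : ℂ) :
    IsSol κ (fun z => k * u (ρ * z)) (fun z => k * ρ * u1 (ρ * z))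
      (fun z => k * ρ ^ 2 * u2 (ρ * z)) where
  d0 z := by
    have hd := ((h.d0 (ρ * z)).comp z ((hasDerivAt_id z).const_mul ρ)).const_mul k
    exact hd.congr_deriv (by ring)
  d1 z := by
    have hd := ((h.d1 (ρ * z)).comp z ((hasDerivAt_id z).const_mul ρ)).const_mul (k * ρ)
    exact hd.congr_deriv (by ring)
  d2 z := by
    have hd := ((h.d2 (ρ * z)).comp z ((hasDerivAt_id z).const_mul ρ)).const_mul (k * ρ ^ 2)
    refine hd.congr_deriv ?_
    linear_combination (k * (ρ * z * u1 (ρ * z) + κ * u (ρ * z))) * hρ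

lemma IsSol.iteratedDeriv_one {κ : ℂ} {u u1 u2 : ℂ → ℂ} (h : IsSol κ u u1 u2) :
    iteratedDeriv 1 u = u1 := by
  rw [_root_.iteratedDeriv_one]; funext z; exact (h.d0 z).deriv

lemma IsSol.iteratedDeriv_two {κ : ℂ} {u u1 u2 : ℂ → ℂ} (h : IsSol κ u u1 u2) :
    iteratedDeriv 2 u = u2 := by
  rw [iteratedDeriv_succ, h.iteratedDeriv_one]; funext z; exact (h.d1 z).deriv

lemma IsSol.nabla_eq {κ : ℂ} {u u1 u2 : ℂ → ℂ} (h : IsSol κ u u1 u2) (z : ℂ) :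
    nabla u z = ![u z, u1 z, u2 z] := by
  funext i
  fin_cases i
  · simp [nabla]
  · simp only [nabla, Fin.mk_one, h.iteratedDeriv_one, Matrix.cons_val_one,
      Matrix.cons_val_zero]
  · simp only [nabla, Fin.reduceFinMk, h.iteratedDeriv_two, Matrix.cons_val]

/-- The row solution of the adjoint system attached to a scalar function. -/
def adjRow (φ φ1 φ2 : ℂ → ℂ) (z : ℂ) : Fin 3 → ℂ := ![φ2 z - z * φ z, -φ1 z, φ z]

lemma adjRow_dotProduct (φ φ1 φ2 : ℂ → ℂ) (z : ℂ) (v : Fin 3 → ℂ) :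
    adjRow φ φ1 φ2 z ⬝ᵥ v = (φ2 z - z * φ z) * v 0 - φ1 z * v 1 + φ z * v 2 := by
  simp [adjRow, dotProduct, Fin.sum_univ_three]
  ring

/-- The adjoint row satisfies r' = -r A, so (r · v)' = r · (v' - A v). The vector `v` is arbitrary
because this is also applied to polynomial truncations, which solve the system only up to lower
levels. -/
lemma IsSol.hasDerivAt_adjRow {κ : ℂ} {φ φ1 φ2 : ℂ → ℂ} (h : IsSol κ φ φ1 φ2)
    {v v' : ℂ → Fin 3 → ℂ} {z : ℂ} (hv : ∀ i, HasDerivAt (fun z => v z i) (v' z i) z) :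
    HasDerivAt (fun z => adjRow φ φ1 φ2 z ⬝ᵥ v z)
      (adjRow φ φ1 φ2 z ⬝ᵥ
        ![v' z 0 - v z 1, v' z 1 - v z 2, v' z 2 - (1 - κ) * v z 0 - z * v z 1]) z := by
  simp only [adjRow_dotProduct]
  have h0 := ((h.d2 z).sub ((hasDerivAt_id z).mul (h.d0 z))).mul (hv 0)
  have h1 := (h.d1 z).mul (hv 1)
  have h2 := (h.d0 z).mul (hv 2)
  refine ((h0.sub h1).add h2).congr_deriv ?_
  simp
  ring

lemma IsSol.adjRow_const {κ : ℂ} {φ φ1 φ2 u u1 u2 : ℂ → ℂ} (hu : IsSol κ u u1 u2)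
    (hφ : IsSol (1 - κ) φ φ1 φ2) (z w : ℂ) :
    adjRow φ φ1 φ2 z ⬝ᵥ ![u z, u1 z, u2 z] = adjRow φ φ1 φ2 w ⬝ᵥ ![u w, u1 w, u2 w] := by
  have hd : ∀ z, HasDerivAt (fun z => adjRow φ φ1 φ2 z ⬝ᵥ ![u z, u1 z, u2 z]) 0 z := fun z => by
    have h := hφ.hasDerivAt_adjRow (v := fun z => ![u z, u1 z, u2 z])
      (v' := fun z => ![u1 z, u2 z, z * u1 z + κ * u z]) (z := z) (fun i => by
        fin_cases i
        · exact hu.d0 z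
        · exact hu.d1 z
        · exact hu.d2 z)
    refine h.congr_deriv ?_
    rw [adjRow_dotProduct]
    simp
  exact is_const_of_deriv_eq_zero (𝕜 := ℂ) (fun z => (hd z).differentiableAt)
    (fun z => (hd z).deriv) z w

/-- Liouville's formula: the companion matrix has trace zero. -/
lemma det_const {κ : ℂ} {u u1 u2 v v1 v2 w w1 w2 : ℂ → ℂ} (hu : IsSol κ u u1 u2)
    (hv : IsSol κ v v1 v2) (hw : IsSol κ w w1 w2) (z z' : ℂ) :
    (ofCols ![u z, u1 z, u2 z] ![v z, v1 z, v2 z] ![w z, w1 z, w2 z]).det =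
      (ofCols ![u z', u1 z', u2 z'] ![v z', v1 z', v2 z'] ![w z', w1 z', w2 z']).det := by
  have e : ∀ z, (ofCols ![u z, u1 z, u2 z] ![v z, v1 z, v2 z] ![w z, w1 z, w2 z]).det =
      u z * (v1 z * w2 z - w1 z * v2 z) - v z * (u1 z * w2 z - w1 z * u2 z)
        + w z * (u1 z * v2 z - v1 z * u2 z) := fun z => by
    rw [Matrix.det_fin_three]
    simp [ofCols]
    ring
  have hd : ∀ z, HasDerivAt (fun z => u z * (v1 z * w2 z - w1 z * v2 z)
      - v z * (u1 z * w2 z - w1 z * u2 z) + w z * (u1 z * v2 z - v1 z * u2 z)) 0 z := fun z => by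
    have h := (((hu.d0 z).mul (((hv.d1 z).mul (hw.d2 z)).sub ((hw.d1 z).mul (hv.d2 z)))).sub
      ((hv.d0 z).mul (((hu.d1 z).mul (hw.d2 z)).sub ((hw.d1 z).mul (hu.d2 z))))).add
      ((hw.d0 z).mul (((hu.d1 z).mul (hv.d2 z)).sub ((hv.d1 z).mul (hu.d2 z))))
    refine h.congr_deriv ?_
    simp
    ring
  rw [e, e]
  exact is_const_of_deriv_eq_zero (𝕜 := ℂ) (fun z => (hd z).differentiableAt)
    (fun z => (hd z).deriv) _ _

/-! ### Constant-coefficient differential operators -/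

/-- The value at `z` of the constant-coefficient operator `m (∂)` applied to `φ`. -/
def applyDiff (φ : ℂ → ℂ) (z : ℂ) : Polynomial ℂ →ₗ[ℂ] ℂ :=
  Polynomial.lsum fun j => LinearMap.id.smulRight (iteratedDeriv j φ z)

lemma applyDiff_monomial (φ : ℂ → ℂ) (z : ℂ) (j : ℕ) (a : ℂ) :
    applyDiff φ z (Polynomial.monomial j a) = a * iteratedDeriv j φ z := by
  rw [applyDiff, Polynomial.lsum_apply, Polynomial.sum_monomial_index]
  · simp
  · simp

lemma applyDiff_eq_sum (φ : ℂ → ℂ) (z : ℂ) (m : Polynomial ℂ) {n : ℕ} (hn : m.natDegree < n) :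
    applyDiff φ z m = ∑ j ∈ Finset.range n, m.coeff j * iteratedDeriv j φ z := by
  rw [applyDiff, Polynomial.lsum_apply, Polynomial.sum_over_range' _ _ n hn]
  · simp
  · simp

lemma hasDerivAt_applyDiff {φ : ℂ → ℂ} (hφ : Differentiable ℂ φ) (m : Polynomial ℂ) (z : ℂ) :
    HasDerivAt (fun z => applyDiff φ z m) (applyDiff φ z (Polynomial.X * m)) z := by
  induction m using Polynomial.induction_on' with
  | add p q hp hq =>
    simp only [map_add, mul_add]
    exact hp.add hq
  | monomial j a =>
    rw [Polynomial.X_mul_monomial]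
    simp only [applyDiff_monomial]
    refine HasDerivAt.const_mul a ?_
    rw [iteratedDeriv_succ]
    exact ((hφ.contDiff (n := ⊤)).differentiable_iteratedDeriv j (by
      exact_mod_cast WithTop.coe_lt_top (j : ℕ∞)) z).hasDerivAt

/-! ### Polynomial parts of the formal solution -/

/-- The polynomial part of `z ^ (l / 2)` times the formal solution, restricted to integer powers. -/
def formalPoly (N : ℕ) (l : ℤ) (i : Fin 3) : Polynomial ℂ :=
  ∑ p ∈ Finset.range (l.toNat + 1), Polynomial.monomial p (formalSol N i (l - 2 * p))

lemma formalPoly_coeff (N : ℕ) (l : ℤ) (i : Fin 3) (p : ℕ) :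
    (formalPoly N l i).coeff p = formalSol N i (l - 2 * p) := by
  rw [formalPoly, Polynomial.finsetSum_coeff]
  simp only [Polynomial.coeff_monomial]
  rw [Finset.sum_ite_eq' (Finset.range _) p]
  split_ifs with h
  · rfl
  · rw [formalSol_of_neg]
    rw [Finset.mem_range] at h
    omega

lemma formalPoly_of_neg (N : ℕ) {l : ℤ} (hl : l < 0) (i : Fin 3) : formalPoly N l i = 0 := by
  ext p
  rw [formalPoly_coeff, formalSol_of_neg _ _ (by omega), Polynomial.coeff_zero]

lemma formalPoly_zero (N : ℕ) (i : Fin 3) :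
    formalPoly N 0 i = Polynomial.C (![0, 0, 1] i) := by
  ext p
  rw [formalPoly_coeff, Polynomial.coeff_C]
  rcases p with _ | p
  · fin_cases i <;> simp [formalSol, formalF_of_neg, formalF_zero]
  · rw [if_neg (by omega), formalSol_of_neg _ _ (by push_cast; omega)]

/-- For w = z^{l/2} v the equation of v gives w' - A w = z^{(l+1)/2} v + (l/2 - N/2 - 1/4)
z^{(l-2)/2} v. Taking polynomial parts commutes with differentiation and with constant coefficients,
so the first two rows carry over unchanged. -/
lemma formalPoly_eq_zero (N : ℕ) (l : ℤ) :
    (formalPoly N l 0).derivative - formalPoly N l 1 = formalPoly N (l + 1) 0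
      + Polynomial.C ((l / 2 - (N / 2 + 1 / 4) : ℂ)) * formalPoly N (l - 2) 0 := by
  ext p
  have h := formalSol_eq_zero N (l - 2 * p)
  simp only [Polynomial.coeff_sub, Polynomial.coeff_add, Polynomial.coeff_C_mul,
    Polynomial.coeff_derivative, formalPoly_coeff]
  rw [show l - 2 * (p : ℤ) + 1 = l + 1 - 2 * p by ring,
    show l - 2 * (p : ℤ) - 2 = l - 2 * (p + 1 : ℕ) by push_cast; ring] at h
  rw [show l - 2 - 2 * (p : ℤ) = l - 2 * (p + 1 : ℕ) by push_cast; ring, h]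
  push_cast
  ring

lemma formalPoly_eq_one (N : ℕ) (l : ℤ) :
    (formalPoly N l 1).derivative - formalPoly N l 2 = formalPoly N (l + 1) 1
      + Polynomial.C ((l / 2 - (N / 2 + 1 / 4) : ℂ)) * formalPoly N (l - 2) 1 := by
  ext p
  have h := formalSol_eq_one N (l - 2 * p)
  simp only [Polynomial.coeff_sub, Polynomial.coeff_add, Polynomial.coeff_C_mul,
    Polynomial.coeff_derivative, formalPoly_coeff]
  rw [show l - 2 * (p : ℤ) + 1 = l + 1 - 2 * p by ring,
    show l - 2 * (p : ℤ) - 2 = l - 2 * (p + 1 : ℕ) by push_cast; ring] at h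
  rw [show l - 2 - 2 * (p : ℤ) = l - 2 * (p + 1 : ℕ) by push_cast; ring, h]
  push_cast
  ring

/-- In the third row A multiplies by z. The polynomial part of z w₁ exceeds z times the polynomial
part of w₁ by the coefficient of z⁻¹ in w₁; this is the extra constant. -/
lemma formalPoly_eq_two (N : ℕ) (l : ℤ) :
    (formalPoly N l 2).derivative - Polynomial.C (N : ℂ) * formalPoly N l 0
      - Polynomial.X * formalPoly N l 1 = formalPoly N (l + 1) 2
      + Polynomial.C ((l / 2 - (N / 2 + 1 / 4) : ℂ)) * formalPoly N (l - 2) 2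
      + Polynomial.C (formalSol N 1 (l + 2)) := by
  ext p
  have h := formalSol_eq_two N (l - 2 * p)
  simp only [Polynomial.coeff_sub, Polynomial.coeff_add, Polynomial.coeff_C_mul,
    Polynomial.coeff_derivative, formalPoly_coeff, Polynomial.coeff_C]
  rw [show l - 2 * (p : ℤ) + 1 = l + 1 - 2 * p by ring,
    show l - 2 * (p : ℤ) - 2 = l - 2 * (p + 1 : ℕ) by push_cast; ring] at h
  rw [show l - 2 - 2 * (p : ℤ) = l - 2 * (p + 1 : ℕ) by push_cast; ring, h]
  rcases p with _ | p
  · simp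
    ring
  · rw [Polynomial.coeff_X_mul, formalPoly_coeff, if_neg (by omega),
      show l - 2 * ((p + 1 : ℕ) : ℤ) + 2 = l - 2 * p by push_cast; ring]
    push_cast
    ring

/-- Induction on the level. Differentiating the pairing at level l gives level l + 1, plus a
multiple of level l - 2, plus a constant times φ. On the other side it multiplies m_l by X. Hence
m_{l+1} = X m_l - c₁ m_{l-2} - c₂, which is monic of degree l + 1 and independent of φ. -/
lemma exists_diffOperator (N l : ℕ) :
    ∃ m : Polynomial ℂ, m.natDegree ≤ l ∧ m.coeff l = 1 ∧
      ∀ φ φ1 φ2 : ℂ → ℂ, IsSol (1 - N) φ φ1 φ2 → ∀ z,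
        adjRow φ φ1 φ2 z ⬝ᵥ (fun i => (formalPoly N l i).eval z) = applyDiff φ z m := by
  induction l using Nat.strong_induction_on with
  | _ l ih =>
    rcases l with _ | l
    · refine ⟨1, by simp, by simp, fun φ φ1 φ2 _ z => ?_⟩
      rw [adjRow_dotProduct]
      have : (1 : Polynomial ℂ) = Polynomial.monomial 0 1 := rfl
      rw [this, applyDiff_monomial]
      simp [formalPoly_zero]
    · obtain ⟨m, hm1, hm2, hm⟩ := ih l (by omega)
      -- The operator of level l - 2; for l < 2 the level is negative, the polynomial part is zero,
      -- and so is the operator.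
      obtain ⟨m', hm1', hm'⟩ : ∃ m' : Polynomial ℂ, m'.natDegree ≤ l ∧
          ∀ φ φ1 φ2 : ℂ → ℂ, IsSol (1 - N) φ φ1 φ2 → ∀ z,
          adjRow φ φ1 φ2 z ⬝ᵥ (fun i => (formalPoly N ((l : ℤ) - 2) i).eval z) =
            applyDiff φ z m' := by
        by_cases h2 : 2 ≤ l
        · obtain ⟨m', h1, -, h⟩ := ih (l - 2) (by omega)
          refine ⟨m', by omega, fun φ φ1 φ2 hφ z => ?_⟩
          rw [← h φ φ1 φ2 hφ z]
          push_cast [h2]; rfl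
        · refine ⟨0, by simp, fun φ φ1 φ2 hφ z => ?_⟩
          rw [adjRow_dotProduct]
          simp [formalPoly_of_neg N (show (l : ℤ) - 2 < 0 by omega)]
      set c1 : ℂ := (l : ℂ) / 2 - (N / 2 + 1 / 4)
      set c2 : ℂ := formalSol N 1 ((l : ℤ) + 2)
      refine ⟨Polynomial.X * m - Polynomial.C c1 * m' - Polynomial.C c2, ?_, ?_, ?_⟩
      · refine Polynomial.natDegree_sub_C.le.trans
          ((Polynomial.natDegree_sub_le _ _).trans (max_le ?_ ?_))
        · refine Polynomial.natDegree_mul_le.trans ?_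
          rw [Polynomial.natDegree_X]; omega
        · exact (Polynomial.natDegree_C_mul_le _ _).trans (by omega)
      · rw [Polynomial.coeff_sub, Polynomial.coeff_sub, Polynomial.coeff_X_mul,
          Polynomial.coeff_C_mul, Polynomial.coeff_eq_zero_of_natDegree_lt (p := m') (by omega),
          Polynomial.coeff_C, if_neg (by omega), hm2]
        simp
      · intro φ φ1 φ2 hφ z
        have hd1 := hφ.hasDerivAt_adjRow (v := fun z i => (formalPoly N l i).eval z)
          (v' := fun z i => (formalPoly N l i).derivative.eval z) (z := z)
          (fun i => Polynomial.hasDerivAt _ _)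
        have hd2 := hasDerivAt_applyDiff (fun z => (hφ.d0 z).differentiableAt) m z
        have heq : (fun z => adjRow φ φ1 φ2 z ⬝ᵥ (fun i => (formalPoly N l i).eval z)) =
            fun z => applyDiff φ z m := funext fun z => hm φ φ1 φ2 hφ z
        rw [heq] at hd1
        have hkey := hd1.unique hd2
        have e0 := congrArg (Polynomial.eval z) (formalPoly_eq_zero N l)
        have e1 := congrArg (Polynomial.eval z) (formalPoly_eq_one N l)
        have e2 := congrArg (Polynomial.eval z) (formalPoly_eq_two N l)
        simp only [Polynomial.eval_sub, Polynomial.eval_add, Polynomial.eval_mul, Polynomial.eval_C,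
          Polynomial.eval_X, Int.cast_natCast] at e0 e1 e2
        have hC : applyDiff φ z (Polynomial.C c2) = c2 * φ z := by
          rw [← Polynomial.monomial_zero_left, applyDiff_monomial, iteratedDeriv_zero]
        have hm'' := hm' φ φ1 φ2 hφ z
        rw [map_sub, map_sub, Polynomial.C_mul', map_smul, smul_eq_mul, hC, ← hkey, ← hm'']
        simp only [adjRow_dotProduct, Matrix.cons_val_zero, Matrix.cons_val_one, Matrix.cons_val]
        push_cast
        linear_combination (-(φ2 z - z * φ z)) * e0 + φ1 z * e1 - φ z * e2

/-! ### Asymptotic expansions in powers of a small function -/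

/-- `h ~ ∑ c_k t ^ k` along the filter `l`. -/
def HasExp (l : Filter ℂ) (t h : ℂ → ℂ) (c : PowerSeries ℂ) : Prop :=
  ∀ K : ℕ, (fun z => h z - ∑ k ∈ Finset.range K, PowerSeries.coeff k c * t z ^ k)
    =O[l] fun z => t z ^ K

variable {l : Filter ℂ} {t h h' : ℂ → ℂ} {c c' : PowerSeries ℂ}

lemma isBigO_pow_of_le (ht : Tendsto t l (𝓝 0)) {m n : ℕ} (hmn : n ≤ m) :
    (fun z => t z ^ m) =O[l] fun z => t z ^ n := by
  obtain ⟨k, rfl⟩ := Nat.exists_eq_add_of_le hmn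
  have h1 : (fun z => t z ^ k) =O[l] fun _ => (1 : ℂ) := (ht.pow k).isBigO_one ℂ
  simpa [pow_add] using (isBigO_refl (fun z => t z ^ n) l).mul h1

/-- Arbitrarily high orders suffice: the terms between order K and order K' are themselves O(t^K).
-/
lemma HasExp.of_frequently (ht : Tendsto t l (𝓝 0))
    (H : ∀ K : ℕ, ∃ K' ≥ K, (fun z => h z - ∑ k ∈ Finset.range K', PowerSeries.coeff k c * t z ^ k)
      =O[l] fun z => t z ^ K') : HasExp l t h c := fun K => by
  obtain ⟨K', hK, hO⟩ := H K
  have h2 : (fun z => ∑ k ∈ Finset.Ico K K', PowerSeries.coeff k c * t z ^ k)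
      =O[l] fun z => t z ^ K :=
    IsBigO.fun_sum fun k hk => (isBigO_pow_of_le ht (Finset.mem_Ico.1 hk).1).const_mul_left _
  refine ((hO.trans (isBigO_pow_of_le ht hK)).add h2).congr_left fun z => ?_
  rw [← Finset.sum_range_add_sum_Ico _ hK]
  ring

lemma HasExp.congr' (H : HasExp l t h c) (e : h =ᶠ[l] h') : HasExp l t h' c := fun K =>
  (H K).congr' (e.mono fun z hz => by simp only [hz]) EventuallyEq.rfl

lemma HasExp.congr_series (H : HasExp l t h c) (e : c = c') : HasExp l t h c' := e ▸ H

lemma hasExp_const (a : ℂ) : HasExp l t (fun _ => a) (PowerSeries.C a) := fun K => by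
  rcases K with _ | K
  · simpa using isBigO_const_const a (one_ne_zero : (1 : ℂ) ≠ 0) l
  · rw [show (fun z => a - ∑ k ∈ Finset.range (K + 1), PowerSeries.coeff k (PowerSeries.C a) * t z ^ k)
      = fun _ => 0 from funext fun z => ?_]
    · exact isBigO_zero _ _
    · rw [Finset.sum_range_succ', Finset.sum_eq_zero]
      · simp
      · intro b _
        simp

lemma HasExp.add (H : HasExp l t h c) (H' : HasExp l t h' c') :
    HasExp l t (fun z => h z + h' z) (c + c') := fun K =>
  ((H K).add (H' K)).congr_left fun z => by
    simp only [map_add, add_mul, Finset.sum_add_distrib]; ring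

lemma HasExp.isBigO_one (H : HasExp l t h c) : h =O[l] fun _ => (1 : ℂ) := by
  simpa using H 0

lemma HasExp.mul (ht : Tendsto t l (𝓝 0)) (H : HasExp l t h c) (H' : HasExp l t h' c') :
    HasExp l t (fun z => h z * h' z) (c * c') := fun K => by
  have hS : (fun z => ∑ k ∈ Finset.range K, PowerSeries.coeff k c * t z ^ k)
      =O[l] fun _ => (1 : ℂ) :=
    IsBigO.fun_sum fun k _ => (((ht.pow k).isBigO_one ℂ).const_mul_left _)
  have h1 := (H K).mul H'.isBigO_one
  have h2 := hS.mul (H' K)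
  have h3 : (fun z => ∑ q ∈ (Finset.range K ×ˢ Finset.range K).filter (fun q => K ≤ q.1 + q.2),
      PowerSeries.coeff q.1 c * PowerSeries.coeff q.2 c' * t z ^ (q.1 + q.2))
      =O[l] fun z => t z ^ K :=
    IsBigO.fun_sum fun q hq =>
      (isBigO_pow_of_le ht (Finset.mem_filter.1 hq).2).const_mul_left _
  simp only [mul_one, one_mul] at h1 h2
  refine ((h1.add h2).add h3).congr_left fun z => ?_
  have e := sum_range_mul_range (fun a b => PowerSeries.coeff a c * PowerSeries.coeff b c' *
    t z ^ (a + b)) K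
  have e1 : ∑ n ∈ Finset.range K, PowerSeries.coeff n (c * c') * t z ^ n =
      ∑ n ∈ Finset.range K, ∑ q ∈ Finset.HasAntidiagonal.antidiagonal n,
        PowerSeries.coeff q.1 c * PowerSeries.coeff q.2 c' * t z ^ (q.1 + q.2) := by
    refine Finset.sum_congr rfl fun n _ => ?_
    rw [PowerSeries.coeff_mul, Finset.sum_mul]
    refine Finset.sum_congr rfl fun q hq => ?_
    rw [Finset.HasAntidiagonal.mem_antidiagonal.1 hq]
  have e2 : (∑ k ∈ Finset.range K, PowerSeries.coeff k c * t z ^ k) *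
      (∑ k ∈ Finset.range K, PowerSeries.coeff k c' * t z ^ k) =
      ∑ a ∈ Finset.range K, ∑ b ∈ Finset.range K,
        PowerSeries.coeff a c * PowerSeries.coeff b c' * t z ^ (a + b) := by
    rw [Finset.sum_mul_sum]
    refine Finset.sum_congr rfl fun a _ => Finset.sum_congr rfl fun b _ => ?_
    rw [pow_add]; ring
  rw [e1]
  linear_combination -e2 - e

lemma HasExp.const_mul (ht : Tendsto t l (𝓝 0)) (a : ℂ) (H : HasExp l t h c) :
    HasExp l t (fun z => a * h z) (PowerSeries.C a * c) := (hasExp_const a).mul ht H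

lemma hasExp_self (ht : Tendsto t l (𝓝 0)) : HasExp l t t PowerSeries.X := by
  refine HasExp.of_frequently ht fun K => ⟨K + 2, by omega, ?_⟩
  rw [show (fun z => t z - ∑ k ∈ Finset.range (K + 2),
      PowerSeries.coeff k (PowerSeries.X : PowerSeries ℂ) * t z ^ k) = fun _ => 0
      from funext fun z => ?_]
  · exact isBigO_zero _ _
  · rw [Finset.sum_range_succ', Finset.sum_range_succ', Finset.sum_eq_zero]
    · simp [PowerSeries.coeff_X]
    · intro b _
      simp [PowerSeries.coeff_X]

lemma HasExp.pow (ht : Tendsto t l (𝓝 0)) (H : HasExp l t h c) (n : ℕ) :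
    HasExp l t (fun z => h z ^ n) (c ^ n) := by
  induction n with
  | zero => simpa using hasExp_const (l := l) (t := t) 1
  | succ n ih => simpa only [pow_succ] using ih.mul ht H

lemma HasExp.prod (ht : Tendsto t l (𝓝 0)) {ι : Type*} (s : Finset ι) {F : ι → ℂ → ℂ}
    {C : ι → PowerSeries ℂ} (H : ∀ i ∈ s, HasExp l t (F i) (C i)) :
    HasExp l t (fun z => ∏ i ∈ s, F i z) (∏ i ∈ s, C i) := by
  classical
  induction s using Finset.induction_on with
  | empty => simpa using hasExp_const (l := l) (t := t) 1
  | insert a s ha ih =>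
    simp only [Finset.prod_insert ha]
    exact (H a (Finset.mem_insert_self _ _)).mul ht
      (ih fun i hi => H i (Finset.mem_insert_of_mem hi))

lemma HasExp.rescale {σ : ℂ} (H : HasExp l (fun z => σ * t z) h c) :
    HasExp l t h (PowerSeries.rescale σ c) := fun K => by
  have h1 := H K
  have e : (fun z => (σ * t z) ^ K) =O[l] fun z => t z ^ K :=
    ((isBigO_refl (fun z => t z ^ K) l).const_mul_left (σ ^ K)).congr_left fun z => by
      rw [mul_pow]
  refine (h1.trans e).congr_left fun z => ?_
  congr 1
  refine Finset.sum_congr rfl fun k _ => ?_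
  rw [PowerSeries.coeff_rescale, mul_pow]; ring

lemma HasExp.div_self (ht0 : ∀ᶠ z in l, t z ≠ 0) (H : HasExp l t h (PowerSeries.X * c)) :
    HasExp l t (fun z => (t z)⁻¹ * h z) c := fun K => by
  have h1 := (isBigO_refl (fun z => (t z)⁻¹) l).mul (H (K + 1))
  refine h1.congr' (ht0.mono fun z hz => ?_) (ht0.mono fun z hz => ?_)
  · simp only
    rw [Finset.sum_range_succ', mul_sub]
    congr 1
    simp only [PowerSeries.coeff_succ_X_mul, PowerSeries.coeff_zero_X_mul, zero_mul, add_zero]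
    rw [Finset.mul_sum]
    refine Finset.sum_congr rfl fun k _ => ?_
    rw [pow_succ]; field_simp
  · simp only
    rw [pow_succ]; field_simp

lemma HasExp.of_even (H : HasExp l t h c) (hodd : ∀ k, PowerSeries.coeff (2 * k + 1) c = 0)
    (heven : ∀ k, PowerSeries.coeff k c' = PowerSeries.coeff (2 * k) c) :
    HasExp l (fun z => t z ^ 2) h c' := fun K => by
  have e : ∀ z, ∑ k ∈ Finset.range (2 * K), PowerSeries.coeff k c * t z ^ k =
      ∑ k ∈ Finset.range K, PowerSeries.coeff k c' * (t z ^ 2) ^ k := fun z => by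
    induction K with
    | zero => simp
    | succ K ih =>
      rw [show 2 * (K + 1) = 2 * K + 1 + 1 by ring, Finset.sum_range_succ, Finset.sum_range_succ,
        Finset.sum_range_succ, ih, hodd, heven, ← pow_mul]
      ring
  have h1 := H (2 * K)
  simp only [e, pow_mul] at h1
  exact h1

lemma HasExp.tendsto (ht : Tendsto t l (𝓝 0)) (H : HasExp l t h c) :
    Tendsto h l (𝓝 (PowerSeries.coeff 0 c)) := by
  have h1 := H 1
  simp only [pow_one, Finset.range_one, Finset.sum_singleton, pow_zero, mul_one] at h1
  have h2 := h1.trans_tendsto ht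
  simpa using h2.add_const (PowerSeries.coeff 0 c)

/-- If all coefficients below K agree, the difference of the K-th ones is a constant that is O(t),
hence zero. -/
lemma HasExp.unique [l.NeBot] (ht : Tendsto t l (𝓝 0)) (ht0 : ∀ᶠ z in l, t z ≠ 0)
    (H : HasExp l t h c) (H' : HasExp l t h c') : c = c' := by
  have hsub : ∀ K : ℕ, (∀ k < K, PowerSeries.coeff k c = PowerSeries.coeff k c') →
      PowerSeries.coeff K c = PowerSeries.coeff K c' := fun K hK => by
    have h1 := ((H' (K + 1)).sub (H (K + 1))).congr_left
      (f₂ := fun z => (PowerSeries.coeff K c - PowerSeries.coeff K c') * t z ^ K) fun z => by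
      have e : ∑ k ∈ Finset.range K, PowerSeries.coeff k c * t z ^ k =
          ∑ k ∈ Finset.range K, PowerSeries.coeff k c' * t z ^ k :=
        Finset.sum_congr rfl fun k hk => by rw [hK k (Finset.mem_range.1 hk)]
      rw [Finset.sum_range_succ, Finset.sum_range_succ, e]
      ring
    have h2 := h1.mul (isBigO_refl (fun z => (t z ^ K)⁻¹) l)
    have h3 : (fun _ : ℂ => PowerSeries.coeff K c - PowerSeries.coeff K c') =O[l] t := by
      refine h2.congr' (ht0.mono fun z hz => ?_) (ht0.mono fun z hz => ?_)
      · simp only; field_simp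
      · simp only; rw [pow_succ]; field_simp
    have h4 := h3.trans_tendsto ht
    exact sub_eq_zero.1 (tendsto_nhds_unique tendsto_const_nhds h4)
  ext K
  induction K using Nat.strong_induction_on with
  | _ K ih => exact hsub K ih

lemma HasExp.sup {l' : Filter ℂ} (H : HasExp l t h c) (G : HasExp l' t h c) :
    HasExp (l ⊔ l') t h c := fun K => (H K).sup (G K)

/-! ### Square roots under rotations -/

lemma arg_polar {r θ : ℝ} (hr : 0 < r) (h1 : -Real.pi < θ) (h2 : θ ≤ Real.pi) :
    ((r : ℂ) * exp (θ * I)).arg = θ := by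
  rw [Complex.exp_mul_I]
  exact Complex.arg_mul_cos_add_sin_mul_I hr ⟨h1, h2⟩

lemma sqrtC_polar {r θ : ℝ} (hr : 0 < r) (h1 : -Real.pi < θ) (h2 : θ < Real.pi) :
    sqrtC ((r : ℂ) * exp (θ * I)) = (Real.sqrt r : ℂ) * exp ((θ / 2 : ℝ) * I) := by
  refine sqrtC_eq_of_sq ?_ ?_
  · rw [mul_pow, ← ofReal_pow, Real.sq_sqrt hr.le, ← exp_nat_mul]
    congr 2
    push_cast; ring
  · rw [re_ofReal_mul, Complex.exp_ofReal_mul_I_re]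
    exact mul_pos (Real.sqrt_pos.2 hr)
      (Real.cos_pos_of_mem_Ioo ⟨by linarith, by linarith⟩)

lemma mul_exp_polar (z : ℂ) (β : ℝ) :
    z * exp (β * I) = (‖z‖ : ℂ) * exp ((z.arg + β : ℝ) * I) := by
  conv_lhs => rw [← Complex.norm_mul_exp_arg_mul_I z]
  push_cast
  rw [add_mul, exp_add]; ring

lemma arg_rot {z : ℂ} (hz : z ≠ 0) {β : ℝ} (h1 : -Real.pi < z.arg + β)
    (h2 : z.arg + β ≤ Real.pi) : (z * exp (β * I)).arg = z.arg + β := by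
  rw [mul_exp_polar, arg_polar (norm_pos_iff.2 hz) h1 h2]

lemma norm_rot (z : ℂ) (β : ℝ) : ‖z * exp (β * I)‖ = ‖z‖ := by
  rw [norm_mul, Complex.norm_exp_ofReal_mul_I, mul_one]

lemma sqrtC_rot {z : ℂ} (hz : z ≠ 0) (hz' : z.arg < Real.pi) {β : ℝ} (h1 : -Real.pi < z.arg + β)
    (h2 : z.arg + β < Real.pi) : sqrtC (z * exp (β * I)) = sqrtC z * exp ((β / 2 : ℝ) * I) := by
  have hn := norm_pos_iff.2 hz
  rw [mul_exp_polar, sqrtC_polar hn h1 h2]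
  conv_rhs => rw [← Complex.norm_mul_exp_arg_mul_I z,
    sqrtC_polar hn (Complex.neg_pi_lt_arg z) hz']
  rw [mul_assoc, ← exp_add]
  congr 2
  push_cast; ring

lemma arg_sqrtC {z : ℂ} (hz : z ≠ 0) (hz' : z.arg < Real.pi) : (sqrtC z).arg = z.arg / 2 := by
  have hn := norm_pos_iff.2 hz
  have h := Complex.neg_pi_lt_arg z
  have hpi := Real.pi_pos
  conv_lhs => rw [← Complex.norm_mul_exp_arg_mul_I z, sqrtC_polar hn h hz']
  exact arg_polar (Real.sqrt_pos.2 hn) (by linarith) (by linarith)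

lemma root4_rot {z : ℂ} (hz : z ≠ 0) (hz' : z.arg < Real.pi) {β : ℝ} (h1 : -Real.pi < z.arg + β)
    (h2 : z.arg + β < Real.pi) : root4 (z * exp (β * I)) = root4 z * exp ((β / 4 : ℝ) * I) := by
  have h := Complex.neg_pi_lt_arg z
  have hpi := Real.pi_pos
  rw [root4, root4, sqrtC_rot hz hz' h1 h2, sqrtC_rot (sqrtC_ne_zero hz)]
  · rw [show β / 2 / 2 = β / 4 by ring]
  · rw [arg_sqrtC hz hz']; linarith
  · rw [arg_sqrtC hz hz']; linarith
  · rw [arg_sqrtC hz hz']; linarith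

/-! ### Complex powers in terms of the roots -/

lemma sqrtC_cube (z : ℂ) : z ^ (3 / 2 : ℂ) = sqrtC z ^ 3 := by
  rw [sqrtC, ← Complex.cpow_nat_mul]; congr 1; norm_num

lemma cpow_half_nat (z : ℂ) (n : ℕ) : z ^ (n / 2 : ℂ) = sqrtC z ^ n := by
  rw [sqrtC, ← Complex.cpow_nat_mul]; congr 1; ring

lemma cpow_neg_half (z : ℂ) : z ^ (-(1 / 2) : ℂ) = (sqrtC z)⁻¹ := by
  rw [sqrtC, Complex.cpow_neg]

lemma root4_eq_cpow (z : ℂ) : root4 z = z ^ (1 / 4 : ℂ) := by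
  have him : (Complex.log z * (1 / 2)).im = z.arg / 2 := by
    have : Complex.log z * (1 / 2) = Complex.log z * ((1 / 2 : ℝ) : ℂ) := by push_cast; ring
    rw [this, im_mul_ofReal, Complex.log_im]; ring
  have hpi := Real.pi_pos
  have h1 := Complex.neg_pi_lt_arg z
  have h2 := Complex.arg_le_pi z
  rw [root4, sqrtC, sqrtC, ← Complex.cpow_mul _ (by rw [him]; linarith) (by rw [him]; linarith)]
  norm_num

lemma cpow_quarter_odd (z : ℂ) (N : ℕ) :
    z ^ (N / 2 + 1 / 4 : ℂ) = root4 z ^ (2 * N + 1) := by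
  rw [root4_eq_cpow, ← Complex.cpow_nat_mul]; congr 1; push_cast; ring

lemma cpow_neg_add_half {z : ℂ} (hz : z ≠ 0) (N : ℕ) :
    z ^ (-N + 1 / 2 : ℂ) = sqrtC z * (z ^ N)⁻¹ := by
  rw [Complex.cpow_add _ _ hz, Complex.cpow_neg, Complex.cpow_natCast, sqrtC, mul_comm]

/-! ### Neighbourhoods of infinity in a sector -/

/-- The filter of neighbourhoods of infinity in `U`. -/
abbrev infIn (U : Set ℂ) : Filter ℂ := Bornology.cobounded ℂ ⊓ 𝓟 U

lemma eventually_infIn {U : Set ℂ} {p : ℂ → Prop} (h : ∀ z ∈ U, 1 ≤ ‖z‖ → p z) :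
    ∀ᶠ z in infIn U, p z := by
  rw [eventually_inf_principal]
  filter_upwards [eventually_cobounded_le_norm (E := ℂ) 1] with z hz hU using h z hU hz

lemma tendsto_inv_infIn (U : Set ℂ) : Tendsto (fun z : ℂ => z⁻¹) (infIn U) (𝓝 0) :=
  (tendsto_inv₀_cobounded (α := ℂ)).mono_left inf_le_left

lemma tendsto_sqrtC_inv_infIn (U : Set ℂ) :
    Tendsto (fun z : ℂ => (sqrtC z)⁻¹) (infIn U) (𝓝 0) := by
  rw [tendsto_zero_iff_norm_tendsto_zero]
  have h := (tendsto_zero_iff_norm_tendsto_zero.1 (tendsto_inv_infIn U)).sqrt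
  rw [Real.sqrt_zero] at h
  refine h.congr fun z => ?_
  rw [← sqrtC_sq z, norm_inv, norm_pow, ← inv_pow, Real.sqrt_sq (by positivity), norm_inv,
    sqrtC_sq]

/-- A ray inside the sector makes the filter nontrivial, as the uniqueness of limits and of
expansions requires. -/
lemma infIn_neBot {U : Set ℂ} {θ : ℝ} (h : ∀ r : ℝ, 0 < r → (r : ℂ) * exp (θ * I) ∈ U) :
    (infIn U).NeBot := by
  have ht : Tendsto (fun r : ℝ => (r : ℂ) * exp (θ * I)) atTop (infIn U) := by
    refine tendsto_inf.2 ⟨?_, tendsto_principal.2 ((eventually_gt_atTop 0).mono h)⟩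
    rw [← tendsto_norm_atTop_iff_cobounded]
    refine tendsto_id.congr' ((eventually_gt_atTop 0).mono fun r hr => ?_)
    change r = ‖_‖
    rw [norm_mul, Complex.norm_exp_ofReal_mul_I, mul_one, norm_real, Real.norm_of_nonneg hr.le]
  exact ht.neBot

lemma HasExp.of_cube {l : Filter ℂ} {t h : ℂ → ℂ} (ht : Tendsto t l (𝓝 0)) {c : PowerSeries ℂ}
    {a : ℕ → ℂ} (hc : ∀ m, ¬ 3 ∣ m → PowerSeries.coeff m c = 0)
    (ha : ∀ k, PowerSeries.coeff (3 * k) c = a k)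
    (H : ∀ K, (fun z => h z - ∑ k ∈ Finset.range K, a k * (t z ^ 3) ^ k)
      =O[l] fun z => (t z ^ 3) ^ K) : HasExp l t h c := by
  refine HasExp.of_frequently ht fun K => ⟨3 * K, by omega, ?_⟩
  have e : ∀ z, ∑ k ∈ Finset.range (3 * K), PowerSeries.coeff k c * t z ^ k =
      ∑ k ∈ Finset.range K, a k * (t z ^ 3) ^ k := fun z => by
    induction K with
    | zero => simp
    | succ K ih =>
      rw [show 3 * (K + 1) = 3 * K + 1 + 1 + 1 by ring, Finset.sum_range_succ,
        Finset.sum_range_succ, Finset.sum_range_succ, Finset.sum_range_succ, ih, ha,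
        hc (3 * K + 1) (by omega), hc (3 * K + 1 + 1) (by omega), ← pow_mul]
      ring
  simpa only [e, pow_mul] using H K

/-! ### Expansions in a rotated frame -/

/-- The series of `normF M` in powers of `z ^ (-1 / 2)`. -/
def airySeries (M : ℤ) : PowerSeries ℂ := PowerSeries.mk fun m => formalF M m

/-- The series of `normG M` in powers of `z⁻¹`. -/
def gSeries (M : ℕ) : PowerSeries ℂ :=
  PowerSeries.mk fun m => if 3 ∣ m then gCoeff M (m / 3) else 0

/-- The point `z` turned by the angle `4 * α`. -/
def turn (α : ℝ) (z : ℂ) : ℂ := exp (α * I) ^ 4 * z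

lemma turn_eq (α : ℝ) (z : ℂ) : turn α z = z * exp ((4 * α : ℝ) * I) := by
  rw [turn, mul_comm, ← Complex.exp_nat_mul]
  congr 2; push_cast; ring

lemma norm_turn (α : ℝ) (z : ℂ) : ‖turn α z‖ = ‖z‖ := by rw [turn_eq, norm_rot]

/-- The rotation by `4 * α` maps the sector `U` into a closed sector that avoids the negative
axis. -/
structure TurnsInto (U : Set ℂ) (α lo hi : ℝ) : Prop where
  ne_zero : ∀ z ∈ U, z ≠ 0
  arg_lt : ∀ z ∈ U, z.arg < Real.pi
  lo_le : ∀ z ∈ U, lo ≤ z.arg + 4 * α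
  le_hi : ∀ z ∈ U, z.arg + 4 * α ≤ hi

namespace TurnsInto

variable {U : Set ℂ} {α lo hi : ℝ}

lemma arg_turn (h : TurnsInto U α lo hi) (hlo : -Real.pi < lo) (hhi : hi < Real.pi) {z : ℂ}
    (hz : z ∈ U) : (turn α z).arg = z.arg + 4 * α := by
  have h1 := h.lo_le z hz
  have h2 := h.le_hi z hz
  rw [turn_eq, arg_rot (h.ne_zero z hz) (by linarith) (by linarith)]

lemma sqrtC_turn (h : TurnsInto U α lo hi) (hlo : -Real.pi < lo) (hhi : hi < Real.pi) {z : ℂ}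
    (hz : z ∈ U) : sqrtC (turn α z) = sqrtC z * exp (α * I) ^ 2 := by
  have h1 := h.lo_le z hz
  have h2 := h.le_hi z hz
  rw [turn_eq, sqrtC_rot (h.ne_zero z hz) (h.arg_lt z hz) (by linarith) (by linarith),
    ← Complex.exp_nat_mul]
  congr 2; push_cast; ring

lemma root4_turn (h : TurnsInto U α lo hi) (hlo : -Real.pi < lo) (hhi : hi < Real.pi) {z : ℂ}
    (hz : z ∈ U) : root4 (turn α z) = root4 z * exp (α * I) := by
  have h1 := h.lo_le z hz
  have h2 := h.le_hi z hz
  rw [turn_eq, root4_rot (h.ne_zero z hz) (h.arg_lt z hz) (by linarith) (by linarith)]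
  congr 2; push_cast; ring

/-- With η = e^{iα}, the turn multiplies the fourth root of z by η, hence z^{3/2} by η⁶ = σ. The
expansion, a series in z^{-3/2}, thus becomes the same series at σ z^{-1/2}, since σ³ = σ. The
equality of the series for σ = 1 and σ = -1 is what later allows the passage to integer powers. -/
lemma hasExp_normF (h : TurnsInto U α lo hi) (hlo : -Real.pi < lo) (hhi : hi < Real.pi) {σ : ℂ}
    (hσ : σ ^ 2 = 1) (hα : exp (α * I) ^ 6 = σ) (M : ℤ) :
    HasExp (infIn U) (fun z => σ * (sqrtC z)⁻¹) (fun z => normF M (turn α z)) (airySeries M) := by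
  have hη := exp_ne_zero (α * I)
  have hσ0 : σ ≠ 0 := fun h0 => by simp [h0] at hσ
  refine HasExp.of_cube (a := fun k => airyCoeff M (2 * k)) ?_ ?_ ?_ fun K => ?_
  · simpa using (tendsto_sqrtC_inv_infIn U).const_mul σ
  · intro m hm
    rw [airySeries, PowerSeries.coeff_mk, formalF_of_not_dvd _ (by exact_mod_cast hm)]
  · intro k
    rw [airySeries, PowerSeries.coeff_mk]
    push_cast
    exact formalF_three_mul M k
  -- The order is 2K because the odd coefficients vanish; δ is the margin between [lo, hi] and ±π.
  · obtain ⟨C, hC⟩ := normF_expansion M (δ := min (min (lo + Real.pi) (Real.pi - hi)) Real.pi)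
      (lt_min (lt_min (by linarith) (by linarith)) Real.pi_pos) (min_le_right _ _) (2 * K)
    have e0 : ∀ z ∈ U, (σ * (sqrtC z)⁻¹) ^ 3 = ((root4 (turn α z) ^ 3)⁻¹) ^ 2 := fun z hz => by
      have hp := root4_ne_zero (h.ne_zero z hz)
      rw [h.root4_turn hlo hhi hz, ← root4_sq z]
      have : (exp (α * I) ^ 6)⁻¹ = σ ^ 3 := by
        rw [hα]; field_simp; linear_combination (-(σ ^ 2 + 1)) * hσ
      calc (σ * (root4 z ^ 2)⁻¹) ^ 3 = σ ^ 3 * (root4 z ^ 6)⁻¹ := by field_simp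
        _ = _ := by rw [← this]; field_simp
    refine IsBigO.of_bound C (eventually_infIn fun z hz hz1 => ?_)
    have hm1 := min_le_left (min (lo + Real.pi) (Real.pi - hi)) Real.pi
    have hm2 := min_le_left (lo + Real.pi) (Real.pi - hi)
    have hm3 := min_le_right (lo + Real.pi) (Real.pi - hi)
    have h1 := h.lo_le z hz
    have h2 := h.le_hi z hz
    have hb := hC (turn α z) (by rwa [norm_turn]) (by
      rw [h.arg_turn hlo hhi hz, abs_le]; constructor <;> linarith)
    rw [e0 z hz, ← pow_mul, norm_pow]
    convert hb using 3
    clear hb hC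
    induction K with
    | zero => simp
    | succ K ih =>
      rw [show 2 * (K + 1) = 2 * K + 1 + 1 by ring, Finset.sum_range_succ, Finset.sum_range_succ,
        Finset.sum_range_succ, ih, airyCoeff_odd M (odd_two_mul_add_one K), ← pow_mul]
      ring

lemma hasExp_normG (h : TurnsInto U α lo hi) (hlo : -(Real.pi / 3) < lo) (hhi : hi < Real.pi)
    (hα : (exp (α * I) ^ 4) ^ 3 = 1) (M : ℕ) :
    HasExp (infIn U) (fun z => z⁻¹) (fun z => normG M (turn α z)) (gSeries M) := by
  have hpi := Real.pi_pos
  refine HasExp.of_cube (a := gCoeff M) (tendsto_inv_infIn U) ?_ ?_ fun K => ?_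
  · intro m hm
    rw [gSeries, PowerSeries.coeff_mk, if_neg hm]
  · intro k
    rw [gSeries, PowerSeries.coeff_mk, if_pos (dvd_mul_right _ _), Nat.mul_div_cancel_left _ three_pos]
  · obtain ⟨C, hC⟩ := normG_expansion M
      (δ := min (min (lo + Real.pi / 3) (Real.pi - hi)) (Real.pi / 6))
      (lt_min (lt_min (by linarith) (by linarith)) (by linarith))
      ((min_le_right _ _).trans_lt (by linarith)) K
    refine IsBigO.of_bound C (eventually_infIn fun z hz hz1 => ?_)
    have hm1 := min_le_left (min (lo + Real.pi / 3) (Real.pi - hi)) (Real.pi / 6)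
    have hm2 := min_le_left (lo + Real.pi / 3) (Real.pi - hi)
    have hm3 := min_le_right (lo + Real.pi / 3) (Real.pi - hi)
    have h1 := h.lo_le z hz
    have h2 := h.le_hi z hz
    have ha := h.arg_turn (by linarith) hhi hz
    have hb := hC (turn α z) (by rwa [norm_turn]) (by rw [ha]; linarith) (by rw [ha]; linarith)
    have e0 : (turn α z)⁻¹ ^ 3 = z⁻¹ ^ 3 := by
      rw [turn, mul_inv, mul_pow, inv_pow, hα]; simp
    rw [e0] at hb
    simpa only [norm_pow] using hb

/-- The function `f` in a rotated frame. -/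
lemma f_turn (h : TurnsInto U α lo hi) (hlo : -Real.pi < lo) (hhi : hi < Real.pi) {σ : ℂ}
    (hα : exp (α * I) ^ 6 = σ) (M : ℤ) {z : ℂ} (hz : z ∈ U) :
    f M (turn α z) = (Real.sqrt 2 : ℂ)⁻¹ * exp (-(σ * (2 / 3 * sqrtC z ^ 3))) *
      (sqrtC z ^ M)⁻¹ * (root4 z)⁻¹ * (exp (α * I) ^ (2 * M + 1))⁻¹ * normF M (turn α z) := by
  have hη := exp_ne_zero (α * I)
  have hz0 := h.ne_zero z hz
  rw [f_eq_normF M (z := turn α z) (mul_ne_zero (pow_ne_zero _ hη) hz0), h.sqrtC_turn hlo hhi hz, h.root4_turn hlo hhi hz,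
    zpow_add₀ hη, zpow_one, mul_zpow, zpow_mul, ← hα]
  rw [show -(2 / 3) * (sqrtC z * exp (α * I) ^ 2) ^ 3 =
    -(exp (α * I) ^ 6 * (2 / 3 * sqrtC z ^ 3)) by ring]
  simp only [mul_inv, zpow_ofNat]
  ring

end TurnsInto

lemma gCoeff_zero (N : ℕ) : gCoeff N 0 = 1 := by
  rcases N with _ | n
  · simp [gCoeff]
  · have h : ((n.factorial : ℕ) : ℂ) ≠ 0 := by exact_mod_cast n.factorial_ne_zero
    have hI : (-I) ^ (n + 1) * I ^ (n + 1) = 1 := by rw [← mul_pow]; simp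
    simp only [gCoeff, expCoeff, Nat.succ_ne_zero, if_false, Nat.add_sub_cancel, mul_zero, add_zero,
      pow_zero, Nat.factorial_zero, Nat.cast_one, div_one, mul_one]
    field_simp
    linear_combination hI

/-! ### Columns and rows in a rotated frame -/

section Frames

variable {κ : ℂ} {u u1 u2 : ℂ → ℂ} {α : ℝ}

lemma IsSol.turn (h : IsSol κ u u1 u2) (hα : (exp (α * I) ^ 4) ^ 3 = 1) (k : ℂ) :
    IsSol κ (fun z => k * u (turn α z)) (fun z => k * exp (α * I) ^ 4 * u1 (turn α z))
      (fun z => k * (exp (α * I) ^ 4) ^ 2 * u2 (turn α z)) := h.rot hα k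

lemma IsSol.smul_nabla_turn (h : IsSol κ u u1 u2) (hα : (exp (α * I) ^ 4) ^ 3 = 1) (k z : ℂ) :
    k • nabla (fun x => u (KontsevichPenner.turn α x)) z =
      ![k * u (KontsevichPenner.turn α z), k * exp (α * I) ^ 4 * u1 (KontsevichPenner.turn α z),
        k * (exp (α * I) ^ 4) ^ 2 * u2 (KontsevichPenner.turn α z)] := by
  have e := (h.turn hα 1).nabla_eq z
  simp only [one_mul] at e
  rw [e]
  funext i
  fin_cases i
  · simp
  · simp [mul_assoc]
  · simp [mul_assoc]

lemma isSol_f_one_sub (N : ℕ) :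
    IsSol N (f (1 - N)) (fun z => -f (-N) z) (f (-1 - N)) := by
  have h := isSol_f (1 - N)
  rw [show (1 : ℤ) - N - 1 = -N by ring, show (1 : ℤ) - N - 2 = -1 - N by ring] at h
  push_cast at h
  rwa [sub_sub_cancel] at h

lemma isSol_f_nat (N : ℕ) : IsSol (1 - N) (f N) (fun z => -f (N - 1) z) (f (N - 2)) := by
  have h := isSol_f N
  push_cast at h
  exact h

/-- The adjoint row of `c * f N` in a rotated frame. -/
lemma adjRow_f_turn (N : ℕ) (hα : (exp (α * I) ^ 4) ^ 3 = 1) (k z : ℂ) :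
    adjRow (fun z => k * f N (turn α z)) (fun z => k * exp (α * I) ^ 4 * -f (N - 1) (turn α z))
      (fun z => k * (exp (α * I) ^ 4) ^ 2 * f (N - 2) (turn α z)) z =
    ![k * (exp (α * I) ^ 4) ^ 2 * (N * f (N + 1) (turn α z)),
      k * exp (α * I) ^ 4 * f (N - 1) (turn α z), k * f N (turn α z)] := by
  have h := f_recurrence N (turn α z)
  funext i
  fin_cases i
  · simp only [adjRow, Fin.zero_eta, Matrix.cons_val_zero]
    rw [h, turn]
    push_cast
    linear_combination (k * z * f N (exp (α * I) ^ 4 * z)) * hα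
  · simp [adjRow]
  · simp [adjRow]

variable {U : Set ℂ} {lo hi : ℝ}

/-- The hypothesis on `k` normalizes the column so that its asymptotic form depends on the sign σ
alone, not on the sector. The second column of `Psi` has σ = 1, the third σ = -1. -/
lemma TurnsInto.col_eq (h : TurnsInto U α lo hi) (hlo : -Real.pi < lo) (hhi : hi < Real.pi) {σ : ℂ}
    (hσ : σ ^ 2 = 1) (hα : exp (α * I) ^ 6 = σ) {N : ℕ} {k : ℂ}
    (hk : k * exp (α * I) ^ (2 * N) = -σ * exp (α * I) ^ 3) {z : ℂ} (hz : z ∈ U) :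
    k • nabla (fun x => f (1 - N) (turn α x)) z =
      (-σ * ((Real.sqrt 2 : ℂ)⁻¹ * root4 z ^ (2 * N + 1) *
        exp (-(σ * (2 / 3 * sqrtC z ^ 3))))) •
      ![(σ * (sqrtC z)⁻¹) ^ 2 * normF (1 - N) (turn α z),
        -(σ * (sqrtC z)⁻¹ * normF (-N) (turn α z)), normF (-1 - N) (turn α z)] := by
  have hη := exp_ne_zero (α * I)
  have hz0 := h.ne_zero z hz
  have hp := root4_ne_zero hz0
  have h12 : (exp (α * I) ^ 4) ^ 3 = 1 := by
    rw [← pow_mul, show 4 * 3 = 6 * 2 by norm_num, pow_mul, hα, hσ]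
  rw [(isSol_f_one_sub N).smul_nabla_turn h12, h.f_turn hlo hhi hα _ hz, h.f_turn hlo hhi hα _ hz,
    h.f_turn hlo hhi hα _ hz, ← root4_sq z]
  set p := root4 z
  set η := exp (α * I)
  have hk' : k = -σ * η ^ 3 * (η ^ (2 * N))⁻¹ := by
    rw [← hk]; field_simp
  have e0 : ((p ^ 2) ^ ((1 : ℤ) - N))⁻¹ = p ^ (2 * N) * (p ^ 2)⁻¹ := by
    rw [zpow_sub₀ (pow_ne_zero _ hp), zpow_one, zpow_natCast, inv_div, pow_mul, div_eq_mul_inv]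
  have e1 : ((p ^ 2) ^ (-(N : ℤ)))⁻¹ = p ^ (2 * N) := by
    rw [zpow_neg, inv_inv, zpow_natCast, pow_mul]
  have e2 : ((p ^ 2) ^ (-1 - (N : ℤ)))⁻¹ = p ^ (2 * N) * p ^ 2 := by
    rw [show -1 - (N : ℤ) = -((N + 1 : ℕ) : ℤ) by push_cast; ring, zpow_neg, inv_inv, zpow_natCast,
      pow_succ, pow_mul]
  have d0 : (η ^ (2 * (1 - (N : ℤ)) + 1))⁻¹ = η ^ (2 * N) * (η ^ 3)⁻¹ := by
    rw [show 2 * (1 - (N : ℤ)) + 1 = ((3 : ℕ) : ℤ) - (2 * N : ℕ) by push_cast; ring, zpow_sub₀ hη,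
      zpow_natCast, zpow_natCast, inv_div, div_eq_mul_inv]
  have d1 : (η ^ (2 * (-(N : ℤ)) + 1))⁻¹ = η ^ (2 * N) * η⁻¹ := by
    rw [show 2 * (-(N : ℤ)) + 1 = ((1 : ℕ) : ℤ) - (2 * N : ℕ) by push_cast; ring, zpow_sub₀ hη,
      zpow_natCast, zpow_natCast, inv_div, div_eq_mul_inv, pow_one]
  have d2 : (η ^ (2 * (-1 - (N : ℤ)) + 1))⁻¹ = η ^ (2 * N) * η := by
    rw [show 2 * (-1 - (N : ℤ)) + 1 = -((2 * N + 1 : ℕ) : ℤ) by push_cast; ring, zpow_neg, inv_inv,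
      zpow_natCast, pow_succ]
  rw [e0, e1, e2, d0, d1, d2, hk']
  have h6 : η ^ 6 = σ := hα
  funext i
  fin_cases i
  · simp only [Fin.zero_eta, Matrix.cons_val_zero, Pi.smul_apply, smul_eq_mul]
    rw [mul_pow, hσ, pow_succ p (2 * N)]
    field_simp
  · simp only [Fin.mk_one, Matrix.cons_val_one, Matrix.cons_val_zero, Pi.smul_apply, smul_eq_mul]
    rw [pow_succ p (2 * N), ← h6]
    field_simp
  · simp only [Fin.reduceFinMk, Matrix.cons_val, Pi.smul_apply, smul_eq_mul]
    rw [pow_succ p (2 * N)]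
    have : η ^ 12 = 1 := by rw [← h12]; ring
    field_simp
    linear_combination (-σ * normF (-1 - N) (turn α z)) * this

lemma TurnsInto.row_eq (h : TurnsInto U α lo hi) (hlo : -Real.pi < lo) (hhi : hi < Real.pi) {σ : ℂ}
    (hσ : σ ^ 2 = 1) (hα : exp (α * I) ^ 6 = σ) (N : ℕ) {z : ℂ} (hz : z ∈ U) :
    ![exp (α * I) ^ (2 * N + 1) * (exp (α * I) ^ 4) ^ 2 * (N * f (N + 1) (turn α z)),
      exp (α * I) ^ (2 * N + 1) * exp (α * I) ^ 4 * f (N - 1) (turn α z),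
      exp (α * I) ^ (2 * N + 1) * f N (turn α z)] =
    ((Real.sqrt 2 : ℂ)⁻¹ * (root4 z ^ (2 * N + 1))⁻¹ * exp (-(σ * (2 / 3 * sqrtC z ^ 3)))) •
      ![N * (σ * (sqrtC z)⁻¹) * normF (N + 1) (turn α z),
        (σ * (sqrtC z)⁻¹)⁻¹ * normF (N - 1) (turn α z), normF N (turn α z)] := by
  have hη := exp_ne_zero (α * I)
  have hz0 := h.ne_zero z hz
  have hp := root4_ne_zero hz0
  have hσ0 : σ ≠ 0 := fun h0 => by simp [h0] at hσ
  have hσ' : σ⁻¹ = σ := by field_simp; linear_combination -hσ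
  rw [h.f_turn hlo hhi hα _ hz, h.f_turn hlo hhi hα _ hz, h.f_turn hlo hhi hα _ hz, ← root4_sq z]
  set p := root4 z
  set η := exp (α * I)
  have h6 : η ^ 6 = σ := hα
  have hp2 : p ^ 2 ≠ 0 := pow_ne_zero _ hp
  have e0 : ((p ^ 2) ^ ((N : ℤ) + 1))⁻¹ = (p ^ (2 * N))⁻¹ * (p ^ 2)⁻¹ := by
    rw [zpow_add₀ hp2, zpow_one, zpow_natCast, mul_inv, pow_mul]
  have e1 : ((p ^ 2) ^ ((N : ℤ) - 1))⁻¹ = (p ^ (2 * N))⁻¹ * p ^ 2 := by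
    rw [zpow_sub₀ hp2, zpow_one, zpow_natCast, inv_div, pow_mul]; field_simp
  have e2 : ((p ^ 2) ^ (N : ℤ))⁻¹ = (p ^ (2 * N))⁻¹ := by
    rw [zpow_natCast, pow_mul]
  have d0 : (η ^ (2 * ((N : ℤ) + 1) + 1))⁻¹ = (η ^ (2 * N + 1))⁻¹ * (η ^ 2)⁻¹ := by
    rw [show 2 * ((N : ℤ) + 1) + 1 = ((2 * N + 1 + 2 : ℕ) : ℤ) by push_cast; ring,
      zpow_natCast, pow_add, mul_inv]
  have d1 : (η ^ (2 * ((N : ℤ) - 1) + 1))⁻¹ = (η ^ (2 * N + 1))⁻¹ * η ^ 2 := by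
    rw [show 2 * ((N : ℤ) - 1) + 1 = ((2 * N + 1 : ℕ) : ℤ) - (2 : ℕ) by push_cast; ring,
      zpow_sub₀ hη, zpow_natCast, zpow_natCast, inv_div]; field_simp
  have d2 : (η ^ (2 * (N : ℤ) + 1))⁻¹ = (η ^ (2 * N + 1))⁻¹ := by
    rw [show 2 * (N : ℤ) + 1 = ((2 * N + 1 : ℕ) : ℤ) by push_cast; ring, zpow_natCast]
  rw [e0, e1, e2, d0, d1, d2]
  funext i
  fin_cases i
  · simp only [Fin.zero_eta, Matrix.cons_val_zero, Pi.smul_apply, smul_eq_mul]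
    rw [pow_succ p (2 * N), ← h6]
    field_simp
  · simp only [Fin.mk_one, Matrix.cons_val_one, Matrix.cons_val_zero, Pi.smul_apply, smul_eq_mul]
    rw [pow_succ p (2 * N), mul_inv σ, hσ', ← h6]
    field_simp
  · simp only [Fin.reduceFinMk, Matrix.cons_val, Pi.smul_apply, smul_eq_mul]
    rw [pow_succ p (2 * N)]
    field_simp

lemma TurnsInto.gCol_eq (h : TurnsInto U α lo hi) (hα : (exp (α * I) ^ 4) ^ 3 = 1) (N : ℕ) {z : ℂ}
    (hz : z ∈ U) :
    (exp (α * I) ^ 4) ^ N • nabla (fun x => g N (turn α x)) z =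
      (z ^ N)⁻¹ • ![normG N (turn α z), -N * z⁻¹ * normG (N + 1) (turn α z),
        N * (N + 1) * z⁻¹ ^ 2 * normG (N + 2) (turn α z)] := by
  have hz0 := h.ne_zero z hz
  rw [(isSol_g N).smul_nabla_turn hα]
  simp only [normG]
  have e : turn α z = exp (α * I) ^ 4 * z := rfl
  generalize turn α z = w at *
  subst e
  simp only [mul_pow]
  funext i
  fin_cases i
  · simp; field_simp
  · simp; field_simp; ring
  · simp; field_simp; ring

end Frames

/-! ### The four sectors -/

/-- The data that describe `Psi` and the functions `φ` in one sector, by three rotations. -/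
structure Chart (N : ℕ) (b : Angles) (U : Set ℂ) (α₁ α₂ α₃ : ℝ) (k₂ k₃ : ℂ) : Prop where
  psi : ∀ z ∈ U, Psi N b z = ofCols
    ((exp (α₁ * I) ^ 4) ^ N • nabla (fun x => g N (turn α₁ x)) z)
    (k₂ • nabla (fun x => f (1 - N) (turn α₂ x)) z)
    (k₃ • nabla (fun x => f (1 - N) (turn α₃ x)) z)
  lam : ∀ p ∈ U, phiLam N b p = fun x => exp (α₂ * I) ^ (2 * N + 1) * f N (turn α₂ x)
  mu : ∀ p ∈ U, phiMu N b p = fun x => exp (α₃ * I) ^ (2 * N + 1) * f N (turn α₃ x)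
  cube : (exp (α₁ * I) ^ 4) ^ 3 = 1
  sixth₂ : exp (α₂ * I) ^ 6 = 1
  sixth₃ : exp (α₃ * I) ^ 6 = -1
  coef₂ : k₂ * exp (α₂ * I) ^ (2 * N) = -exp (α₂ * I) ^ 3
  coef₃ : k₃ * exp (α₃ * I) ^ (2 * N) = exp (α₃ * I) ^ 3
  turns₁ : ∃ lo hi, -(Real.pi / 3) < lo ∧ hi < Real.pi ∧ TurnsInto U α₁ lo hi
  turns₂ : ∃ lo hi, -Real.pi < lo ∧ hi < Real.pi ∧ TurnsInto U α₂ lo hi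
  turns₃ : ∃ lo hi, -Real.pi < lo ∧ hi < Real.pi ∧ TurnsInto U α₃ lo hi
  neBot : (infIn U).NeBot
  -- The g-column shares its rotation with one of the two f-columns and is ahead of the other by
  -- 2π/3. So in either f-frame its argument on the positive axis is 0 or 2π/3, inside the sector
  -- -π/3 < arg < π where g is controlled.
  link : α₁ = α₂ ∧ (∀ x, turn α₂ x = turn (Real.pi / 6) (turn α₃ x)) ∨
    α₁ = α₃ ∧ ∀ x, turn α₃ x = turn (Real.pi / 6) (turn α₂ x)

lemma exp_eq_of_sub {x y : ℂ} (n : ℤ) (h : x = y + n * (2 * Real.pi * I)) : exp x = exp y :=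
  Complex.exp_eq_exp_iff_exists_int.2 ⟨n, h⟩

lemma omegaPow_natCast (a : ℂ) (N : ℕ) : omegaPow a ^ N = omegaPow (N * a) := by
  rw [omegaPow, omegaPow, ← Complex.exp_nat_mul]; congr 1; ring

lemma turn_zero (x : ℂ) : turn 0 x = x := by simp [turn]

lemma turn_pi_div_three (x : ℂ) : turn (Real.pi / 3) x = omegaPow (-1) * x := by
  rw [turn, ← Complex.exp_nat_mul, omegaPow, exp_eq_of_sub 1]
  push_cast; ring

lemma turn_neg_pi_div_three (x : ℂ) : turn (-(Real.pi / 3)) x = omegaPow 1 * x := by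
  rw [turn, ← Complex.exp_nat_mul, omegaPow, exp_eq_of_sub (-1)]
  push_cast; ring

lemma turn_pi_div_six (x : ℂ) : turn (Real.pi / 6) x = omegaPow 1 * x := by
  rw [turn, ← Complex.exp_nat_mul, omegaPow, exp_eq_of_sub 0]
  push_cast; ring

lemma turn_neg_pi_div_six (x : ℂ) : turn (-(Real.pi / 6)) x = omegaPow (-1) * x := by
  rw [turn, ← Complex.exp_nat_mul, omegaPow, exp_eq_of_sub 0]
  push_cast; ring

lemma omegaPow_add (a b : ℂ) : omegaPow a * omegaPow b = omegaPow (a + b) := by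
  rw [omegaPow, omegaPow, omegaPow, ← exp_add]; congr 1; ring

lemma omegaPow_add_int (a : ℂ) (n : ℤ) : omegaPow (a + 3 * n) = omegaPow a :=
  exp_eq_of_sub n (by ring)

lemma exp_four {α : ℝ} {a : ℂ} (h : ∀ x, turn α x = omegaPow a * x) :
    exp (α * I) ^ 4 = omegaPow a := by
  simpa [turn] using h 1

lemma exp_pi_div_three (n : ℕ) :
    exp ((Real.pi / 3 : ℝ) * I) ^ n = omegaPow (n / 2) := by
  rw [omegaPow, ← Complex.exp_nat_mul]; congr 1; push_cast; ring

lemma exp_neg_pi_div_three (n : ℕ) :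
    exp ((-(Real.pi / 3) : ℝ) * I) ^ n = omegaPow (-n / 2) := by
  rw [omegaPow, ← Complex.exp_nat_mul]; congr 1; push_cast; ring

lemma exp_pi_div_six (n : ℕ) :
    exp ((Real.pi / 6 : ℝ) * I) ^ n = omegaPow (n / 4) := by
  rw [omegaPow, ← Complex.exp_nat_mul]; congr 1; push_cast; ring

lemma exp_neg_pi_div_six (n : ℕ) :
    exp ((-(Real.pi / 6) : ℝ) * I) ^ n = omegaPow (-n / 4) := by
  rw [omegaPow, ← Complex.exp_nat_mul]; congr 1; push_cast; ring

lemma omegaPow_zero : omegaPow 0 = 1 := by simp [omegaPow]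

lemma omegaPow_three : omegaPow 3 = 1 := by
  simpa [omegaPow_zero] using omegaPow_add_int 0 1

lemma omegaPow_three_halves : omegaPow (3 / 2) = -1 := by
  rw [omegaPow, ← exp_pi_mul_I]; congr 1; ring

lemma omegaPow_neg_three_halves : omegaPow (-3 / 2) = -1 := by
  rw [← omegaPow_three_halves, ← omegaPow_add_int (-3 / 2) 1]; norm_num

lemma omegaPow_three_quarters : omegaPow (3 / 4) = I := by
  refine Eq.trans ?_ exp_pi_div_two_mul_I
  rw [omegaPow]; congr 1; ring

lemma omegaPow_neg_three_quarters : omegaPow (-3 / 4) = -I := by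
  have h := omegaPow_add (3 / 4) (-3 / 2)
  rw [omegaPow_three_quarters, omegaPow_neg_three_halves] at h
  rw [show (-3 / 4 : ℂ) = 3 / 4 + -3 / 2 by norm_num, ← h]; ring

section Charts

variable (b : Angles) (N : ℕ)

lemma disjoint_sectors {z : ℂ} :
    (z ∈ sectorII b → z ∉ sectorI b) ∧ (z ∈ sectorIII b → z ∉ sectorI b ∧ z ∉ sectorII b) ∧
      (z ∈ sectorIV b → z ∉ sectorI b ∧ z ∉ sectorII b ∧ z ∉ sectorIII b) := by
  have h2 := b.betaMinus_lt
  have h3 := b.lt_betaZero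
  have h4 := b.betaZero_lt
  have h5 := b.lt_betaPlus
  have hpi := Real.pi_pos
  simp only [sectorI, sectorII, sectorIII, sectorIV, Set.mem_ofPred_eq, not_and, not_lt]
  refine ⟨?_, ?_, ?_⟩
  · rintro ⟨_, h, _⟩ _ _; linarith
  · rintro ⟨_, h, _⟩; exact ⟨fun _ _ => by linarith, fun _ _ => by linarith⟩
  · rintro ⟨_, h, _⟩
    exact ⟨fun _ _ => by linarith, fun _ _ => by linarith, fun _ _ => by linarith⟩

lemma ray_mem {θ : ℝ} (h1 : -Real.pi < θ) (h2 : θ ≤ Real.pi) {r : ℝ} (hr : 0 < r) :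
    (r : ℂ) * exp (θ * I) ≠ 0 ∧ ((r : ℂ) * exp (θ * I)).arg = θ :=
  ⟨mul_ne_zero (by exact_mod_cast hr.ne') (exp_ne_zero _), arg_polar hr h1 h2⟩

/-- ω⁻¹ is realized as rotation by 4π/3, not -2π/3: for arg z near -π this keeps arg z + 4α inside
(-π, π), where the principal roots rotate by the expected factors. For the same reason `chart_IV`
realizes ω as rotation by -4π/3. -/
lemma chart_I : Chart N b (sectorI b) (Real.pi / 3) (Real.pi / 3) (Real.pi / 6)
    (omegaPow (-N)) (I * omegaPow (-N / 2)) := by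
  have h1 := b.neg_pi_lt
  have h2 := b.betaMinus_lt
  have hpi := Real.pi_pos
  have hT : TurnsInto (sectorI b) (Real.pi / 3) (Real.pi / 3) (b.betaMinus + 4 * (Real.pi / 3)) :=
    ⟨fun z h => h.1, fun z h => by linarith [h.2.2], fun z h => by linarith [h.2.1],
      fun z h => by linarith [h.2.2]⟩
  refine
  { psi := fun z hz => ?_
    lam := fun z hz => ?_
    mu := fun z hz => ?_
    cube := ?_
    sixth₂ := ?_
    sixth₃ := ?_
    coef₂ := ?_
    coef₃ := ?_
    turns₁ := ⟨_, _, by linarith, by linarith, hT⟩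
    turns₂ := ⟨_, _, by linarith, by linarith, hT⟩
    turns₃ := ⟨-(Real.pi / 3), b.betaMinus + 2 * (Real.pi / 3), by linarith, by linarith,
      ⟨fun z h => h.1, fun z h => by linarith [h.2.2], fun z h => by linarith [h.2.1],
      fun z h => by linarith [h.2.2]⟩⟩
    neBot := infIn_neBot (θ := (b.betaMinus - Real.pi) / 2) fun r hr => ?_
    link := Or.inl ⟨rfl, fun x => ?_⟩ }
  · rw [Psi, if_pos hz, exp_four turn_pi_div_three, omegaPow_natCast]
    simp only [turn_pi_div_three, turn_pi_div_six, mul_neg, mul_one]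
  · rw [phiLam, if_pos hz, exp_pi_div_three]
    simp only [turn_pi_div_three]
    rw [show ((2 * N + 1 : ℕ) : ℂ) / 2 = N + 1 / 2 by push_cast; ring]
  · rw [phiMu, if_pos (Set.mem_union_left _ hz), exp_pi_div_six]
    simp only [turn_pi_div_six]
    rw [show ((2 * N + 1 : ℕ) : ℂ) / 4 = N / 2 + 1 / 4 by push_cast; ring]
  · rw [← pow_mul, exp_pi_div_three, ← omegaPow_zero, ← omegaPow_add_int 0 2]; norm_num
  · rw [exp_pi_div_three, ← omegaPow_three]; norm_num
  · rw [exp_pi_div_six, ← omegaPow_three_halves]; norm_num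
  · rw [exp_pi_div_three, exp_pi_div_three, omegaPow_add]
    push_cast
    rw [omegaPow_three_halves, show -(N : ℂ) + 2 * N / 2 = 0 by ring, omegaPow_zero, neg_neg]
  · rw [exp_pi_div_six, exp_pi_div_six, mul_assoc, omegaPow_add]
    push_cast
    rw [omegaPow_three_quarters, show -(N : ℂ) / 2 + 2 * N / 4 = 0 by ring, omegaPow_zero, mul_one]
  · obtain ⟨e1, e2⟩ := ray_mem (θ := (b.betaMinus - Real.pi) / 2) (by linarith) (by linarith) hr
    exact ⟨e1, by rw [e2]; linarith, by rw [e2]; linarith⟩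
  · rw [turn_pi_div_three, turn_pi_div_six, turn_pi_div_six, ← mul_assoc, omegaPow_add,
      ← omegaPow_add_int (-1) 1]
    norm_num

lemma chart_II : Chart N b (sectorII b) (Real.pi / 6) 0 (Real.pi / 6)
    (-1) (I * omegaPow (-N / 2)) := by
  have h1 := b.neg_pi_lt
  have h2 := b.betaMinus_lt
  have h3 := b.lt_betaZero
  have h4 := b.betaZero_lt
  have hpi := Real.pi_pos
  have hT : TurnsInto (sectorII b) (Real.pi / 6) (b.betaMinus + 2 * (Real.pi / 3))
      (b.betaZero + 2 * (Real.pi / 3)) :=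
    ⟨fun z h => h.1, fun z h => by linarith [h.2.2], fun z h => by linarith [h.2.1],
      fun z h => by linarith [h.2.2]⟩
  refine
  { psi := fun z hz => ?_
    lam := fun z hz => ?_
    mu := fun z hz => ?_
    cube := ?_
    sixth₂ := by simp
    sixth₃ := ?_
    coef₂ := by simp
    coef₃ := ?_
    turns₁ := ⟨_, _, by linarith, by linarith, hT⟩
    turns₂ := ⟨b.betaMinus, b.betaZero, by linarith, by linarith,
      ⟨fun z h => h.1, fun z h => by linarith [h.2.2], fun z h => by linarith [h.2.1],
      fun z h => by linarith [h.2.2]⟩⟩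
    turns₃ := ⟨_, _, by linarith, by linarith, hT⟩
    neBot := infIn_neBot (θ := (b.betaMinus + b.betaZero) / 2) fun r hr => ?_
    link := Or.inr ⟨rfl, fun x => by rw [turn_zero]⟩ }
  · rw [Psi, if_neg ((disjoint_sectors b).1 hz), if_pos hz, exp_four turn_pi_div_six,
      omegaPow_natCast]
    simp only [turn_zero, turn_pi_div_six, mul_one, neg_smul, one_smul]
  · rw [phiLam, if_neg ((disjoint_sectors b).1 hz), if_pos (Set.mem_union_left _ hz)]
    simp [turn_zero]
  · rw [phiMu, if_pos (Set.mem_union_right _ hz), exp_pi_div_six]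
    simp only [turn_pi_div_six]
    rw [show ((2 * N + 1 : ℕ) : ℂ) / 4 = N / 2 + 1 / 4 by push_cast; ring]
  · rw [← pow_mul, exp_pi_div_six, ← omegaPow_three]; norm_num
  · rw [exp_pi_div_six, ← omegaPow_three_halves]; norm_num
  · rw [exp_pi_div_six, exp_pi_div_six, mul_assoc, omegaPow_add]
    push_cast
    rw [omegaPow_three_quarters, show -(N : ℂ) / 2 + 2 * N / 4 = 0 by ring, omegaPow_zero, mul_one]
  · obtain ⟨e1, e2⟩ := ray_mem (θ := (b.betaMinus + b.betaZero) / 2) (by linarith) (by linarith) hr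
    exact ⟨e1, by rw [e2]; linarith, by rw [e2]; linarith⟩

lemma chart_III : Chart N b (sectorIII b) 0 0 (-(Real.pi / 6))
    (-1) (-(I * omegaPow (N / 2))) := by
  have h3 := b.lt_betaZero
  have h4 := b.betaZero_lt
  have h5 := b.lt_betaPlus
  have h6 := b.betaPlus_lt
  have hpi := Real.pi_pos
  have hT : TurnsInto (sectorIII b) 0 b.betaZero b.betaPlus :=
    ⟨fun z h => h.1, fun z h => by linarith [h.2.2], fun z h => by linarith [h.2.1],
      fun z h => by linarith [h.2.2]⟩
  refine
  { psi := fun z hz => ?_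
    lam := fun z hz => ?_
    mu := fun z hz => ?_
    cube := by simp
    sixth₂ := by simp
    sixth₃ := ?_
    coef₂ := by simp
    coef₃ := ?_
    turns₁ := ⟨_, _, by linarith, by linarith, hT⟩
    turns₂ := ⟨_, _, by linarith, by linarith, hT⟩
    turns₃ := ⟨b.betaZero - 2 * (Real.pi / 3), b.betaPlus - 2 * (Real.pi / 3), by linarith,
      by linarith, ⟨fun z h => h.1, fun z h => by linarith [h.2.2], fun z h => by linarith [h.2.1],
      fun z h => by linarith [h.2.2]⟩⟩
    neBot := infIn_neBot (θ := (b.betaZero + b.betaPlus) / 2) fun r hr => ?_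
    link := Or.inl ⟨rfl, fun x => ?_⟩ }
  · rw [Psi, if_neg ((disjoint_sectors b).2.1 hz).1, if_neg ((disjoint_sectors b).2.1 hz).2,
      if_pos hz]
    simp only [turn_zero, turn_neg_pi_div_six, neg_smul, one_smul, ofReal_zero, zero_mul, exp_zero,
      one_pow]
  · rw [phiLam, if_neg ((disjoint_sectors b).2.1 hz).1, if_pos (Set.mem_union_right _ hz)]
    simp [turn_zero]
  · rw [phiMu, if_neg (mt (Set.mem_union _ _ _).1 <| not_or.2 ((disjoint_sectors b).2.1 hz)), exp_neg_pi_div_six]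
    simp only [turn_neg_pi_div_six]
    rw [show -((2 * N + 1 : ℕ) : ℂ) / 4 = -N / 2 - 1 / 4 by push_cast; ring]
  · rw [exp_neg_pi_div_six, ← omegaPow_neg_three_halves]; norm_num
  · rw [exp_neg_pi_div_six, exp_neg_pi_div_six, neg_mul, mul_assoc, omegaPow_add]
    push_cast
    rw [omegaPow_neg_three_quarters, show (N : ℂ) / 2 + -(2 * N) / 4 = 0 by ring, omegaPow_zero,
      mul_one]
  · obtain ⟨e1, e2⟩ := ray_mem (θ := (b.betaZero + b.betaPlus) / 2) (by linarith) (by linarith) hr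
    exact ⟨e1, by rw [e2]; linarith, by rw [e2]; linarith⟩
  · rw [turn_zero, turn_pi_div_six, turn_neg_pi_div_six, ← mul_assoc, omegaPow_add]
    norm_num [omegaPow_zero]

lemma chart_IV : Chart N b (sectorIV b) (-(Real.pi / 6)) (-(Real.pi / 3)) (-(Real.pi / 6))
    (omegaPow N) (-(I * omegaPow (N / 2))) := by
  have h5 := b.lt_betaPlus
  have h6 := b.betaPlus_lt
  have hpi := Real.pi_pos
  have hT : TurnsInto (sectorIV b) (-(Real.pi / 6)) (b.betaPlus - 2 * (Real.pi / 3))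
      (Real.pi / 3) :=
    ⟨fun z h => h.1, fun z h => by linarith [h.2.2], fun z h => by linarith [h.2.1],
      fun z h => by linarith [h.2.2]⟩
  refine
  { psi := fun z hz => ?_
    lam := fun z hz => ?_
    mu := fun z hz => ?_
    cube := ?_
    sixth₂ := ?_
    sixth₃ := ?_
    coef₂ := ?_
    coef₃ := ?_
    turns₁ := ⟨_, _, by linarith, by linarith, hT⟩
    turns₂ := ⟨b.betaPlus - 4 * (Real.pi / 3), -(Real.pi / 3), by linarith, by linarith,
      ⟨fun z h => h.1, fun z h => by linarith [h.2.2], fun z h => by linarith [h.2.1],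
      fun z h => by linarith [h.2.2]⟩⟩
    turns₃ := ⟨_, _, by linarith, by linarith, hT⟩
    neBot := infIn_neBot (θ := (b.betaPlus + Real.pi) / 2) fun r hr => ?_
    link := Or.inr ⟨rfl, fun x => ?_⟩ }
  · rw [Psi, if_neg ((disjoint_sectors b).2.2 hz).1, if_neg ((disjoint_sectors b).2.2 hz).2.1,
      if_neg ((disjoint_sectors b).2.2 hz).2.2, if_pos hz, exp_four turn_neg_pi_div_six,
      omegaPow_natCast]
    simp only [turn_neg_pi_div_three, turn_neg_pi_div_six, mul_neg, mul_one]
  · rw [phiLam, if_neg ((disjoint_sectors b).2.2 hz).1,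
      if_neg (mt (Set.mem_union _ _ _).1 <| not_or.2 ((disjoint_sectors b).2.2 hz).2), exp_neg_pi_div_three]
    simp only [turn_neg_pi_div_three]
    rw [show -((2 * N + 1 : ℕ) : ℂ) / 2 = -N - 1 / 2 by push_cast; ring]
  · rw [phiMu, if_neg (mt (Set.mem_union _ _ _).1 <| not_or.2 ⟨((disjoint_sectors b).2.2 hz).1, ((disjoint_sectors b).2.2 hz).2.1⟩),
      exp_neg_pi_div_six]
    simp only [turn_neg_pi_div_six]
    rw [show -((2 * N + 1 : ℕ) : ℂ) / 4 = -N / 2 - 1 / 4 by push_cast; ring]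
  · rw [← pow_mul, exp_neg_pi_div_six, ← omegaPow_zero, ← omegaPow_add_int _ 1]; norm_num
  · rw [exp_neg_pi_div_three, ← omegaPow_zero, ← omegaPow_add_int _ 1]; norm_num
  · rw [exp_neg_pi_div_six, ← omegaPow_neg_three_halves]; norm_num
  · rw [exp_neg_pi_div_three, exp_neg_pi_div_three, omegaPow_add]
    push_cast
    rw [omegaPow_neg_three_halves, show (N : ℂ) + -(2 * N) / 2 = 0 by ring, omegaPow_zero, neg_neg]
  · rw [exp_neg_pi_div_six, exp_neg_pi_div_six, neg_mul, mul_assoc, omegaPow_add]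
    push_cast
    rw [omegaPow_neg_three_quarters, show (N : ℂ) / 2 + -(2 * N) / 4 = 0 by ring, omegaPow_zero,
      mul_one]
  · obtain ⟨e1, e2⟩ := ray_mem (θ := (b.betaPlus + Real.pi) / 2) (by linarith) (by linarith) hr
    exact ⟨e1, by rw [e2]; linarith, by rw [e2]; linarith⟩
  · rw [turn_neg_pi_div_three, turn_pi_div_six, turn_neg_pi_div_six, ← mul_assoc, omegaPow_add,
      ← omegaPow_add_int (-1) 1]
    norm_num

end Charts

/-! ### Behaviour on the positive axis -/

lemma sqrtC_ofReal {x : ℝ} (hx : 0 < x) : sqrtC x = (Real.sqrt x : ℂ) :=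
  sqrtC_eq_of_sq (by rw [← ofReal_pow, Real.sq_sqrt hx.le]) (by
    rw [ofReal_re]; exact Real.sqrt_pos.2 hx)

lemma tendsto_f_ofReal (M : ℤ) : Tendsto (fun x : ℝ => f M x) atTop (𝓝 0) := by
  -- At order 0 the expansion is simply a bound on `normF`; `δ = π` leaves only the positive axis.
  obtain ⟨C, hC⟩ := normF_expansion M Real.pi_pos le_rfl 0
  simp only [Finset.range_zero, Finset.sum_empty, sub_zero, pow_zero, mul_one] at hC
  have hlim : Tendsto (fun x : ℝ => C * (Real.sqrt x ^ M.natAbs * Real.exp (-Real.sqrt x))) atTop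
      (𝓝 0) := by
    simpa using ((Real.tendsto_pow_mul_exp_neg_atTop_nhds_zero M.natAbs).comp
      Real.tendsto_sqrt_atTop).const_mul C
  refine squeeze_zero_norm' ?_ hlim
  filter_upwards [eventually_ge_atTop 4] with x hx
  have hx0 : (0 : ℝ) < x := by linarith
  have hy : 2 ≤ Real.sqrt x := Real.le_sqrt_of_sq_le (by linarith)
  have hz : (x : ℂ) ≠ 0 := by exact_mod_cast hx0.ne'
  have hF := hC x (by rw [norm_real, Real.norm_of_nonneg hx0.le]; linarith) (by
    rw [Complex.arg_ofReal_of_nonneg hx0.le]; simp)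
  have hC0 : 0 ≤ C := (norm_nonneg _).trans hF
  have hp : 1 ≤ ‖root4 x‖ := by
    have h : ‖root4 x‖ ^ 2 = Real.sqrt x := by
      rw [← norm_pow, root4_sq, sqrtC_ofReal hx0, norm_real,
        Real.norm_of_nonneg (Real.sqrt_nonneg _)]
    by_contra hlt
    have := pow_lt_one₀ (norm_nonneg (root4 x)) (not_le.1 hlt) two_ne_zero
    linarith
  rw [f_eq_normF M hz, sqrtC_ofReal hx0]
  set y := Real.sqrt x
  have h1 : ‖((Real.sqrt 2 : ℂ))⁻¹‖ ≤ 1 := by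
    rw [norm_inv, norm_real, Real.norm_of_nonneg (Real.sqrt_nonneg _)]
    exact inv_le_one_of_one_le₀ (Real.one_le_sqrt.2 (by norm_num))
  have h2 : ‖exp (-(2 / 3) * (y : ℂ) ^ 3)‖ ≤ Real.exp (-y) := by
    rw [Complex.norm_exp, show -(2 / 3) * (y : ℂ) ^ 3 = ((-(2 / 3) * y ^ 3 : ℝ) : ℂ) by
      push_cast; ring, ofReal_re]
    refine Real.exp_le_exp.2 ?_
    nlinarith [mul_nonneg (by linarith : 0 ≤ y) (by nlinarith : 0 ≤ y ^ 2 - 4)]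
  have h3 : ‖((y : ℂ) ^ M)⁻¹‖ ≤ y ^ M.natAbs := by
    rw [norm_inv, norm_zpow, norm_real, Real.norm_of_nonneg (by linarith), ← zpow_neg,
      ← zpow_natCast]
    exact zpow_le_zpow_right₀ (by linarith) (by omega)
  have h4 : ‖(root4 x)⁻¹‖ ≤ 1 := by rw [norm_inv]; exact inv_le_one_of_one_le₀ hp
  simp only [norm_mul]
  calc _ ≤ 1 * Real.exp (-y) * y ^ M.natAbs * 1 * C := by gcongr
    _ = _ := by ring

lemma isBigO_g_turn (N : ℕ) {α : ℝ} (h0 : 0 ≤ α) (h1 : α ≤ Real.pi / 6) :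
    (fun x : ℝ => g N (turn α x)) =O[atTop] fun _ => (1 : ℂ) := by
  have hpi := Real.pi_pos
  obtain ⟨C, hC⟩ := normG_expansion N (δ := Real.pi / 6) (by positivity) (by linarith) 0
  simp only [Finset.range_zero, Finset.sum_empty, sub_zero, pow_zero, mul_one] at hC
  refine IsBigO.of_bound C ?_
  filter_upwards [eventually_ge_atTop 1] with x hx
  have hx0 : (0 : ℝ) < x := by linarith
  have hn : ‖turn α x‖ = x := by rw [norm_turn, norm_real, Real.norm_of_nonneg hx0.le]
  have ha : (turn α x).arg = 4 * α := by
    rw [turn_eq]; exact arg_polar hx0 (by linarith) (by linarith)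
  have h := hC (turn α x) (by rwa [hn]) (by rw [ha]; linarith) (by rw [ha]; linarith)
  rw [normG, norm_mul, norm_pow, hn] at h
  rw [norm_one, mul_one]
  exact (le_mul_of_one_le_left (norm_nonneg _) (one_le_pow₀ hx)).trans h

/-! ### Pairings of solutions with adjoint solutions -/

/-- The adjoint row of `f N` in a rotated frame. -/
def fRow (N : ℕ) (α : ℝ) (z : ℂ) : Fin 3 → ℂ :=
  adjRow (fun z => exp (α * I) ^ (2 * N + 1) * f N (turn α z))
    (fun z => exp (α * I) ^ (2 * N + 1) * exp (α * I) ^ 4 * -f (N - 1) (turn α z))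
    (fun z => exp (α * I) ^ (2 * N + 1) * (exp (α * I) ^ 4) ^ 2 * f (N - 2) (turn α z)) z

section Pairings

variable {N : ℕ} {α : ℝ} {u u1 u2 : ℂ → ℂ}

lemma fRow_pairing_const (hα : (exp (α * I) ^ 4) ^ 3 = 1) (hu : IsSol N u u1 u2) (z w : ℂ) :
    fRow N α z ⬝ᵥ ![u z, u1 z, u2 z] = fRow N α w ⬝ᵥ ![u w, u1 w, u2 w] :=
  hu.adjRow_const ((isSol_f_nat N).turn hα _) z w

/-- The pairing is constant, so it may be evaluated where the rotated variable x is positive and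
tends to infinity. There every entry of the row contains a decaying f, while the column is bounded.
-/
lemma fRow_pairing_eq_zero (hα : (exp (α * I) ^ 4) ^ 3 = 1) (hu : IsSol N u u1 u2)
    (h0 : (fun x : ℝ => u x) =O[atTop] fun _ => (1 : ℂ))
    (h1 : (fun x : ℝ => u1 x) =O[atTop] fun _ => (1 : ℂ))
    (h2 : (fun x : ℝ => u2 x) =O[atTop] fun _ => (1 : ℂ)) (k z : ℂ) :
    fRow N α z ⬝ᵥ (k • nabla (fun x => u (turn α x)) z) = 0 := by
  have hη := exp_ne_zero (α * I)
  rw [hu.smul_nabla_turn hα]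
  have hdecay : ∀ (M : ℤ) {v : ℝ → ℂ}, v =O[atTop] (fun _ => (1 : ℂ)) →
      Tendsto (fun x : ℝ => f M x * v x) atTop (𝓝 0) := fun M v hv => by
    have := ((isLittleO_one_iff ℂ).2 (tendsto_f_ofReal M)).mul_isBigO hv
    simp only [mul_one] at this
    exact (isLittleO_one_iff ℂ).1 this
  set c := exp (α * I) ^ (2 * N + 1)
  set ρ := exp (α * I) ^ 4
  have hlim : Tendsto (fun x : ℝ => c * ρ ^ 2 * N * k * (f (N + 1) x * u x)
      + c * ρ * (k * ρ) * (f (N - 1) x * u1 x) + c * (k * ρ ^ 2) * (f N x * u2 x)) atTop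
      (𝓝 0) := by
    simpa using (((hdecay _ h0).const_mul _).add ((hdecay _ h1).const_mul _)).add
      ((hdecay _ h2).const_mul _)
  refine tendsto_nhds_unique (tendsto_const_nhds.congr fun x => ?_) hlim
  have hx : turn α ((ρ)⁻¹ * x) = x := by
    rw [turn, ← mul_assoc, mul_inv_cancel₀ (pow_ne_zero _ hη), one_mul]
  rw [fRow_pairing_const hα (hu.turn hα k) z (ρ⁻¹ * x), fRow, adjRow_f_turn N hα, hx]
  simp only [dotProduct, Fin.sum_univ_three, Matrix.cons_val_zero, Matrix.cons_val_one,
    Matrix.cons_val]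
  ring

lemma isBigO_f_ofReal (M : ℤ) : (fun x : ℝ => f M x) =O[atTop] fun _ => (1 : ℂ) :=
  (tendsto_f_ofReal M).isBigO_one ℂ

lemma fRow_pairing_f (hα : (exp (α * I) ^ 4) ^ 3 = 1) (k z : ℂ) :
    fRow N α z ⬝ᵥ (k • nabla (fun x => f (1 - N) (turn α x)) z) = 0 :=
  fRow_pairing_eq_zero hα (isSol_f_one_sub N) (isBigO_f_ofReal _)
    ((isBigO_f_ofReal (-N)).neg_left) (isBigO_f_ofReal _) k z

lemma fRow_pairing_g (hα : (exp (α * I) ^ 4) ^ 3 = 1) (k z : ℂ) :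
    fRow N α z ⬝ᵥ (k • nabla (fun x => g N (turn α x)) z) = 0 := by
  have hb : ∀ M, (fun x : ℝ => g M x) =O[atTop] fun _ => (1 : ℂ) := fun M => by
    simpa [turn_zero] using isBigO_g_turn M le_rfl (by positivity)
  exact fRow_pairing_eq_zero hα (isSol_g N) (hb N) ((hb (N + 1)).const_mul_left _)
    ((hb (N + 2)).const_mul_left _) k z

/-- A positive variable turned by 2π/3 stays inside the sector -π/3 < arg < π, so g is still bounded
along it. -/
lemma fRow_pairing_g_turn (hα : (exp (α * I) ^ 4) ^ 3 = 1) (k z : ℂ) :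
    fRow N α z ⬝ᵥ (k • nabla (fun x => g N (turn (Real.pi / 6) (turn α x))) z) = 0 := by
  have h6 : (exp ((Real.pi / 6 : ℝ) * I) ^ 4) ^ 3 = 1 := by
    rw [exp_four turn_pi_div_six, omegaPow_natCast]; simp [omegaPow_three]
  have hb := fun M => isBigO_g_turn M (α := Real.pi / 6) (by positivity) le_rfl
  have h := (isSol_g N).turn h6 1
  have := fRow_pairing_eq_zero hα h ((hb N).const_mul_left _)
    (((hb (N + 1)).const_mul_left _).const_mul_left _)
    (((hb (N + 2)).const_mul_left _).const_mul_left _) k z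
  simpa only [one_mul] using this

lemma airySeries_coeff_zero (M : ℤ) : PowerSeries.coeff 0 (airySeries M) = 1 := by
  rw [airySeries, PowerSeries.coeff_mk]; exact formalF_zero M

variable {U : Set ℂ} {lo hi lo' hi' α' : ℝ}

lemma TurnsInto.tendsto_normF (h : TurnsInto U α lo hi) (hlo : -Real.pi < lo) (hhi : hi < Real.pi)
    {σ : ℂ} (hσ : σ ^ 2 = 1) (hα : exp (α * I) ^ 6 = σ) (M : ℤ) :
    Tendsto (fun z => normF M (turn α z)) (infIn U) (𝓝 1) := by
  rw [← airySeries_coeff_zero M]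
  exact (h.hasExp_normF hlo hhi hσ hα M).tendsto
    (by simpa using (tendsto_sqrtC_inv_infIn U).const_mul σ)

/-- For opposite signs the exponentials and the powers of z cancel. As z tends to infinity in the
sector, the entries with indices 1 and 2 contribute σ/2 each and the entry with index 0 tends to
zero; by constancy the pairing is σ everywhere. -/
lemma fRow_pairing_cross [(infIn U).NeBot] (h : TurnsInto U α lo hi) (hlo : -Real.pi < lo)
    (hhi : hi < Real.pi) (h' : TurnsInto U α' lo' hi') (hlo' : -Real.pi < lo') (hhi' : hi' < Real.pi)
    {σ σ' : ℂ} (hσ : σ ^ 2 = 1) (hα : exp (α * I) ^ 6 = σ) (hσ' : σ' = -σ)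
    (hα' : exp (α' * I) ^ 6 = σ') {k : ℂ}
    (hk : k * exp (α' * I) ^ (2 * N) = -σ' * exp (α' * I) ^ 3) (z : ℂ) :
    fRow N α z ⬝ᵥ (k • nabla (fun x => f (1 - N) (turn α' x)) z) = σ := by
  have hσ2 : σ' ^ 2 = 1 := by rw [hσ', neg_sq, hσ]
  have h12 : (exp (α * I) ^ 4) ^ 3 = 1 := by
    rw [← pow_mul, show 4 * 3 = 6 * 2 by norm_num, pow_mul, hα, hσ]
  have h12' : (exp (α' * I) ^ 4) ^ 3 = 1 := by
    rw [← pow_mul, show 4 * 3 = 6 * 2 by norm_num, pow_mul, hα', hσ2]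
  have hF := h.tendsto_normF hlo hhi hσ hα
  have hF' := h'.tendsto_normF hlo' hhi' hσ2 hα'
  have ht := tendsto_sqrtC_inv_infIn U
  have hlim : Tendsto (fun z => (σ / 2) * (N * σ * (sqrtC z)⁻¹ ^ 3 *
      (normF (N + 1) (turn α z) * normF (1 - N) (turn α' z)) +
      normF (N - 1) (turn α z) * normF (-N) (turn α' z) +
      normF N (turn α z) * normF (-1 - N) (turn α' z))) (infIn U) (𝓝 σ) := by
    have := (((((ht.pow 3).const_mul (N * σ)).mul ((hF (N + 1)).mul (hF' (1 - N)))).add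
      ((hF (N - 1)).mul (hF' (-N)))).add ((hF N).mul (hF' (-1 - N)))).const_mul (σ / 2)
    convert this using 2
    ring
  refine tendsto_nhds_unique (tendsto_const_nhds.congr' (eventually_infIn fun w hw _ => ?_)) hlim
  have hσ0 : σ ≠ 0 := fun h0 => by simp [h0] at hσ
  have hs := sqrtC_ne_zero (h.ne_zero w hw)
  have hp := root4_ne_zero (h.ne_zero w hw)
  rw [(isSol_f_one_sub N).smul_nabla_turn h12',
    fRow_pairing_const h12 ((isSol_f_one_sub N).turn h12' k) z w,
    ← (isSol_f_one_sub N).smul_nabla_turn h12', h'.col_eq hlo' hhi' hσ2 hα' hk hw, fRow,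
    adjRow_f_turn N h12, h.row_eq hlo hhi hσ hα N hw, hσ']
  have hE : exp (-(σ * (2 / 3 * sqrtC w ^ 3))) * exp (-(-σ * (2 / 3 * sqrtC w ^ 3))) = 1 := by
    rw [← exp_add]; simp
  have h2 : (Real.sqrt 2 : ℂ) ^ 2 = 2 := by
    rw [← ofReal_pow, Real.sq_sqrt (by norm_num)]; norm_num
  have h20 : (Real.sqrt 2 : ℂ) ≠ 0 := fun h0 => by simp [h0] at h2
  rw [smul_dotProduct, dotProduct_smul, smul_eq_mul, smul_eq_mul, ← mul_assoc]
  have hc : (Real.sqrt 2 : ℂ)⁻¹ * (root4 w ^ (2 * N + 1))⁻¹ * exp (-(σ * (2 / 3 * sqrtC w ^ 3))) *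
      (- -σ * ((Real.sqrt 2 : ℂ)⁻¹ * root4 w ^ (2 * N + 1) *
        exp (-(-σ * (2 / 3 * sqrtC w ^ 3))))) = σ / 2 := by
    calc _ = σ * ((Real.sqrt 2 : ℂ) ^ 2)⁻¹ * (exp (-(σ * (2 / 3 * sqrtC w ^ 3))) *
        exp (-(-σ * (2 / 3 * sqrtC w ^ 3)))) := by field_simp
      _ = _ := by rw [hE, h2]; ring
  rw [hc]
  congr 1
  simp only [dotProduct, Fin.sum_univ_three, Matrix.cons_val_zero, Matrix.cons_val_one,
    Matrix.cons_val]
  rw [neg_mul σ, neg_sq, mul_pow, hσ]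
  field_simp

end Pairings

/-! ### Rows of the inverse of Γ₀ in one sector -/

namespace Chart

variable {N : ℕ} {b : Angles} {U : Set ℂ} {α₁ α₂ α₃ : ℝ} {k₂ k₃ : ℂ}

lemma cube₂ (h : Chart N b U α₁ α₂ α₃ k₂ k₃) : (exp (α₂ * I) ^ 4) ^ 3 = 1 := by
  rw [← pow_mul, show 4 * 3 = 6 * 2 by norm_num, pow_mul, h.sixth₂, one_pow]

lemma cube₃ (h : Chart N b U α₁ α₂ α₃ k₂ k₃) : (exp (α₃ * I) ^ 4) ^ 3 = 1 := by
  rw [← pow_mul, show 4 * 3 = 6 * 2 by norm_num, pow_mul, h.sixth₃, neg_one_sq]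

/-- The second column of `Psi` in a sector. -/
lemma col₂_eq (h : Chart N b U α₁ α₂ α₃ k₂ k₃) {z : ℂ} (hz : z ∈ U) :
    k₂ • nabla (fun x => f (1 - N) (turn α₂ x)) z =
      (-((Real.sqrt 2 : ℂ)⁻¹ * root4 z ^ (2 * N + 1) * exp (-(2 / 3 * sqrtC z ^ 3)))) •
      ![(sqrtC z)⁻¹ ^ 2 * normF (1 - N) (turn α₂ z),
        -((sqrtC z)⁻¹ * normF (-N) (turn α₂ z)), normF (-1 - N) (turn α₂ z)] := by
  obtain ⟨lo, hi, hlo, hhi, hT⟩ := h.turns₂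
  have := hT.col_eq hlo hhi (one_pow 2) h.sixth₂ (N := N) (k := k₂)
    (by rw [h.coef₂]; ring) hz
  simpa using this

/-- The third column of `Psi` in a sector. -/
lemma col₃_eq (h : Chart N b U α₁ α₂ α₃ k₂ k₃) {z : ℂ} (hz : z ∈ U) :
    k₃ • nabla (fun x => f (1 - N) (turn α₃ x)) z =
      ((Real.sqrt 2 : ℂ)⁻¹ * root4 z ^ (2 * N + 1) * exp (2 / 3 * sqrtC z ^ 3)) •
      ![(-(sqrtC z)⁻¹) ^ 2 * normF (1 - N) (turn α₃ z),
        -(-(sqrtC z)⁻¹ * normF (-N) (turn α₃ z)), normF (-1 - N) (turn α₃ z)] := by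
  obtain ⟨lo, hi, hlo, hhi, hT⟩ := h.turns₃
  have := hT.col_eq hlo hhi (neg_one_sq) h.sixth₃ (N := N) (k := k₃)
    (by rw [h.coef₃]; ring) hz
  simpa using this

lemma hasExp_normF₂ (h : Chart N b U α₁ α₂ α₃ k₂ k₃) (M : ℤ) :
    HasExp (infIn U) (fun z => (sqrtC z)⁻¹) (fun z => normF M (turn α₂ z)) (airySeries M) := by
  obtain ⟨lo, hi, hlo, hhi, hT⟩ := h.turns₂
  simpa using hT.hasExp_normF hlo hhi (one_pow 2) h.sixth₂ M

lemma hasExp_normF₃ (h : Chart N b U α₁ α₂ α₃ k₂ k₃) (M : ℤ) :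
    HasExp (infIn U) (fun z => -(sqrtC z)⁻¹) (fun z => normF M (turn α₃ z)) (airySeries M) := by
  obtain ⟨lo, hi, hlo, hhi, hT⟩ := h.turns₃
  simpa using hT.hasExp_normF hlo hhi neg_one_sq h.sixth₃ M

lemma hasExp_normG₁ (h : Chart N b U α₁ α₂ α₃ k₂ k₃) (M : ℕ) :
    HasExp (infIn U) (fun z => z⁻¹) (fun z => normG M (turn α₁ z)) (gSeries M) := by
  obtain ⟨lo, hi, hlo, hhi, hT⟩ := h.turns₁
  exact hT.hasExp_normG hlo hhi h.cube M

lemma tendsto_normF₂ (h : Chart N b U α₁ α₂ α₃ k₂ k₃) (M : ℤ) :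
    Tendsto (fun z => normF M (turn α₂ z)) (infIn U) (𝓝 1) := by
  rw [← airySeries_coeff_zero M]
  exact (h.hasExp_normF₂ M).tendsto (tendsto_sqrtC_inv_infIn U)

lemma tendsto_normF₃ (h : Chart N b U α₁ α₂ α₃ k₂ k₃) (M : ℤ) :
    Tendsto (fun z => normF M (turn α₃ z)) (infIn U) (𝓝 1) := by
  rw [← airySeries_coeff_zero M]
  exact (h.hasExp_normF₃ M).tendsto (by simpa using (tendsto_sqrtC_inv_infIn U).neg)

lemma tendsto_normG₁ (h : Chart N b U α₁ α₂ α₃ k₂ k₃) (M : ℕ) :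
    Tendsto (fun z => normG M (turn α₁ z)) (infIn U) (𝓝 1) := by
  have e : PowerSeries.coeff 0 (gSeries M) = 1 := by
    rw [gSeries, PowerSeries.coeff_mk, if_pos (dvd_zero 3), Nat.zero_div, gCoeff_zero]
  rw [← e]
  exact (h.hasExp_normG₁ M).tendsto (tendsto_inv_infIn U)

lemma ne_zero (h : Chart N b U α₁ α₂ α₃ k₂ k₃) {z : ℂ} (hz : z ∈ U) : z ≠ 0 := by
  obtain ⟨lo, hi, hlo, hhi, hT⟩ := h.turns₁
  exact hT.ne_zero z hz

lemma gCol_eq (h : Chart N b U α₁ α₂ α₃ k₂ k₃) {z : ℂ} (hz : z ∈ U) :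
    (exp (α₁ * I) ^ 4) ^ N • nabla (fun x => g N (turn α₁ x)) z =
      (z ^ N)⁻¹ • ![normG N (turn α₁ z), -N * z⁻¹ * normG (N + 1) (turn α₁ z),
        N * (N + 1) * z⁻¹ ^ 2 * normG (N + 2) (turn α₁ z)] := by
  obtain ⟨lo, hi, hlo, hhi, hT⟩ := h.turns₁
  exact hT.gCol_eq h.cube N hz

/-- The determinant is constant, so it equals its limit at infinity in the sector, where the
exponentials of the second and third columns cancel. -/
lemma det_psi (h : Chart N b U α₁ α₂ α₃ k₂ k₃) {z : ℂ} (hz : z ∈ U) : (Psi N b z).det = 1 := by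
  have := h.neBot
  have ht := tendsto_sqrtC_inv_infIn U
  have hF := h.tendsto_normF₂
  have hF' := h.tendsto_normF₃
  have hG := h.tendsto_normG₁
  have hlim : Tendsto (fun z => (1 / 2 : ℂ) * (normG N (turn α₁ z) *
      (normF (-N) (turn α₂ z) * normF (-1 - N) (turn α₃ z) +
        normF (-N) (turn α₃ z) * normF (-1 - N) (turn α₂ z)) -
      N * (sqrtC z)⁻¹ ^ 3 * (normG (N + 1) (turn α₁ z) *
      (normF (1 - N) (turn α₂ z) * normF (-1 - N) (turn α₃ z) -
        normF (1 - N) (turn α₃ z) * normF (-1 - N) (turn α₂ z))) -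
      N * (N + 1) * (sqrtC z)⁻¹ ^ 6 * (normG (N + 2) (turn α₁ z) *
      (normF (1 - N) (turn α₂ z) * normF (-N) (turn α₃ z) +
        normF (1 - N) (turn α₃ z) * normF (-N) (turn α₂ z)))))
      (infIn U) (𝓝 1) := by
    have := ((((hG N).mul (((hF (-N)).mul (hF' (-1 - N))).add ((hF' (-N)).mul (hF (-1 - N))))).sub
      (((ht.pow 3).const_mul (N : ℂ)).mul ((hG (N + 1)).mul (((hF (1 - N)).mul (hF' (-1 - N))).sub
        ((hF' (1 - N)).mul (hF (-1 - N))))))).sub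
      (((ht.pow 6).const_mul ((N : ℂ) * (N + 1))).mul ((hG (N + 2)).mul
        (((hF (1 - N)).mul (hF' (-N))).add ((hF' (1 - N)).mul (hF (-N))))))).const_mul (1 / 2 : ℂ)
    convert this using 2
    norm_num
  refine tendsto_nhds_unique (tendsto_const_nhds.congr' (eventually_infIn fun w hw _ => ?_)) hlim
  rw [h.psi z hz, (isSol_g N).smul_nabla_turn h.cube, (isSol_f_one_sub N).smul_nabla_turn h.cube₂,
    (isSol_f_one_sub N).smul_nabla_turn h.cube₃,
    det_const ((isSol_g N).turn h.cube _) ((isSol_f_one_sub N).turn h.cube₂ _)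
      ((isSol_f_one_sub N).turn h.cube₃ _) z w,
    ← (isSol_g N).smul_nabla_turn h.cube, ← (isSol_f_one_sub N).smul_nabla_turn h.cube₂,
    ← (isSol_f_one_sub N).smul_nabla_turn h.cube₃, h.gCol_eq hw, h.col₂_eq hw, h.col₃_eq hw]
  have hw0 := h.ne_zero hw
  have hs := sqrtC_ne_zero hw0
  have hE : exp (-(2 / 3 * sqrtC w ^ 3)) * exp (2 / 3 * sqrtC w ^ 3) = 1 := by
    rw [← exp_add]; simp
  have h2 : (Real.sqrt 2 : ℂ)⁻¹ ^ 2 = 1 / 2 := by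
    rw [inv_pow, ← ofReal_pow, Real.sq_sqrt (by norm_num)]; norm_num
  set a : ℂ := (w ^ N)⁻¹
  set p2 := (Real.sqrt 2 : ℂ)⁻¹ * root4 w ^ (2 * N + 1) * exp (-(2 / 3 * sqrtC w ^ 3))
  set p3 := (Real.sqrt 2 : ℂ)⁻¹ * root4 w ^ (2 * N + 1) * exp (2 / 3 * sqrtC w ^ 3)
  have hprod : a * p2 * p3 = sqrtC w / 2 := by
    have hp : (root4 w ^ (2 * N + 1)) ^ 2 = w ^ N * sqrtC w := by
      rw [← pow_mul, show (2 * N + 1) * 2 = 2 * (2 * N + 1) by ring, pow_mul, root4_sq, pow_succ,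
        pow_mul, sqrtC_sq]
    calc a * p2 * p3 = (w ^ N)⁻¹ * ((Real.sqrt 2 : ℂ)⁻¹ ^ 2) * (root4 w ^ (2 * N + 1)) ^ 2 *
        (exp (-(2 / 3 * sqrtC w ^ 3)) * exp (2 / 3 * sqrtC w ^ 3)) := by ring
      _ = _ := by rw [hE, hp, h2]; field_simp
  have hw1 : w⁻¹ = (sqrtC w)⁻¹ ^ 2 := by rw [inv_pow, sqrtC_sq]
  rw [hw1, Matrix.det_fin_three]
  simp only [ofCols, Matrix.of_apply, Matrix.cons_val_zero, Matrix.cons_val_one, Matrix.cons_val,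
    Pi.smul_apply, smul_eq_mul]
  generalize sqrtC w = s at *
  have hs1 : s * s⁻¹ = 1 := mul_inv_cancel₀ hs
  generalize s⁻¹ = t at *
  generalize normG N (turn α₁ w) = G0
  generalize normG (N + 1) (turn α₁ w) = G1
  generalize normG (N + 2) (turn α₁ w) = G2
  generalize normF (1 - N) (turn α₂ w) = F0
  generalize normF (-N) (turn α₂ w) = F1
  generalize normF (-1 - N) (turn α₂ w) = F2
  generalize normF (1 - N) (turn α₃ w) = H0
  generalize normF (-N) (turn α₃ w) = H1
  generalize normF (-1 - N) (turn α₃ w) = H2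
  trans a * p2 * p3 * t * (G0 * (F1 * H2 + H1 * F2) -
      N * t ^ 3 * (G1 * (F0 * H2 - H0 * F2)) -
      N * (N + 1) * t ^ 6 * (G2 * (F0 * H1 + H0 * F1)))
  · ring
  · rw [hprod]
    linear_combination (1 / 2 * (G0 * (F1 * H2 + H1 * F2) -
      N * t ^ 3 * (G1 * (F0 * H2 - H0 * F2)) -
      N * (N + 1) * t ^ 6 * (G2 * (F0 * H1 + H0 * F1)))) * hs1

lemma expNegTheta_mul (z : ℂ) : exp (2 / 3 * sqrtC z ^ 3) * exp (-(2 / 3 * sqrtC z ^ 3)) = 1 := by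
  rw [← exp_add]; simp

lemma det_gamma0 (h : Chart N b U α₁ α₂ α₃ k₂ k₃) {z : ℂ} (hz : z ∈ U) :
    (Gamma0 N b z).det = 1 := by
  rw [Gamma0, Matrix.det_mul, h.det_psi hz, expNegTheta, Matrix.det_diagonal, sqrtC_cube,
    Fin.prod_univ_three]
  simpa using expNegTheta_mul z

lemma row_of_vecMul {A : Matrix (Fin 3) (Fin 3) ℂ} (hA : A.det = 1) {v : Fin 3 → ℂ} {i : Fin 3}
    (hv : Matrix.vecMul v A = Pi.single i 1) : A⁻¹ i = v := by
  have hu : IsUnit A.det := by rw [hA]; exact isUnit_one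
  change A⁻¹.row i = v
  rw [← Matrix.single_one_vecMul i A⁻¹, ← hv, Matrix.vecMul_vecMul, Matrix.mul_nonsing_inv _ hu,
    Matrix.vecMul_one]

/-- The row attached to the second column is orthogonal to the g-column and to the second column
itself, by decay, and pairs to 1 with the third. It is therefore the third row of Ψ⁻¹. -/
lemma fRow₂_vecMul (h : Chart N b U α₁ α₂ α₃ k₂ k₃) {z : ℂ} (hz : z ∈ U) :
    Matrix.vecMul (fRow N α₂ z) (Psi N b z) = ![0, 0, 1] := by
  have := h.neBot
  obtain ⟨lo, hi, hlo, hhi, hT⟩ := h.turns₂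
  obtain ⟨lo', hi', hlo', hhi', hT'⟩ := h.turns₃
  rw [h.psi z hz]
  funext j
  fin_cases j
  · change fRow N α₂ z ⬝ᵥ _ = _
    rcases h.link with ⟨h1, h2⟩ | ⟨h1, h2⟩
    · exact (by rw [h1]; exact fRow_pairing_g h.cube₂ _ z)
    · rw [h1]
      have := fRow_pairing_g_turn (N := N) h.cube₂ ((exp (α₃ * I) ^ 4) ^ N) z
      simp only [← h2] at this
      exact this
  · exact fRow_pairing_f h.cube₂ k₂ z
  · exact fRow_pairing_cross hT hlo hhi hT' hlo' hhi' (one_pow 2) h.sixth₂ rfl h.sixth₃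
      (by rw [h.coef₃]; ring) z

/-- The mirror case: here σ = -1, so the pairing with the second column is -1, and the second row of
Ψ⁻¹ carries a minus sign. -/
lemma fRow₃_vecMul (h : Chart N b U α₁ α₂ α₃ k₂ k₃) {z : ℂ} (hz : z ∈ U) :
    Matrix.vecMul (fRow N α₃ z) (Psi N b z) = ![0, -1, 0] := by
  have := h.neBot
  obtain ⟨lo, hi, hlo, hhi, hT⟩ := h.turns₂
  obtain ⟨lo', hi', hlo', hhi', hT'⟩ := h.turns₃
  rw [h.psi z hz]
  funext j
  fin_cases j
  · change fRow N α₃ z ⬝ᵥ _ = _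
    rcases h.link with ⟨h1, h2⟩ | ⟨h1, h2⟩
    · rw [h1]
      have := fRow_pairing_g_turn (N := N) h.cube₃ ((exp (α₂ * I) ^ 4) ^ N) z
      simp only [← h2] at this
      exact this
    · exact (by rw [h1]; exact fRow_pairing_g h.cube₃ _ z)
  · exact fRow_pairing_cross hT' hlo' hhi' hT hlo hhi neg_one_sq h.sixth₃ (neg_neg 1).symm h.sixth₂
      (by rw [h.coef₂]; ring) z
  · exact fRow_pairing_f h.cube₃ k₃ z

lemma gamma0_inv_two (h : Chart N b U α₁ α₂ α₃ k₂ k₃) {z : ℂ} (hz : z ∈ U) :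
    (Gamma0 N b z)⁻¹ 2 = exp (2 / 3 * sqrtC z ^ 3) • fRow N α₂ z := by
  refine row_of_vecMul (h.det_gamma0 hz) ?_
  rw [Gamma0, ← Matrix.vecMul_vecMul, Matrix.smul_vecMul, h.fRow₂_vecMul hz]
  funext j
  rw [expNegTheta, Matrix.vecMul_diagonal, sqrtC_cube]
  fin_cases j
  · simp
  · simp
  · simpa using expNegTheta_mul z

lemma gamma0_inv_one (h : Chart N b U α₁ α₂ α₃ k₂ k₃) {z : ℂ} (hz : z ∈ U) :
    (Gamma0 N b z)⁻¹ 1 = (-exp (-(2 / 3 * sqrtC z ^ 3))) • fRow N α₃ z := by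
  refine row_of_vecMul (h.det_gamma0 hz) ?_
  rw [Gamma0, ← Matrix.vecMul_vecMul, Matrix.smul_vecMul, h.fRow₃_vecMul hz]
  funext j
  rw [expNegTheta, Matrix.vecMul_diagonal, sqrtC_cube]
  fin_cases j
  · simp
  · simpa [mul_comm] using expNegTheta_mul z
  · simp

end Chart

/-! ### The matrix `Ginf` -/

lemma inv_diagonal_of_mul {d e : Fin 3 → ℂ} (h : ∀ i, d i * e i = 1) :
    (Matrix.diagonal d)⁻¹ = Matrix.diagonal e := by
  refine Matrix.inv_eq_right_inv ?_
  rw [Matrix.diagonal_mul_diagonal, ← Matrix.diagonal_one]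
  congr 1
  funext i
  exact h i

lemma isUnit_det_diagonal {d e : Fin 3 → ℂ} (h : ∀ i, d i * e i = 1) :
    IsUnit (Matrix.diagonal d).det := by
  rw [Matrix.det_diagonal, isUnit_iff_ne_zero, Finset.prod_ne_zero_iff]
  intro i _ h0
  simpa [h0] using h i

lemma inv_sqrt_two_sq : (1 / (Real.sqrt 2 : ℂ)) * (1 / (Real.sqrt 2 : ℂ)) = 1 / 2 := by
  rw [← mul_div_mul_comm, ← pow_two (Real.sqrt 2 : ℂ), ← ofReal_pow, Real.sq_sqrt (by norm_num)]
  norm_num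

lemma gmat_mul_transpose : Gmat * Gmat.transpose = 1 := by
  have h : (Real.sqrt 2 : ℂ) ^ 2 = 2 := by
    rw [← ofReal_pow, Real.sq_sqrt (by norm_num)]; norm_num
  ext i j
  simp only [Gmat, Matrix.mul_apply, Fin.sum_univ_three, Matrix.transpose_apply]
  fin_cases i <;> fin_cases j <;> simp [← pow_two] <;>
    · rw [h]; norm_num

lemma gmat_inv : Gmat⁻¹ = Gmat.transpose := Matrix.inv_eq_right_inv gmat_mul_transpose

lemma isUnit_det_gmat : IsUnit Gmat.det := by
  have h := congrArg Matrix.det gmat_mul_transpose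
  rw [Matrix.det_mul, Matrix.det_one] at h
  exact IsUnit.of_mul_eq_one _ h

section Ginf

variable {n₁ n₂ : ℕ} (lam : Fin n₁ → ℂ) (mu : Fin n₂ → ℂ)

/-- The dressing factor as a function of `z ^ (-1 / 2)`. -/
def dressing (t : ℂ) : ℂ :=
  (-1) ^ (n₁ + n₂) * ((∏ j, (1 + sqrtC (lam j) * t)) * ∏ j, (sqrtC (mu j) * t - 1))

/-- Together with `dressing_neg_inv` this shows that (-1)^n π₊ z^{-n/2} and π₋ z^{-n/2} are the
values of one polynomial at z^{-1/2} and at -z^{-1/2}. -/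
lemma dressing_inv {s : ℂ} (hs : s ≠ 0) : dressing lam mu s⁻¹ * s ^ (n₁ + n₂) =
    (-1) ^ (n₁ + n₂) * ((∏ j, (sqrtC (lam j) + s)) * ∏ j, (sqrtC (mu j) - s)) := by
  have hprod : ∀ (n : ℕ) (F : Fin n → ℂ), ∏ j, s * F j = s ^ n * ∏ j, F j := fun n F => by
    rw [Finset.prod_mul_distrib, Finset.prod_const, Finset.card_univ, Fintype.card_fin]
  have e1 : ∏ j, (sqrtC (lam j) + s) = s ^ n₁ * ∏ j, (1 + sqrtC (lam j) * s⁻¹) := by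
    rw [← hprod]
    exact Finset.prod_congr rfl fun j _ => by field_simp; ring
  have e2 : ∏ j, (sqrtC (mu j) - s) = s ^ n₂ * ∏ j, (sqrtC (mu j) * s⁻¹ - 1) := by
    rw [← hprod]
    exact Finset.prod_congr rfl fun j _ => by field_simp
  rw [dressing, e1, e2, pow_add s]; ring

lemma dressing_neg_inv {s : ℂ} (hs : s ≠ 0) : dressing lam mu (-s⁻¹) * s ^ (n₁ + n₂) =
    (∏ j, (sqrtC (lam j) - s)) * ∏ j, (sqrtC (mu j) + s) := by
  have h := dressing_inv lam mu (neg_ne_zero.2 hs)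
  rw [inv_neg, neg_pow s] at h
  simp only [sub_neg_eq_add, ← sub_eq_add_neg] at h
  have h1 : ((-1 : ℂ) ^ (n₁ + n₂)) ≠ 0 := pow_ne_zero _ (by norm_num)
  refine mul_left_cancel₀ h1 ?_
  rw [← h]; ring

/-- In J_∞ H_∞⁻¹ the inner factors z^{-S} z^S and G⁻¹ G cancel, so H_∞ only divides the dressing
factors by their leading powers of z. -/
lemma ginf_eq_mul (N : ℕ) (b : Angles) {z : ℂ} (hz : z ≠ 0) :
    Ginf N b lam mu z = Gamma0 N b z * Matrix.diagonal
      ![(∏ j, sqrtC (lam j)) * (∏ j, sqrtC (mu j)) * (z ^ N * (sqrtC z)⁻¹),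
        (root4 z ^ (2 * N + 1))⁻¹ * dressing lam mu (sqrtC z)⁻¹,
        (root4 z ^ (2 * N + 1))⁻¹ * dressing lam mu (-(sqrtC z)⁻¹)] *
      (Gmat.transpose * Matrix.diagonal ![sqrtC z, sqrtC z, 1]) := by
  have hs := sqrtC_ne_zero hz
  have hp := root4_ne_zero hz
  have hS : ∀ i, (![z ^ (-(1 / 2) : ℂ), z ^ (-(1 / 2) : ℂ), 1] : Fin 3 → ℂ) i *
      (![sqrtC z, sqrtC z, 1] : Fin 3 → ℂ) i = 1 := fun i => by
    rw [cpow_neg_half]; fin_cases i <;> simp [hs]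
  have hL : ∀ i, (![z ^ (-N + 1 / 2 : ℂ), z ^ (N / 2 + 1 / 4 : ℂ), z ^ (N / 2 + 1 / 4 : ℂ)] :
      Fin 3 → ℂ) i * (![z ^ N * (sqrtC z)⁻¹, (root4 z ^ (2 * N + 1))⁻¹,
        (root4 z ^ (2 * N + 1))⁻¹] : Fin 3 → ℂ) i = 1 := fun i => by
    rw [cpow_quarter_odd, cpow_neg_add_half hz]
    fin_cases i
    · simp; field_simp
    · simp [hp]
    · simp [hp]
  have hE : ∀ i, (![1, (-1) ^ (n₁ + n₂) * z ^ ((n₁ + n₂ : ℕ) / 2 : ℂ),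
      z ^ ((n₁ + n₂ : ℕ) / 2 : ℂ)] : Fin 3 → ℂ) i *
      (![1, (-1) ^ (n₁ + n₂) * (sqrtC z ^ (n₁ + n₂))⁻¹, (sqrtC z ^ (n₁ + n₂))⁻¹] : Fin 3 → ℂ) i
        = 1 := fun i => by
    rw [cpow_half_nat]
    have h1 : ((-1 : ℂ) ^ (n₁ + n₂)) * (-1) ^ (n₁ + n₂) = 1 := by
      rw [← mul_pow]; simp
    fin_cases i
    · simp
    · simp only [Fin.mk_one, Matrix.cons_val_one, Matrix.cons_val_zero]
      field_simp
      rw [pow_two, h1]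
    · simp [hs]
  rw [Ginf, Jinf, Hinf, powS, powL, Matrix.mul_inv_rev, Matrix.mul_inv_rev, Matrix.mul_inv_rev,
    Matrix.mul_inv_rev, Matrix.nonsing_inv_nonsing_inv _ (isUnit_det_diagonal hS),
    Matrix.nonsing_inv_nonsing_inv _ isUnit_det_gmat]
  simp only [Matrix.mul_assoc]
  rw [Matrix.nonsing_inv_mul_cancel_left _ _ (isUnit_det_diagonal hS),
    Matrix.nonsing_inv_mul_cancel_left _ _ isUnit_det_gmat, inv_diagonal_of_mul hS,
    inv_diagonal_of_mul hL, inv_diagonal_of_mul hE, gmat_inv, Dmat]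
  congr 1
  simp only [← Matrix.mul_assoc]
  congr 2
  simp only [Matrix.diagonal_mul_diagonal]
  congr 1
  funext i
  have e1 := dressing_inv lam mu hs
  have e2 := dressing_neg_inv lam mu hs
  generalize dressing lam mu (sqrtC z)⁻¹ = d at *
  generalize dressing lam mu (-(sqrtC z)⁻¹) = d' at *
  fin_cases i
  · simp
  · simp only [Fin.mk_one, Matrix.cons_val_one, Matrix.cons_val_zero]
    have hsn := pow_ne_zero (n₁ + n₂) hs
    have hpn := pow_ne_zero (2 * N + 1) hp
    rw [eq_comm, ← mul_right_inj' hsn]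
    field_simp
    linear_combination e1
  · simp only [Fin.reduceFinMk, Matrix.cons_val]
    field_simp
    linear_combination -e2

lemma ginf_zero (N : ℕ) (b : Angles) {z : ℂ} (hz : z ≠ 0) (i : Fin 3) :
    Ginf N b lam mu z i 0 =
      (∏ j, sqrtC (lam j)) * (∏ j, sqrtC (mu j)) * (z ^ N * Gamma0 N b z i 0) := by
  have hs := sqrtC_ne_zero hz
  rw [ginf_eq_mul lam mu N b hz]
  simp [Matrix.mul_apply, Fin.sum_univ_three, Matrix.diagonal_apply, Gmat]
  field_simp

lemma ginf_one (N : ℕ) (b : Angles) {z : ℂ} (hz : z ≠ 0) (i : Fin 3) :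
    Ginf N b lam mu z i 1 = sqrtC z * ((Real.sqrt 2 : ℂ)⁻¹ * (root4 z ^ (2 * N + 1))⁻¹ *
      (Gamma0 N b z i 1 * dressing lam mu (sqrtC z)⁻¹ +
        Gamma0 N b z i 2 * dressing lam mu (-(sqrtC z)⁻¹))) := by
  rw [ginf_eq_mul lam mu N b hz]
  simp [Matrix.mul_apply, Fin.sum_univ_three, Matrix.diagonal_apply, Gmat]
  ring

lemma ginf_two (N : ℕ) (b : Angles) {z : ℂ} (hz : z ≠ 0) (i : Fin 3) :
    Ginf N b lam mu z i 2 = (Real.sqrt 2 : ℂ)⁻¹ * (root4 z ^ (2 * N + 1))⁻¹ *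
      (-(Gamma0 N b z i 1 * dressing lam mu (sqrtC z)⁻¹) +
        Gamma0 N b z i 2 * dressing lam mu (-(sqrtC z)⁻¹)) := by
  rw [ginf_eq_mul lam mu N b hz]
  simp [Matrix.mul_apply, Fin.sum_univ_three, Matrix.diagonal_apply, Gmat]
  ring

/-! ### The expansion of G_∞ in integer powers -/

/-- The dressing factor as a power series. -/
def dressingSeries : PowerSeries ℂ :=
  PowerSeries.C ((-1) ^ (n₁ + n₂)) *
    ((∏ j, (1 + PowerSeries.C (sqrtC (lam j)) * PowerSeries.X)) *
      ∏ j, (PowerSeries.C (sqrtC (mu j)) * PowerSeries.X + PowerSeries.C (-1)))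

lemma hasExp_dressing {l : Filter ℂ} {t : ℂ → ℂ} (ht : Tendsto t l (𝓝 0)) :
    HasExp l t (fun z => dressing lam mu (t z)) (dressingSeries lam mu) := by
  refine HasExp.const_mul ht _ (HasExp.mul ht ?_ ?_)
  · exact HasExp.prod ht _ fun j _ => (hasExp_const 1).add ((hasExp_self ht).const_mul ht _)
  · refine HasExp.prod ht _ fun j _ => ?_
    simp only [sub_eq_add_neg]
    exact ((hasExp_self ht).const_mul ht _).add (hasExp_const (-1))

lemma dressingSeries_coeff_zero :
    PowerSeries.coeff 0 (dressingSeries lam mu) = (-1) ^ n₁ := by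
  rw [PowerSeries.coeff_zero_eq_constantCoeff, dressingSeries]
  simp only [map_mul, map_prod, map_add, PowerSeries.constantCoeff_C, PowerSeries.constantCoeff_X,
    mul_zero, zero_add, map_one, add_zero, Finset.prod_const_one, one_mul, Finset.prod_const,
    Finset.card_univ, Fintype.card_fin]
  rw [pow_add, mul_assoc, ← mul_pow]
  simp

/-- The formal solution of the bare system as a power series in `z ^ (-1 / 2)`. -/
def solSeries (N : ℕ) (i : Fin 3) : PowerSeries ℂ := PowerSeries.mk fun m => formalSol N i m

lemma solSeries_eq (N : ℕ) (i : Fin 3) : solSeries N i =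
    ![PowerSeries.X ^ 2 * airySeries (1 - N), PowerSeries.C (-1) * (PowerSeries.X * airySeries (-N)),
      airySeries (-1 - N)] i := by
  ext m
  rw [solSeries, PowerSeries.coeff_mk]
  fin_cases i
  · simp only [formalSol, Fin.zero_eta, Matrix.cons_val_zero]
    rw [PowerSeries.coeff_X_pow_mul', airySeries]
    split_ifs with h
    · rw [PowerSeries.coeff_mk]; congr 1; omega
    · rw [formalF_of_neg]; omega
  · simp only [formalSol, Fin.mk_one, Matrix.cons_val_one, Matrix.cons_val_zero]
    rw [PowerSeries.coeff_C_mul]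
    rcases m with _ | m
    · simp [formalF_of_neg]
    · rw [PowerSeries.coeff_succ_X_mul, airySeries, PowerSeries.coeff_mk]
      push_cast
      rw [add_sub_cancel_right]; ring
  · simp [formalSol, airySeries]

lemma hasExp_solSeries {l : Filter ℂ} {t F0 F1 F2 : ℂ → ℂ} (ht : Tendsto t l (𝓝 0)) (N : ℕ)
    (h0 : HasExp l t F0 (airySeries (1 - N))) (h1 : HasExp l t F1 (airySeries (-N)))
    (h2 : HasExp l t F2 (airySeries (-1 - N))) (i : Fin 3) :
    HasExp l t (fun z => (![t z ^ 2 * F0 z, -(t z * F1 z), F2 z] : Fin 3 → ℂ) i)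
      (solSeries N i) := by
  rw [solSeries_eq]
  fin_cases i
  · exact ((hasExp_self ht).pow ht 2).mul ht h0
  · have := ((hasExp_self ht).mul ht h1).const_mul ht (-1)
    simpa using this
  · exact h2

/-- The expansion of `Ginf`. -/
def ginfSeries (N : ℕ) : Matrix (Fin 3) (Fin 3) (PowerSeries ℂ) :=
  Matrix.of fun i => ![
    PowerSeries.C ((∏ j, sqrtC (lam j)) * (∏ j, sqrtC (mu j))) *
      ![gSeries N, PowerSeries.C (-N : ℂ) * (PowerSeries.X * gSeries (N + 1)),
        PowerSeries.C (N * (N + 1) : ℂ) * (PowerSeries.X ^ 2 * gSeries (N + 2))] i,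
    PowerSeries.mk fun m => -PowerSeries.coeff (2 * m + 1) (solSeries N i * dressingSeries lam mu),
    PowerSeries.mk fun m => PowerSeries.coeff (2 * m) (solSeries N i * dressingSeries lam mu)]

variable {lam mu} {N : ℕ} {b : Angles} {U : Set ℂ} {α₁ α₂ α₃ : ℝ} {k₂ k₃ : ℂ}

lemma Chart.gamma0_apply (h : Chart N b U α₁ α₂ α₃ k₂ k₃) {z : ℂ} (hz : z ∈ U) (i : Fin 3) :
    z ^ N * Gamma0 N b z i 0 = (![normG N (turn α₁ z), -N * (z⁻¹ * normG (N + 1) (turn α₁ z)),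
        N * (N + 1) * (z⁻¹ ^ 2 * normG (N + 2) (turn α₁ z))] : Fin 3 → ℂ) i ∧
    (root4 z ^ (2 * N + 1))⁻¹ * Gamma0 N b z i 1 = (Real.sqrt 2 : ℂ)⁻¹ *
      -(![(sqrtC z)⁻¹ ^ 2 * normF (1 - N) (turn α₂ z),
        -((sqrtC z)⁻¹ * normF (-N) (turn α₂ z)), normF (-1 - N) (turn α₂ z)] : Fin 3 → ℂ) i ∧
    (root4 z ^ (2 * N + 1))⁻¹ * Gamma0 N b z i 2 = (Real.sqrt 2 : ℂ)⁻¹ *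
      (![(-(sqrtC z)⁻¹) ^ 2 * normF (1 - N) (turn α₃ z),
        -(-(sqrtC z)⁻¹ * normF (-N) (turn α₃ z)), normF (-1 - N) (turn α₃ z)] : Fin 3 → ℂ) i := by
  have hz0 := h.ne_zero hz
  have hp := root4_ne_zero hz0
  have hE := Chart.expNegTheta_mul z
  rw [Gamma0, expNegTheta, Matrix.mul_diagonal, Matrix.mul_diagonal, Matrix.mul_diagonal, h.psi z hz,
    h.gCol_eq hz, h.col₂_eq hz, h.col₃_eq hz, sqrtC_cube]
  simp only [ofCols, Matrix.of_apply, Matrix.cons_val_zero, Matrix.cons_val_one, Matrix.cons_val,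
    Pi.smul_apply, smul_eq_mul]
  refine ⟨?_, ?_, ?_⟩
  · fin_cases i
    · simp; field_simp
    · simp; field_simp
    · simp; field_simp
  · generalize (![(sqrtC z)⁻¹ ^ 2 * normF (1 - N) (turn α₂ z),
        -((sqrtC z)⁻¹ * normF (-N) (turn α₂ z)), normF (-1 - N) (turn α₂ z)] : Fin 3 → ℂ) i = v
    trans (Real.sqrt 2 : ℂ)⁻¹ * -v * ((root4 z ^ (2 * N + 1))⁻¹ * root4 z ^ (2 * N + 1)) *
      (exp (2 / 3 * sqrtC z ^ 3) * exp (-(2 / 3 * sqrtC z ^ 3)))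
    · ring
    · rw [hE, inv_mul_cancel₀ (pow_ne_zero _ hp)]; ring
  · generalize (![(-(sqrtC z)⁻¹) ^ 2 * normF (1 - N) (turn α₃ z),
        -(-(sqrtC z)⁻¹ * normF (-N) (turn α₃ z)), normF (-1 - N) (turn α₃ z)] : Fin 3 → ℂ) i = v
    trans (Real.sqrt 2 : ℂ)⁻¹ * v * ((root4 z ^ (2 * N + 1))⁻¹ * root4 z ^ (2 * N + 1)) *
      (exp (2 / 3 * sqrtC z ^ 3) * exp (-(2 / 3 * sqrtC z ^ 3)))
    · ring
    · rw [hE, inv_mul_cancel₀ (pow_ne_zero _ hp)]; ring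

/-- Two functions with the same series, one in t and one in -t: in their sum the odd powers cancel,
which leaves a series in t² = z⁻¹. `HasExp.odd_part` is the counterpart for the difference, divided
by t. -/
lemma HasExp.even_part {l : Filter ℂ} {t h₁ h₂ : ℂ → ℂ} (ht : Tendsto t l (𝓝 0))
    {a : PowerSeries ℂ} (H₁ : HasExp l t h₁ a) (H₂ : HasExp l (fun z => -t z) h₂ a) :
    HasExp l (fun z => t z ^ 2) (fun z => 1 / 2 * (h₁ z + h₂ z))
      (PowerSeries.mk fun m => PowerSeries.coeff (2 * m) a) := by
  have H₂' : HasExp l t h₂ (PowerSeries.rescale (-1) a) :=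
    HasExp.rescale (by simpa only [neg_one_mul] using H₂)
  refine ((H₁.add H₂').const_mul ht (1 / 2)).of_even (fun k => ?_) fun k => ?_
  · rw [PowerSeries.coeff_C_mul, map_add, PowerSeries.coeff_rescale,
      (odd_two_mul_add_one k).neg_one_pow]
    ring
  · rw [PowerSeries.coeff_C_mul, map_add, PowerSeries.coeff_rescale, (even_two_mul k).neg_one_pow,
      PowerSeries.coeff_mk]
    ring

lemma HasExp.odd_part {l : Filter ℂ} {t h₁ h₂ : ℂ → ℂ} (ht : Tendsto t l (𝓝 0))
    (ht0 : ∀ᶠ z in l, t z ≠ 0)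
    {a : PowerSeries ℂ} (H₁ : HasExp l t h₁ a) (H₂ : HasExp l (fun z => -t z) h₂ a) :
    HasExp l (fun z => t z ^ 2) (fun z => (t z)⁻¹ * (-(1 / 2) * (h₁ z + -1 * h₂ z)))
      (PowerSeries.mk fun m => -PowerSeries.coeff (2 * m + 1) a) := by
  have H₂' : HasExp l t h₂ (PowerSeries.rescale (-1) a) :=
    HasExp.rescale (by simpa only [neg_one_mul] using H₂)
  have H := (H₁.add (H₂'.const_mul ht (-1))).const_mul ht (-(1 / 2))
  set c := PowerSeries.C (-(1 / 2) : ℂ) *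
    (a + PowerSeries.C (-1) * PowerSeries.rescale (-1) a) with hc
  have hcoeff : ∀ m, PowerSeries.coeff m c =
      -(1 / 2) * (1 - (-1) ^ m) * PowerSeries.coeff m a := fun m => by
    rw [hc, PowerSeries.coeff_C_mul, map_add, PowerSeries.coeff_C_mul, PowerSeries.coeff_rescale]
    ring
  have hX : c = PowerSeries.X * PowerSeries.mk fun m => PowerSeries.coeff (m + 1) c := by
    ext m
    rcases m with _ | m
    · rw [hcoeff]; simp
    · rw [PowerSeries.coeff_succ_X_mul, PowerSeries.coeff_mk]
  refine ((H.congr_series hX).div_self ht0).of_even (fun k => ?_) fun k => ?_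
  · rw [PowerSeries.coeff_mk, hcoeff, show 2 * k + 1 + 1 = 2 * (k + 1) by ring,
      (even_two_mul (k + 1)).neg_one_pow]
    ring
  · rw [PowerSeries.coeff_mk, PowerSeries.coeff_mk, hcoeff, (odd_two_mul_add_one k).neg_one_pow]
    ring

/-- Multiplication by G⁻¹ forms the sum and the difference of two columns that are one series at
±z^{-1/2}, and z^{-S} supplies the factor z^{1/2} that the odd part needs. The resulting series does
not refer to the sector, so the expansions in the four sectors can be glued. -/
lemma Chart.hasExp_ginf (h : Chart N b U α₁ α₂ α₃ k₂ k₃) (lam : Fin n₁ → ℂ) (mu : Fin n₂ → ℂ)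
    (i j : Fin 3) :
    HasExp (infIn U) (fun z => z⁻¹) (fun z => Ginf N b lam mu z i j) (ginfSeries lam mu N i j) := by
  have ht := tendsto_sqrtC_inv_infIn U
  have ht' : Tendsto (fun z => -(sqrtC z)⁻¹) (infIn U) (𝓝 0) := by simpa using ht.neg
  have hx := tendsto_inv_infIn U
  have e2 : (fun z : ℂ => (sqrtC z)⁻¹ ^ 2) = fun z => z⁻¹ := by
    funext z; rw [inv_pow, sqrtC_sq]
  have H₁ := (hasExp_solSeries ht N (h.hasExp_normF₂ _) (h.hasExp_normF₂ _)
    (h.hasExp_normF₂ _) i).mul ht (hasExp_dressing lam mu ht)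
  have H₂ := (hasExp_solSeries ht' N (h.hasExp_normF₃ _) (h.hasExp_normF₃ _)
    (h.hasExp_normF₃ _) i).mul ht' (hasExp_dressing lam mu ht')
  have hr : (Real.sqrt 2 : ℂ)⁻¹ * (Real.sqrt 2 : ℂ)⁻¹ = 1 / 2 := by
    simpa only [one_div] using inv_sqrt_two_sq
  fin_cases j
  · have H : HasExp (infIn U) (fun z => z⁻¹) (fun z =>
        (![normG N (turn α₁ z), -N * (z⁻¹ * normG (N + 1) (turn α₁ z)),
          N * (N + 1) * (z⁻¹ ^ 2 * normG (N + 2) (turn α₁ z))] : Fin 3 → ℂ) i)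
        (![gSeries N, PowerSeries.C (-N : ℂ) * (PowerSeries.X * gSeries (N + 1)),
        PowerSeries.C (N * (N + 1) : ℂ) * (PowerSeries.X ^ 2 * gSeries (N + 2))] i) := by
      fin_cases i
      · exact h.hasExp_normG₁ N
      · exact ((hasExp_self hx).mul hx (h.hasExp_normG₁ (N + 1))).const_mul hx _
      · exact (((hasExp_self hx).pow hx 2).mul hx (h.hasExp_normG₁ (N + 2))).const_mul hx _
    refine (H.const_mul hx ((∏ j, sqrtC (lam j)) * (∏ j, sqrtC (mu j)))).congr'
      (eventually_infIn fun z hz _ => ?_)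
    simp only [Fin.zero_eta]
    rw [ginf_zero lam mu N b (h.ne_zero hz), (h.gamma0_apply hz i).1]
  · have ht0 : ∀ᶠ z in infIn U, (sqrtC z)⁻¹ ≠ 0 :=
      eventually_infIn fun z hz _ => inv_ne_zero (sqrtC_ne_zero (h.ne_zero hz))
    have H := HasExp.odd_part ht ht0 H₁ H₂
    rw [e2] at H
    refine H.congr' (eventually_infIn fun z hz _ => ?_)
    obtain ⟨-, h2, h3⟩ := h.gamma0_apply hz i
    simp only [Fin.mk_one]
    rw [ginf_one lam mu N b (h.ne_zero hz), inv_inv]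
    generalize (![(sqrtC z)⁻¹ ^ 2 * normF (1 - N) (turn α₂ z),
        -((sqrtC z)⁻¹ * normF (-N) (turn α₂ z)), normF (-1 - N) (turn α₂ z)] : Fin 3 → ℂ) i = v at *
    generalize (![(-(sqrtC z)⁻¹) ^ 2 * normF (1 - N) (turn α₃ z),
        -(-(sqrtC z)⁻¹ * normF (-N) (turn α₃ z)), normF (-1 - N) (turn α₃ z)] : Fin 3 → ℂ) i = v'
      at *
    set d := dressing lam mu (sqrtC z)⁻¹
    set d' := dressing lam mu (-(sqrtC z)⁻¹)
    set r := (Real.sqrt 2 : ℂ)⁻¹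
    linear_combination (-(sqrtC z * r * d)) * h2 - sqrtC z * r * d' * h3 +
      sqrtC z * (d * v - d' * v') * hr
  · have H := HasExp.even_part ht H₁ H₂
    rw [e2] at H
    refine H.congr' (eventually_infIn fun z hz _ => ?_)
    obtain ⟨-, h2, h3⟩ := h.gamma0_apply hz i
    simp only [Fin.reduceFinMk]
    rw [ginf_two lam mu N b (h.ne_zero hz)]
    generalize (![(sqrtC z)⁻¹ ^ 2 * normF (1 - N) (turn α₂ z),
        -((sqrtC z)⁻¹ * normF (-N) (turn α₂ z)), normF (-1 - N) (turn α₂ z)] : Fin 3 → ℂ) i = v at *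
    generalize (![(-(sqrtC z)⁻¹) ^ 2 * normF (1 - N) (turn α₃ z),
        -(-(sqrtC z)⁻¹ * normF (-N) (turn α₃ z)), normF (-1 - N) (turn α₃ z)] : Fin 3 → ℂ) i = v'
      at *
    set d := dressing lam mu (sqrtC z)⁻¹
    set d' := dressing lam mu (-(sqrtC z)⁻¹)
    set r := (Real.sqrt 2 : ℂ)⁻¹
    linear_combination r * d * h2 - r * d' * h3 - (v * d + v' * d') * hr

lemma infIn_union (U V : Set ℂ) : infIn (U ∪ V) = infIn U ⊔ infIn V := by
  rw [infIn, infIn, infIn, ← sup_principal, inf_sup_left]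

lemma hasExpansionAtInfinity_ginf (N : ℕ) (b : Angles) (lam : Fin n₁ → ℂ) (mu : Fin n₂ → ℂ) :
    HasExpansionAtInfinity (sectors b) (Ginf N b lam mu) (ginfSeries lam mu N) := by
  intro i j
  have H : HasExp (infIn (sectors b)) (fun z => z⁻¹) (fun z => Ginf N b lam mu z i j)
      (ginfSeries lam mu N i j) := by
    rw [sectors, infIn_union, infIn_union, infIn_union]
    exact ((((chart_I b N).hasExp_ginf lam mu i j).sup
      ((chart_II b N).hasExp_ginf lam mu i j)).sup
      ((chart_III b N).hasExp_ginf lam mu i j)).sup ((chart_IV b N).hasExp_ginf lam mu i j)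
  exact H

lemma hasExpansionAtInfinity_unique {b : Angles} {F : ℂ → Matrix (Fin 3) (Fin 3) ℂ}
    {c c' : Matrix (Fin 3) (Fin 3) (PowerSeries ℂ)} (H : HasExpansionAtInfinity (sectors b) F c)
    (H' : HasExpansionAtInfinity (sectors b) F c') : c = c' := by
  -- One sector already determines the coefficients. The chart serves only to show that the filter
  -- is nontrivial, so its parameter 0 is immaterial.
  have := (chart_I b 0).neBot
  have hle : infIn (sectorI b) ≤ infIn (sectors b) :=
    inf_le_inf_left _ (principal_mono.2 fun z hz => Or.inl (Or.inl (Or.inl hz)))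
  ext1 i j
  refine HasExp.unique (l := infIn (sectorI b)) (t := fun z => z⁻¹) (h := fun z => F z i j)
    (tendsto_inv_infIn _) (eventually_infIn fun z hz _ => inv_ne_zero hz.1) (fun K => ?_)
    fun K => ?_
  · exact (H i j K).mono hle
  · exact (H' i j K).mono hle

end Ginf

/-! ### The characteristic matrix -/

/-- The geometric series 1/(z - ζ) = z⁻¹ ∑ ζ^k z^{-k}. -/
lemma formalVar_sub_C_inv (ζ : ℂ) : (formalVar - HahnSeries.C ζ)⁻¹ =
    HahnSeries.single (1 : ℤ) (1 : ℂ) *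
      HahnSeries.ofPowerSeries ℤ ℂ (PowerSeries.mk fun k => ζ ^ k) := by
  refine inv_eq_of_mul_eq_one_right ?_
  have h1 : (formalVar - HahnSeries.C ζ) * HahnSeries.single (1 : ℤ) (1 : ℂ) =
      HahnSeries.ofPowerSeries ℤ ℂ (1 - PowerSeries.C ζ * PowerSeries.X) := by
    rw [map_sub (HahnSeries.ofPowerSeries ℤ ℂ),
      map_one (HahnSeries.ofPowerSeries ℤ ℂ), map_mul (HahnSeries.ofPowerSeries ℤ ℂ),
      HahnSeries.ofPowerSeries_C, HahnSeries.ofPowerSeries_X, sub_mul, formalVar,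
      HahnSeries.single_mul_single]
    simp
  rw [← mul_assoc, h1, ← map_mul, ← map_one (HahnSeries.ofPowerSeries ℤ ℂ)]
  congr 1
  ext n
  rcases n with _ | n
  · simp [sub_mul, mul_assoc]
  · rw [sub_mul, one_mul, mul_assoc, map_sub, PowerSeries.coeff_mk, PowerSeries.coeff_C_mul,
      PowerSeries.coeff_succ_X_mul, PowerSeries.coeff_mk, PowerSeries.coeff_one, if_neg (by omega)]
    ring

lemma formalVar_pow (m : ℕ) : formalVar ^ m = HahnSeries.single (-(m : ℤ)) (1 : ℂ) := by
  rw [formalVar, HahnSeries.single_pow]; simp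

/-- The coefficient of z⁻¹ in z^m/(z - ζ) · h is the polynomial part of z^m h evaluated at ζ. -/
lemma resInfinity_eq (m : ℕ) (ζ : ℂ) (A : Fin 3 → ℂ) (c : Fin 3 → PowerSeries ℂ) :
    resInfinity (formalVar ^ m * (formalVar - HahnSeries.C ζ)⁻¹ *
      ∑ i, HahnSeries.C (A i) * HahnSeries.ofPowerSeries ℤ ℂ (c i)) =
      -∑ i, A i * ∑ q ∈ Finset.range (m + 1), ζ ^ q * PowerSeries.coeff (m - q) (c i) := by
  have e : formalVar ^ m * (formalVar - HahnSeries.C ζ)⁻¹ *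
      ∑ i, HahnSeries.C (A i) * HahnSeries.ofPowerSeries ℤ ℂ (c i) =
      HahnSeries.single (1 - (m : ℤ)) (1 : ℂ) * HahnSeries.ofPowerSeries ℤ ℂ
        ((PowerSeries.mk fun k => ζ ^ k) * ∑ i, PowerSeries.C (A i) * c i) := by
    rw [formalVar_pow, formalVar_sub_C_inv]
    simp only [← HahnSeries.ofPowerSeries_C, ← map_mul, ← map_sum]
    rw [map_mul (HahnSeries.ofPowerSeries ℤ ℂ), ← mul_assoc, ← mul_assoc,
      HahnSeries.single_mul_single, one_mul, neg_add_eq_sub]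
  rw [resInfinity, e]
  congr 1
  have hm : (1 : ℤ) = (m : ℤ) + (1 - m) := by ring
  conv_lhs => arg 2; rw [hm]
  rw [HahnSeries.coeff_single_mul_add, one_mul, HahnSeries.ofPowerSeries_apply_coeff,
    PowerSeries.coeff_mul, Finset.Nat.sum_antidiagonal_eq_sum_range_succ_mk]
  simp only [PowerSeries.coeff_mk, map_sum, PowerSeries.coeff_C_mul, Finset.mul_sum]
  rw [Finset.sum_comm]
  exact Finset.sum_congr rfl fun i _ => Finset.sum_congr rfl fun q _ => by ring

/-- Both sides are the integer-power polynomial part of z^{l/2} P v at ζ. On the right P is expanded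
in powers of z^{-1/2}, each of which lowers the level by one; powers above l contribute nothing. -/
lemma sum_coeff_eq_sum_formalPoly (N l : ℕ) (i : Fin 3) (P : PowerSeries ℂ) (ζ : ℂ) :
    ∑ q ∈ Finset.range (l / 2 + 1), ζ ^ q * PowerSeries.coeff (l - 2 * q) (solSeries N i * P) =
      ∑ j ∈ Finset.range (l + 1), PowerSeries.coeff j P *
        (formalPoly N ((l - j : ℕ) : ℤ) i).eval ζ := by
  have h1 : ∀ j ∈ Finset.range (l + 1), PowerSeries.coeff j P *
      (formalPoly N ((l - j : ℕ) : ℤ) i).eval ζ = ∑ q ∈ Finset.range (l / 2 + 1),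
        ζ ^ q * (PowerSeries.coeff j P * formalSol N i ((l : ℤ) - j - 2 * q)) := fun j hj => by
    have hj' := Finset.mem_range.1 hj
    rw [Polynomial.eval_eq_sum_range' (n := l / 2 + 1), Finset.mul_sum]
    · refine Finset.sum_congr rfl fun q _ => ?_
      rw [formalPoly_coeff, show ((l - j : ℕ) : ℤ) = (l : ℤ) - j by omega]
      ring
    · refine Nat.lt_succ_of_le (Polynomial.natDegree_le_iff_coeff_eq_zero.2 fun q hq => ?_)
      rw [formalPoly_coeff, formalSol_of_neg]
      omega
  rw [Finset.sum_congr rfl h1, Finset.sum_comm]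
  refine Finset.sum_congr rfl fun q hq => ?_
  have hq' := Finset.mem_range.1 hq
  rw [← Finset.mul_sum, mul_comm (solSeries N i), PowerSeries.coeff_mul,
    Finset.Nat.sum_antidiagonal_eq_sum_range_succ_mk]
  congr 1
  refine ((Finset.sum_congr rfl fun j hj => ?_).trans
    (Finset.sum_subset (Finset.range_mono (show l - 2 * q + 1 ≤ l + 1 by omega))
      fun j _ hj => ?_))
  · have hj' := Finset.mem_range.1 hj
    rw [solSeries, PowerSeries.coeff_mk]
    congr 2
    omega
  · rw [Finset.mem_range] at hj
    rw [formalSol_of_neg _ _ (by omega), mul_zero]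

section CharMatrix

variable {n₁ n₂ : ℕ}

/-- Even columns use even coefficients in z^{-1/2} and odd columns use minus the odd ones. The
alternation of the columns of G_∞ thus merges into one formula for level l, with the sign (-1)^l. -/
lemma charMatrix_apply (N : ℕ) (b : Angles) (lam : Fin n₁ → ℂ) (mu : Fin n₂ → ℂ)
    (k l : Fin (n₁ + n₂)) :
    charMatrix N b lam mu (ginfSeries lam mu N) k l =
      -(-1) ^ (l : ℕ) * ∑ j ∈ Finset.range (l + 1),
        PowerSeries.coeff j (dressingSeries lam mu) * (rowA N b lam mu k ⬝ᵥ
          fun i => (formalPoly N ((l - j : ℕ) : ℤ) i).eval (zeta lam mu k)) := by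
  rw [charMatrix, Matrix.of_apply, resInfinity_eq]
  have h : ∀ i : Fin 3, ∑ q ∈ Finset.range ((l : ℕ) / 2 + 1), zeta lam mu k ^ q *
      PowerSeries.coeff ((l : ℕ) / 2 - q)
        (ginfSeries lam mu N i (if (l : ℕ) % 2 = 0 then 2 else 1)) =
      (-1) ^ (l : ℕ) * ∑ j ∈ Finset.range (l + 1), PowerSeries.coeff j (dressingSeries lam mu) *
        (formalPoly N ((l - j : ℕ) : ℤ) i).eval (zeta lam mu k) := fun i => by
    rw [← sum_coeff_eq_sum_formalPoly, Finset.mul_sum]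
    refine Finset.sum_congr rfl fun q hq => ?_
    have hq' := Finset.mem_range.1 hq
    rcases Nat.even_or_odd' (l : ℕ) with ⟨m, hm | hm⟩
    · rw [if_pos (by omega), hm, (even_two_mul m).neg_one_pow]
      simp only [ginfSeries, Matrix.of_apply, Matrix.cons_val, PowerSeries.coeff_mk]
      rw [one_mul]
      congr 3
      omega
    · rw [if_neg (by omega), hm, (odd_two_mul_add_one m).neg_one_pow]
      simp only [ginfSeries, Matrix.of_apply, Matrix.cons_val_one, Matrix.cons_val_zero,
        PowerSeries.coeff_mk]
      rw [show 2 * ((2 * m + 1) / 2 - q) + 1 = 2 * m + 1 - 2 * q by omega]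
      ring
  simp only [h, dotProduct]
  simp only [Finset.mul_sum, ← Finset.sum_neg_distrib]
  rw [Finset.sum_comm]
  exact Finset.sum_congr rfl fun j _ => Finset.sum_congr rfl fun i _ => by ring

/-! ### Adjoint rows at the points, and the determinant -/

lemma mem_sectors_iff {b : Angles} {p : ℂ} : p ∈ sectors b ↔
    ((p ∈ sectorI b ∨ p ∈ sectorII b) ∨ p ∈ sectorIII b) ∨ p ∈ sectorIV b := Iff.rfl

lemma Chart.exists_adjRow {N : ℕ} {b : Angles} {U : Set ℂ} {α₁ α₂ α₃ : ℝ} {k₂ k₃ : ℂ}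
    (h : Chart N b U α₁ α₂ α₃ k₂ k₃) {p : ℂ} (hp : p ∈ U) :
    (∃ φ1 φ2, IsSol (1 - N) (phiLam N b p) φ1 φ2 ∧ (Gamma0 N b p)⁻¹ 2 =
      exp (2 / 3 * p ^ (3 / 2 : ℂ)) • adjRow (phiLam N b p) φ1 φ2 p) ∧
    (∃ φ1 φ2, IsSol (1 - N) (phiMu N b p) φ1 φ2 ∧ (Gamma0 N b p)⁻¹ 1 =
      (-exp (-(2 / 3 * p ^ (3 / 2 : ℂ)))) • adjRow (phiMu N b p) φ1 φ2 p) := by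
  rw [h.lam p hp, h.mu p hp, sqrtC_cube, h.gamma0_inv_two hp, h.gamma0_inv_one hp]
  exact ⟨⟨_, _, (isSol_f_nat N).turn h.cube₂ _, rfl⟩, ⟨_, _, (isSol_f_nat N).turn h.cube₃ _, rfl⟩⟩

lemma exists_adjRow {N : ℕ} {b : Angles} {p : ℂ} (hp : p ∈ sectors b) :
    (∃ φ1 φ2, IsSol (1 - N) (phiLam N b p) φ1 φ2 ∧ (Gamma0 N b p)⁻¹ 2 =
      exp (2 / 3 * p ^ (3 / 2 : ℂ)) • adjRow (phiLam N b p) φ1 φ2 p) ∧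
    (∃ φ1 φ2, IsSol (1 - N) (phiMu N b p) φ1 φ2 ∧ (Gamma0 N b p)⁻¹ 1 =
      (-exp (-(2 / 3 * p ^ (3 / 2 : ℂ)))) • adjRow (phiMu N b p) φ1 φ2 p) := by
  rcases mem_sectors_iff.1 hp with ((h | h) | h) | h
  · exact (chart_I b N).exists_adjRow h
  · exact (chart_II b N).exists_adjRow h
  · exact (chart_III b N).exists_adjRow h
  · exact (chart_IV b N).exists_adjRow h

/-- The scalar factors of the rows `rowA`. -/
def rowFactor (lam : Fin n₁ → ℂ) (mu : Fin n₂ → ℂ) : Fin (n₁ + n₂) → ℂ :=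
  Fin.append (fun k => exp (2 / 3 * lam k ^ (3 / 2 : ℂ)))
    (fun k => -exp (-(2 / 3 * mu k ^ (3 / 2 : ℂ))))

lemma prod_rowFactor (lam : Fin n₁ → ℂ) (mu : Fin n₂ → ℂ) :
    ∏ k, rowFactor lam mu k = (-1) ^ n₂ * exp (Q lam mu) := by
  have h2 : ∏ k, -exp (-(2 / 3 * mu k ^ (3 / 2 : ℂ))) =
      (-1) ^ n₂ * ∏ k, exp (-(2 / 3 * mu k ^ (3 / 2 : ℂ))) := by
    rw [Finset.prod_neg, Finset.card_univ, Fintype.card_fin]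
  rw [Fin.prod_univ_add]
  simp only [rowFactor, Fin.append_left, Fin.append_right]
  rw [h2, ← exp_sum, ← exp_sum, mul_left_comm, ← exp_add, Q, Finset.sum_neg_distrib,
    ← Finset.mul_sum, ← Finset.mul_sum, sub_eq_add_neg]

/-- The functions `φ_k`. -/
def phiAll (N : ℕ) (b : Angles) (lam : Fin n₁ → ℂ) (mu : Fin n₂ → ℂ) :
    Fin (n₁ + n₂) → ℂ → ℂ :=
  Fin.append (fun k => phiLam N b (lam k)) (fun k => phiMu N b (mu k))

lemma exists_rowA_eq (N : ℕ) {b : Angles} {lam : Fin n₁ → ℂ} {mu : Fin n₂ → ℂ}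
    (hlam : ∀ k, lam k ∈ sectors b) (hmu : ∀ k, mu k ∈ sectors b) (k : Fin (n₁ + n₂)) :
    ∃ φ1 φ2, IsSol (1 - N) (phiAll N b lam mu k) φ1 φ2 ∧ rowA N b lam mu k =
      rowFactor lam mu k • adjRow (phiAll N b lam mu k) φ1 φ2 (zeta lam mu k) := by
  induction k using Fin.addCases with
  | left k =>
    simp only [phiAll, rowA, rowFactor, zeta, Fin.append_left]
    exact (exists_adjRow (hlam k)).1
  | right k =>
    simp only [phiAll, rowA, rowFactor, zeta, Fin.append_right]
    exact (exists_adjRow (hmu k)).2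

/-- The sign that relates the two determinants. -/
def detSign (n₁ n₂ : ℕ) : ℂ := (-1) ^ n₂ * ∏ l : Fin (n₁ + n₂), (-(-1) ^ (l : ℕ) * (-1) ^ n₁)

lemma detSign_eq (n₁ n₂ : ℕ) : detSign n₁ n₂ = 1 ∨ detSign n₁ n₂ = -1 := by
  have h : ∀ n : ℕ, ((-1 : ℂ) ^ n) * (-1) ^ n = 1 := fun n => by rw [← mul_pow]; simp
  refine mul_self_eq_one_iff.1 ?_
  rw [detSign, mul_mul_mul_comm, h, one_mul, ← Finset.prod_mul_distrib]
  refine Finset.prod_eq_one fun l _ => ?_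
  rw [mul_mul_mul_comm, neg_mul_neg, h, h, one_mul]

/-- The pairing of the k-th row with the l-th column is the row factor times u_l(∂)φ_k at ζ_k, where
deg u_l ≤ l. Writing u_l in the monomial basis factors the matrix as diagonal times Wronskian times
upper triangular. -/
lemma det_charMatrix (N : ℕ) {b : Angles} {lam : Fin n₁ → ℂ} {mu : Fin n₂ → ℂ}
    (hlam : ∀ k, lam k ∈ sectors b) (hmu : ∀ k, mu k ∈ sectors b) :
    (charMatrix N b lam mu (ginfSeries lam mu N)).det =
      detSign n₁ n₂ * exp (Q lam mu) * (wronskianMatrix N b lam mu).det := by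
  choose m hdeg hlead hm using exists_diffOperator N
  set P := dressingSeries lam mu
  set u : ℕ → Polynomial ℂ := fun l => ∑ j ∈ Finset.range (l + 1),
    Polynomial.C (-(-1) ^ l * PowerSeries.coeff j P) * m (l - j)
  have hu_deg : ∀ l, (u l).natDegree ≤ l := fun l =>
    Polynomial.natDegree_sum_le_of_forall_le _ _ fun j _ =>
      (Polynomial.natDegree_C_mul_le _ _).trans ((hdeg _).trans (Nat.sub_le _ _))
  -- Only the summand j = 0 reaches degree l. Its coefficient is the constant term (-1)^{n₁} of the
  -- dressing series, so the leading coefficient is a sign independent of the points and of `N`.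
  have hu_lead : ∀ l, (u l).coeff l = -(-1) ^ l * (-1) ^ n₁ := fun l => by
    simp only [u]
    rw [Polynomial.finsetSum_coeff, Finset.sum_eq_single 0]
    · rw [Polynomial.coeff_C_mul, Nat.sub_zero, hlead, dressingSeries_coeff_zero, mul_one]
    · intro j hj h0
      have hj' := Finset.mem_range.1 hj
      rw [Polynomial.coeff_C_mul, Polynomial.coeff_eq_zero_of_natDegree_lt
        ((hdeg _).trans_lt (by omega)), mul_zero]
    · simp
  set T : Matrix (Fin (n₁ + n₂)) (Fin (n₁ + n₂)) ℂ := Matrix.of fun j l => (u l).coeff j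
  have hT : T.det = ∏ l : Fin (n₁ + n₂), (-(-1) ^ (l : ℕ) * (-1) ^ n₁) := by
    rw [Matrix.det_of_isUpperTriangular]
    · exact Finset.prod_congr rfl fun l _ => hu_lead l
    · intro i j hij
      exact Polynomial.coeff_eq_zero_of_natDegree_lt ((hu_deg _).trans_lt hij)
  have hmat : charMatrix N b lam mu (ginfSeries lam mu N) =
      Matrix.diagonal (rowFactor lam mu) * (wronskianMatrix N b lam mu * T) := by
    ext k l
    obtain ⟨φ1, φ2, hφ, hrow⟩ := exists_rowA_eq N hlam hmu k
    have hsum : applyDiff (phiAll N b lam mu k) (zeta lam mu k) (u l) =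
        ∑ j : Fin (n₁ + n₂), wronskianMatrix N b lam mu k j * T j l := by
      rw [applyDiff_eq_sum _ _ _ ((hu_deg l).trans_lt l.2), Finset.sum_range]
      exact Finset.sum_congr rfl fun j _ => mul_comm _ _
    rw [charMatrix_apply, Matrix.diagonal_mul, Matrix.mul_apply, ← hsum, hrow]
    simp only [u, map_sum, smul_dotProduct, hm _ _ _ _ hφ, ← Polynomial.smul_eq_C_mul, map_smul,
      smul_eq_mul, Finset.mul_sum]
    exact Finset.sum_congr rfl fun j _ => by ring
  rw [hmat, Matrix.det_mul, Matrix.det_mul, Matrix.det_diagonal, prod_rowFactor, hT, detSign]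
  ring

end CharMatrix

end

end KontsevichPenner

theorem mainTheorem6 (n₁ n₂ : ℕ) :
    -- one sign, which depends only on the numbers of points
    ∃ ε : ℂ, (ε = 1 ∨ ε = -1) ∧
      ∀ (N : ℕ) (b : KontsevichPenner.Angles) (lam : Fin n₁ → ℂ) (mu : Fin n₂ → ℂ),
        (∀ k, lam k ∈ KontsevichPenner.sectors b) →
        (∀ k, mu k ∈ KontsevichPenner.sectors b) →
        -- `c` is the formal expansion of `G_∞` at infinity: it exists and is unique
        ∃ c : Matrix (Fin 3) (Fin 3) (PowerSeries ℂ),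
          KontsevichPenner.HasExpansionAtInfinity (KontsevichPenner.sectors b)
            (KontsevichPenner.Ginf N b lam mu) c ∧
          (∀ c', KontsevichPenner.HasExpansionAtInfinity (KontsevichPenner.sectors b)
            (KontsevichPenner.Ginf N b lam mu) c' → c' = c) ∧
          (KontsevichPenner.charMatrix N b lam mu c).det =
            ε * Complex.exp (KontsevichPenner.Q lam mu) *
              (KontsevichPenner.wronskianMatrix N b lam mu).det := by
  refine ⟨KontsevichPenner.detSign n₁ n₂, KontsevichPenner.detSign_eq n₁ n₂,
    fun N b lam mu hlam hmu => ⟨KontsevichPenner.ginfSeries lam mu N,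
      KontsevichPenner.hasExpansionAtInfinity_ginf N b lam mu, fun c' hc' => ?_,
      KontsevichPenner.det_charMatrix N hlam hmu⟩⟩
  exact KontsevichPenner.hasExpansionAtInfinity_unique hc'
    (KontsevichPenner.hasExpansionAtInfinity_ginf N b lam mu)
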